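/- Let $(M,\mathsf g)$ be a compact connected smooth Riemannian manifold without boundary, with volume density $\mu$. Let $V\in C^\infty(M,\mathbb R)$, let $f\colon\mathbb R_{>0}\to\mathbb R$ be smooth and let $F\colon\mathbb R_{>0}\to\mathbb R$ be a primitive of $f$. Let $\mathrm{Dens}(M)=\{\rho\mu : \rho\in C^\infty(M),\ \rho>0,\ \int_M\rho\,\mu=1\}$ and $T^*\mathrm{Dens}(M)=\mathrm{Dens}(M)\times C^\infty(M)/\mathbb R$, with the canonical symplectic form $\omega\big((\dot\rho_1,\dot\theta_1),(\dot\rho_2,\dot\theta_2)\big)=\int_M(\dot\rho_1\dot\theta_2-\dot\rho_2\dot\theta_1)\mu$. Let $PC^\infty(M,\mathbb C)$ be the unit $L^2$-sphere of $C^\infty(M,\mathbb C)$ modulo constant phases, and $PC^\infty(M,\mathbb C\setminus\{0\})$ its subset of classes of nowhere vanishing functions. Both spaces carry the Fréchet topology and smooth structure of $C^\infty$ functions. Let $\Omega(\psi_1,\psi_2)=\mathrm{Im}\int_M\overline{\psi_1}\psi_2\,\mu$, which induces a symplectic form on $PC^\infty(M,\mathbb C)$. The Madelung transform is $\Phi(\rho\mu,[\theta])=[\sqrt{\rho\,e^{i\theta}}]$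 with $\sqrt{\rho\,e^{i\theta}}:=\sqrt\rho\,e^{i\theta/2}$. Put $$\bar U(\rho)=\frac12\int_M\frac{|\nabla\rho|^2}{\rho}\mu+2\int_M V\rho\,\mu+2\int_M F(\rho)\mu .$$ 1. $\Phi$ is a symplectomorphism of $(T^*\mathrm{Dens}(M),\omega)$ onto an open subset of $PC^\infty(M,\mathbb C)$ with the symplectic form induced by $4\Omega$: it is a homeomorphism onto its image, is smooth with smooth inverse, and pulls the one form back to the other. The image consists of classes of nowhere vanishing functions, and equals $PC^\infty(M,\mathbb C\setminus\{0\})$ if $M$ is simply connected. 2. For $\rho\mu\in\mathrm{Dens}(M)$ the variational derivative of $\bar U$ is $\delta\bar U/\delta\varrho=2V+2f(\rho)-2\Delta\sqrt\rho/\sqrt\rho$, and the system $$\dot\theta+\tfrac12|\nabla\theta|^2+2V+2f(\rho)-\frac{2\Delta\sqrt\rho}{\sqrt\rho}=0,\qquad \dot\rho+\mathrm{div}(\rho\nabla\theta)=0\tag{A}$$ is the Hamiltonian system on $(T^*\mathrm{Dens}(M),\omega)$ of $H(\rho,\theta)=\frac12\int_M|\nabla\theta|^2\rho\,\mu+\bar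 U(\rho)$. 3. On nowhere vanishing functions, the Schrödinger equation $$i\dot\psi=-\Delta\psi+V\psi+f(|\psi|^2)\psi\tag{B}$$ is the Hamiltonian system, with respect to $\Omega$, of $H_S(\psi)=\frac12\int_M|\nabla\psi|^2\mu+\frac12\int_M\big(V|\psi|^2+F(|\psi|^2)\big)\mu$. 4. $H=4H_S\circ\Phi$ on $T^*\mathrm{Dens}(M)$. 5. Let $J\subseteq\mathbb R$ be an open interval. For functions $\rho>0$ and $\theta$ which are smooth on $J\times M$, $(\rho,\theta)$ solves (A) if and only if $\psi=\sqrt\rho\,e^{i\theta/2}$ solves (B). A curve $c\colon J\to T^*\mathrm{Dens}(M)$ is a solution of (A) (that is, is represented by a smooth $(\rho,\theta)$ which solves (A)) if and only if $\Phi\circ c$ is a solution of (B) (that is, is represented by a smooth $\psi$ with values in the unit sphere which solves (B)). If $c$ is represented by smooth functions $(\rho,\theta)$, then $c$ is a solution of (A) if and only if $(v,\rho)$ with $v=\nabla\theta$ is a (potential) solution of the quantum-corrected barotropic system $$\dot v+\nabla_vv+\nabla\Big(2V+2f(\rho)-\frac{2\Delta\sqrt\rho}{\sqrt\rho}\Big)=0,\qquad\dot\rho+\mathrm{div}(\rho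 v)=0 .$$ -/

import Mathlib

open Set Filter Topology MeasureTheory
open scoped Manifold ContDiff

noncomputable section

namespace Madelung

universe u v

/-! ### Smooth functions and their Fréchet topology -/

/-- Real-valued smooth functions on `M`. -/
abbrev CR (n : ℕ) (M : Type u) [TopologicalSpace M] [ChartedSpace (EuclideanSpace ℝ (Fin n)) M] :
    Type u :=
  C^∞⟮𝓡 n, M; 𝓘(ℝ, ℝ), ℝ⟯

/-- Complex-valued smooth functions on `M`. -/
abbrev CC (n : ℕ) (M : Type u) [TopologicalSpace M] [ChartedSpace (EuclideanSpace ℝ (Fin n)) M] :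
    Type u :=
  C^∞⟮𝓡 n, M; 𝓘(ℝ, ℂ), ℂ⟯

/-- The Fréchet topology of `C^∞(M, W)`: uniform convergence of all the derivatives in charts, on
compact subsets of the chart domains. -/
instance smoothTopology {n : ℕ} {M : Type u} [TopologicalSpace M]
    [ChartedSpace (EuclideanSpace ℝ (Fin n)) M]
    {W : Type v} [NormedAddCommGroup W] [NormedSpace ℝ W] :
    TopologicalSpace C^∞⟮𝓡 n, M; 𝓘(ℝ, W), W⟯ :=
  ⨅ (x₀ : M) (k : ℕ), TopologicalSpace.induced
    (fun u : C^∞⟮𝓡 n, M; 𝓘(ℝ, W), W⟯ =>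
      UniformOnFun.ofFun {K | IsCompact K ∧ K ⊆ (extChartAt (𝓡 n) x₀).target}
        (iteratedFDeriv ℝ k (fun y : EuclideanSpace ℝ (Fin n) =>
          u ((extChartAt (𝓡 n) x₀).symm y))))
    inferInstance

/-! ### Smooth maps between (manifolds modelled on) Fréchet spaces -/

/-- `w` is the derivative of `h` at `x` in the direction `v`. -/
def HasDirDeriv {F : Type u} {G : Type v}
    [AddCommGroup F] [Module ℝ F]
    [AddCommGroup G] [Module ℝ G] [TopologicalSpace G]
    (h : F → G) (x v : F) (w : G) : Prop :=
  Tendsto (fun t : ℝ => t⁻¹ • (h (x + t • v) - h x)) (𝓝[≠] 0) (𝓝 w)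

/-- Maps of class `C^k` (in the sense of Michal, Bastiani and Hamilton) on a set `U` which is
meant to be open: the map is continuous and, if `k > 0`, all its directional derivatives exist and
the derivative is of class `C^(k-1)` jointly in the point and the direction. -/
def IsCk {G : Type v} [AddCommGroup G] [Module ℝ G] [TopologicalSpace G] :
    ℕ → ∀ (F : Type u) [AddCommGroup F] [Module ℝ F] [TopologicalSpace F],
      Set F → (F → G) → Prop
  | 0, _, _, _, _, U, h => ContinuousOn h U
  | k + 1, F, _, _, _, U, h => ContinuousOn h U ∧ ∃ dh : F × F → G,
      (∀ x ∈ U, ∀ v, HasDirDeriv h x v (dh (x, v))) ∧ IsCk k (F × F) (U ×ˢ univ) dh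

/-- Smooth maps on open subsets of Fréchet spaces. -/
def FrechetSmoothOn {F : Type u} {G : Type v}
    [AddCommGroup F] [Module ℝ F] [TopologicalSpace F]
    [AddCommGroup G] [Module ℝ G] [TopologicalSpace G]
    (U : Set F) (h : F → G) : Prop :=
  ∀ k : ℕ, IsCk k F U h

/-- Let `X` and `Y` be quotients, by maps `πX` and `πY`, of subsets `S` and `T` of `F` and `G`.
The map `l`, defined on the open set `N ⊆ F`, is a smooth local lift of `h : X → Y`. -/
def IsSmoothLift {F : Type u} {G : Type v}
    [AddCommGroup F] [Module ℝ F] [TopologicalSpace F]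
    [AddCommGroup G] [Module ℝ G] [TopologicalSpace G] {X Y : Type*}
    {S : Set F} (πX : S → X) {T : Set G} (πY : T → Y)
    (h : X → Y) (N : Set F) (l : F → G) : Prop :=
  IsOpen N ∧ FrechetSmoothOn N l ∧
    ∀ (q : F) (hq : q ∈ S), q ∈ N → ∃ hlq : l q ∈ T, πY ⟨l q, hlq⟩ = h (πX ⟨q, hq⟩)

/-! ### Riemannian geometry -/

/-- Smooth Riemannian metrics on `M`. -/
abbrev Metric (n : ℕ) (M : Type u) [TopologicalSpace M]
    [ChartedSpace (EuclideanSpace ℝ (Fin n)) M] [IsManifold (𝓡 n) ∞ M] : Type u :=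
  Bundle.ContMDiffRiemannianMetric (𝓡 n) ∞ (EuclideanSpace ℝ (Fin n))
    (fun x : M => TangentSpace (𝓡 n) x)

section Riemannian

variable {n : ℕ} {M : Type u} [TopologicalSpace M] [ChartedSpace (EuclideanSpace ℝ (Fin n)) M]
  [IsManifold (𝓡 n) ∞ M] (g : Metric n M)

/-- The squared length of a tangent vector. -/
def normSq (x : M) (v : TangentSpace (𝓡 n) x) : ℝ := g.inner x v v

theorem exists_gradient (x : M) (l : TangentSpace (𝓡 n) x →L[ℝ] ℝ) :
    ∃ v : TangentSpace (𝓡 n) x, ∀ w : TangentSpace (𝓡 n) x, g.inner x v w = l w := by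
  have : FiniteDimensional ℝ (TangentSpace (𝓡 n) x) :=
    inferInstanceAs (FiniteDimensional ℝ (EuclideanSpace ℝ (Fin n)))
  let B : TangentSpace (𝓡 n) x →ₗ[ℝ] Module.Dual ℝ (TangentSpace (𝓡 n) x) :=
    { toFun := fun v => (g.inner x v).toLinearMap
      map_add' := fun v w => by ext; simp
      map_smul' := fun c v => by ext; simp }
  have hB : Function.Injective B := by
    refine (injective_iff_map_eq_zero B).2 fun v hv => ?_
    by_contra hne
    have h1 : g.inner x v v = 0 := by
      have := congrArg (fun φ : Module.Dual ℝ (TangentSpace (𝓡 n) x) => φ v) hv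
      simpa [B] using this
    exact (g.pos x v hne).ne' h1
  have hs : Function.Surjective B :=
    (LinearMap.injective_iff_surjective_of_finrank_eq_finrank
      (Subspace.dual_finrank_eq (K := ℝ) (V := TangentSpace (𝓡 n) x)).symm).1 hB
  obtain ⟨v, hv⟩ := hs l.toLinearMap
  exact ⟨v, fun w => congrArg (fun φ : Module.Dual ℝ (TangentSpace (𝓡 n) x) => φ w) hv⟩

/-- The Riemannian gradient: `g(∇u, w) = du(w)`. -/
def grad (u : M → ℝ) (x : M) : TangentSpace (𝓡 n) x :=
  (exists_gradient g x (mfderiv (𝓡 n) 𝓘(ℝ, ℝ) u x)).choose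

theorem grad_spec (u : M → ℝ) (x : M) (w : TangentSpace (𝓡 n) x) :
    g.inner x (grad g u x) w = mfderiv (𝓡 n) 𝓘(ℝ, ℝ) u x w :=
  (exists_gradient g x (mfderiv (𝓡 n) 𝓘(ℝ, ℝ) u x)).choose_spec w

/-- The `i`-th vector of the standard basis of the model space. -/
def stdVec (i : Fin n) : EuclideanSpace ℝ (Fin n) := EuclideanSpace.single i 1

/-- The coordinate vector field `∂/∂yⁱ` of the chart at `x₀`, at the point with coordinates `y`. -/
def coordVec (x₀ : M) (y : EuclideanSpace ℝ (Fin n)) (i : Fin n) :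
    TangentSpace (𝓡 n) ((extChartAt (𝓡 n) x₀).symm y) :=
  mfderiv 𝓘(ℝ, EuclideanSpace ℝ (Fin n)) (𝓡 n) (extChartAt (𝓡 n) x₀).symm y (stdVec i)

/-- The matrix `g_ij` of the metric in the chart at `x₀`, as a function of the coordinates. -/
def gram (x₀ : M) (y : EuclideanSpace ℝ (Fin n)) : Matrix (Fin n) (Fin n) ℝ :=
  Matrix.of fun i j =>
    g.inner ((extChartAt (𝓡 n) x₀).symm y) (coordVec x₀ y i) (coordVec x₀ y j)

/-- The `i`-th coordinate of a vector of the model space. -/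
def coord (v : EuclideanSpace ℝ (Fin n)) (i : Fin n) : ℝ := v i

/-- The `i`-th component of the vector field `X` in the chart at `x₀`, as a function of the
coordinates. -/
def comp (x₀ : M) (X : ∀ x : M, TangentSpace (𝓡 n) x) (y : EuclideanSpace ℝ (Fin n))
    (i : Fin n) : ℝ :=
  coord (mfderiv (𝓡 n) 𝓘(ℝ, EuclideanSpace ℝ (Fin n)) (extChartAt (𝓡 n) x₀)
    ((extChartAt (𝓡 n) x₀).symm y) (X ((extChartAt (𝓡 n) x₀).symm y))) i

/-- The tangent vector at `x` with the given components in the chart at `x` (by definition, the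
tangent space at `x` is the model space, through the derivative of the chart at `x`). -/
def ofComponents (x : M) (v : Fin n → ℝ) : TangentSpace (𝓡 n) x :=
  (WithLp.toLp 2 v : EuclideanSpace ℝ (Fin n))

/-- The partial derivative with respect to the `i`-th coordinate. -/
def pd (i : Fin n) (h : EuclideanSpace ℝ (Fin n) → ℝ) (y : EuclideanSpace ℝ (Fin n)) : ℝ :=
  fderiv ℝ h y (stdVec i)

/-- The Riemannian divergence `(det g)^(-1/2) ∂ᵢ((det g)^(1/2) Xⁱ)`, computed at `x` in the chart
at `x`. -/
def divg (X : ∀ x : M, TangentSpace (𝓡 n) x) (x : M) : ℝ :=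
  (√(gram g x (extChartAt (𝓡 n) x x)).det)⁻¹ *
    ∑ i, pd i (fun y => √(gram g x y).det * comp x X y i) (extChartAt (𝓡 n) x x)

/-- The Laplace-Beltrami operator. -/
def lap (u : M → ℝ) (x : M) : ℝ := divg g (grad g u) x

/-- The Laplace-Beltrami operator on complex-valued functions. -/
def lapC (ψ : M → ℂ) (x : M) : ℂ :=
  (lap g (fun x => (ψ x).re) x : ℂ) + Complex.I * (lap g (fun x => (ψ x).im) x : ℂ)

/-- The squared length of the (complex) gradient of a complex-valued function. -/
def gradNormSqC (ψ : M → ℂ) (x : M) : ℝ :=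
  normSq g x (grad g (fun x => (ψ x).re) x) + normSq g x (grad g (fun x => (ψ x).im) x)

/-- Christoffel symbols `Γᵏᵢⱼ` of the chart at `x₀`. -/
def christoffel (x₀ : M) (y : EuclideanSpace ℝ (Fin n)) (k i j : Fin n) : ℝ :=
  (1 / 2) * ∑ l, (gram g x₀ y)⁻¹ k l *
    (pd i (fun z => gram g x₀ z j l) y + pd j (fun z => gram g x₀ z i l) y
      - pd l (fun z => gram g x₀ z i j) y)

/-- The Levi-Civita covariant derivative `∇_X Y`, with components
`Xʲ ∂ⱼYᵏ + Γᵏᵢⱼ Xⁱ Yʲ`, computed at `x` in the chart at `x`. -/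
def covDeriv (X Y : ∀ x : M, TangentSpace (𝓡 n) x) (x : M) : TangentSpace (𝓡 n) x :=
  ofComponents x fun k =>
    (∑ j, comp x X (extChartAt (𝓡 n) x x) j *
        pd j (fun y => comp x Y y k) (extChartAt (𝓡 n) x x))
    + ∑ i, ∑ j, christoffel g x (extChartAt (𝓡 n) x x) k i j *
        comp x X (extChartAt (𝓡 n) x x) i * comp x Y (extChartAt (𝓡 n) x x) j

section Volume

variable [T2Space M] [SigmaCompactSpace M] [MeasurableSpace M]

variable (n M) in
/-- A smooth partition of unity subordinate to the charts. -/
def chartPartition : SmoothPartitionOfUnity M (𝓡 n) M univ :=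
  (SmoothPartitionOfUnity.exists_isSubordinate_chartAt_source (𝓡 n) M).choose

/-- The Riemannian volume measure (density): `∑ᵢ χᵢ (det g)^(1/2) dy¹ ⋯ dyⁿ` for a partition of
unity `χᵢ` subordinate to charts. -/
def vol : Measure M :=
  Measure.sum fun x₀ : M =>
    (((volume : Measure (EuclideanSpace ℝ (Fin n))).restrict
        (extChartAt (𝓡 n) x₀).target).withDensity fun y =>
      ENNReal.ofReal
        (chartPartition n M x₀ ((extChartAt (𝓡 n) x₀).symm y) * √(gram g x₀ y).det)).map
      (extChartAt (𝓡 n) x₀).symm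

end Volume

end Riemannian

/-! ### The Madelung function -/

/-- `√(ρ e^{iθ}) = √ρ e^{iθ/2}`. -/
def madelungFun {M : Type u} (ρ θ : M → ℝ) (x : M) : ℂ :=
  (√(ρ x) : ℂ) * Complex.exp ((θ x / 2 : ℝ) * Complex.I)

theorem norm_sq_madelungFun {M : Type u} (ρ θ : M → ℝ) (x : M) (hx : 0 ≤ ρ x) :
    ‖madelungFun ρ θ x‖ ^ 2 = ρ x := by
  rw [madelungFun, norm_mul, Complex.norm_exp_ofReal_mul_I, mul_one, Complex.norm_real,
    Real.norm_eq_abs, sq_abs, Real.sq_sqrt hx]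

theorem contMDiff_madelungFun {n : ℕ} {M : Type u} [TopologicalSpace M]
    [ChartedSpace (EuclideanSpace ℝ (Fin n)) M] (ρ θ : CR n M) (hρ : ∀ x, 0 < ρ x) :
    ContMDiff (𝓡 n) 𝓘(ℝ, ℂ) ∞ (madelungFun ρ θ) := by
  intro x
  have h : ContDiffAt ℝ ∞ (fun q : ℝ × ℝ =>
      (√q.1 : ℂ) * Complex.exp ((q.2 / 2 : ℝ) * Complex.I)) (ρ x, θ x) := by
    have h1 : ContDiffAt ℝ ∞ (fun q : ℝ × ℝ => √q.1) (ρ x, θ x) :=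
      contDiffAt_fst.sqrt (hρ x).ne'
    have h2 : ContDiffAt ℝ ∞ (fun q : ℝ × ℝ => (√q.1 : ℂ)) (ρ x, θ x) :=
      Complex.ofRealCLM.contDiff.contDiffAt.comp _ h1
    have h3 : ContDiffAt ℝ ∞ (fun q : ℝ × ℝ => ((q.2 / 2 : ℝ) : ℂ)) (ρ x, θ x) :=
      Complex.ofRealCLM.contDiff.contDiffAt.comp _ (contDiffAt_snd.div_const 2)
    exact h2.mul (h3.mul contDiffAt_const).cexp
  exact h.contMDiffAt.comp x ((ρ.contMDiff x).prodMk_space (θ.contMDiff x))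

/-! ### The two phase spaces -/

section PhaseSpaces

variable {n : ℕ} {M : Type u} [TopologicalSpace M] [ChartedSpace (EuclideanSpace ℝ (Fin n)) M]
  [IsManifold (𝓡 n) ∞ M] [T2Space M] [SigmaCompactSpace M] [MeasurableSpace M] (g : Metric n M)

/-- The density `ρ μ` is a positive smooth density of total volume 1. -/
def IsDens (ρ : CR n M) : Prop := (∀ x, 0 < ρ x) ∧ ∫ x, ρ x ∂(vol g) = 1

/-- The space `Dens(M)`; the density `ρ μ` is represented by the function `ρ`. -/
abbrev Dens : Type u := {ρ : CR n M // IsDens g ρ}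

variable (n M) in
/-- The constant functions. -/
def constants : Submodule ℝ (CR n M) := Submodule.span ℝ {1}

/-- `T*Dens(M) = Dens(M) × C^∞(M)/ℝ`. -/
abbrev CotDens : Type u := Dens g × (CR n M ⧸ constants n M)

/-- Pairs `(ρ, θ)` representing points of `T*Dens(M)`. -/
def cotPairs : Set (CR n M × CR n M) := {p | IsDens g p.1}

/-- The projection `(ρ, θ) ↦ (ρ, [θ])`. -/
def cotMk (p : cotPairs g) : CotDens g := (⟨p.1.1, p.2⟩, Submodule.Quotient.mk p.1.2)

/-- The unit `L²`-sphere of smooth wave functions. -/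
def waveSphere : Set (CC n M) := {ψ | ∫ x, ‖ψ x‖ ^ 2 ∂(vol g) = 1}

/-- Wave functions which differ by a constant phase. -/
def phaseSetoid : Setoid (waveSphere g) where
  r ψ φ := ∃ α : ℝ, ∀ x, φ.1 x = Complex.exp (α * Complex.I) * ψ.1 x
  iseqv :=
    { refl := fun ψ => ⟨0, fun x => by simp⟩
      symm := by
        rintro ψ φ ⟨α, h⟩
        refine ⟨-α, fun x => ?_⟩
        rw [h x, ← mul_assoc, ← Complex.exp_add]
        simp
      trans := by
        rintro ψ φ χ ⟨α, h⟩ ⟨β, h'⟩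
        refine ⟨β + α, fun x => ?_⟩
        rw [h' x, h x, ← mul_assoc, ← Complex.exp_add]
        push_cast
        ring_nf }

/-- The projective space `PC^∞(M, ℂ)`, with the quotient topology. -/
abbrev ProjWave : Type u := Quotient (phaseSetoid g)

/-- The projection `ψ ↦ [ψ]`. -/
def projMk (ψ : waveSphere g) : ProjWave g := Quotient.mk (phaseSetoid g) ψ

/-- The subset `PC^∞(M, ℂ ∖ {0})` of classes of nowhere vanishing functions. -/
def nonvanishing : Set (ProjWave g) := {c | ∃ ψ : waveSphere g, (∀ x, ψ.1 x ≠ 0) ∧ projMk g ψ = c}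

/-- The canonical symplectic form of `T*Dens(M)` on tangent vectors `(ρ̇, θ̇)`. -/
def cotForm (X Y : (M → ℝ) × (M → ℝ)) : ℝ :=
  ∫ x, (X.1 x * Y.2 x - Y.1 x * X.2 x) ∂(vol g)

/-- The symplectic form `Im ⟨·,·⟩` on wave functions, for the Hermitian `L²` inner product which is
antilinear in the first slot; restricted to the unit sphere it descends to a symplectic form on the
projective space. -/
def waveForm (η ζ : M → ℂ) : ℝ :=
  (∫ x, (starRingEnd ℂ) (η x) * ζ x ∂(vol g)).im

/-- A map `Φ : T*Dens(M) → PC^∞(M, ℂ)` is a symplectomorphism onto the open subset `U`, for the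
canonical symplectic form of `T*Dens(M)` and four times the form induced by `waveForm`: it is a
homeomorphism onto `U`, smooth in both directions, and it pulls back the second form to the
first. -/
def IsSymplectomorphismOnto (Φ : CotDens g → ProjWave g) (U : Set (ProjWave g)) : Prop :=
  IsOpenEmbedding Φ ∧ range Φ = U ∧
  (∀ p ∈ cotPairs g, ∃ (N : Set (CR n M × CR n M)) (l : CR n M × CR n M → CC n M),
    p ∈ N ∧ IsSmoothLift (cotMk g) (projMk g) Φ N l ∧
    ∀ X Y : CR n M × CR n M, ∫ x, X.1 x ∂(vol g) = 0 → ∫ x, Y.1 x ∂(vol g) = 0 →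
      ∀ η ζ : CC n M, HasDirDeriv l p X η → HasDirDeriv l p Y ζ →
        4 * waveForm g η ζ = cotForm g (X.1, X.2) (Y.1, Y.2)) ∧
  ∃ Ψ : ProjWave g → CotDens g, Function.LeftInverse Ψ Φ ∧
    ∀ (ψ : CC n M) (hψ : ψ ∈ waveSphere g), projMk g ⟨ψ, hψ⟩ ∈ U →
      ∃ (N : Set (CC n M)) (l : CC n M → CR n M × CR n M),
        ψ ∈ N ∧ IsSmoothLift (projMk g) (cotMk g) Ψ N l

/-- The Madelung transform `(ρ, θ) ↦ √ρ e^{iθ/2}` as an element of the unit sphere. -/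
def madelungSphere (p : cotPairs g) : waveSphere g :=
  ⟨⟨madelungFun p.1.1 p.1.2, contMDiff_madelungFun p.1.1 p.1.2 p.2.1⟩, by
    change ∫ x, ‖madelungFun p.1.1 p.1.2 x‖ ^ 2 ∂(vol g) = 1
    rw [← p.2.2]
    refine integral_congr_ae (Eventually.of_forall fun x => ?_)
    exact norm_sq_madelungFun p.1.1 p.1.2 x (p.2.1 x).le⟩

/-- The Madelung transform `T*Dens(M) → PC^∞(M, ℂ)`, `(ρ, [θ]) ↦ [√ρ e^{iθ/2}]`. -/
def madelung (c : CotDens g) : ProjWave g :=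
  Quotient.liftOn' c.2 (fun θ => projMk g (madelungSphere g ⟨(c.1.1, θ), c.1.2⟩)) (by
    intro θ θ' h
    obtain ⟨a, ha⟩ := Submodule.mem_span_singleton.1 ((Submodule.quotientRel_def _).1 h)
    refine Quotient.sound ⟨-a / 2, fun x => ?_⟩
    have hx : θ x = θ' x + a := by
      have := congrArg (fun u : CR n M => u x) ha
      simp at this
      linarith
    change madelungFun c.1.1 θ' x = _ * madelungFun c.1.1 θ x
    simp only [madelungFun, hx]
    rw [mul_left_comm, ← Complex.exp_add]
    push_cast
    ring_nf)

/-! ### The equations -/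

section Equations

variable (V : M → ℝ) (f F : ℝ → ℝ)

/-- Fisher's information functional. -/
def fisherInfo (ρ : M → ℝ) : ℝ := (1 / 8) * ∫ x, normSq g x (grad g ρ x) / ρ x ∂(vol g)

/-- The potential `Ū(ρ) = 4 I(ρ) + 2 ∫ V ρ μ + 2 ∫ F(ρ) μ`. -/
def potential (ρ : M → ℝ) : ℝ :=
  4 * fisherInfo g ρ + 2 * ∫ x, V x * ρ x ∂(vol g) + 2 * ∫ x, F (ρ x) ∂(vol g)

/-- The function `2V + 2f(ρ) - 2Δ√ρ/√ρ`. -/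
def quantumPotential (ρ : M → ℝ) (x : M) : ℝ :=
  2 * V x + 2 * f (ρ x) - 2 * lap g (fun x => √(ρ x)) x / √(ρ x)

/-- `w` is the variational derivative `δU/δϱ` at `ρ`. -/
def IsVariationalDeriv (U : (M → ℝ) → ℝ) (ρ w : M → ℝ) : Prop :=
  ∀ α : CR n M, HasDerivAt (fun ε : ℝ => U fun x => ρ x + ε * α x)
    (∫ x, w x * α x ∂(vol g)) 0

/-- The Hamiltonian `½ ∫ |∇θ|² ρ μ + Ū(ρ)` on `T*Dens(M)`. -/
def cotHamiltonian (p : (M → ℝ) × (M → ℝ)) : ℝ :=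
  (1 / 2) * ∫ x, normSq g x (grad g p.2 x) * p.1 x ∂(vol g) + potential g V F p.1

/-- The Hamiltonian vector field `(ρ̇, θ̇) = (-div(ρ∇θ), -½|∇θ|² - (2V + 2f(ρ) - 2Δ√ρ/√ρ))`. -/
def cotField (p : (M → ℝ) × (M → ℝ)) : (M → ℝ) × (M → ℝ) :=
  (fun x => -divg g (fun y => p.1 y • grad g p.2 y) x,
    fun x => -((1 / 2) * normSq g x (grad g p.2 x)) - quantumPotential g V f p.1 x)

/-- The Hamiltonian `½ ‖∇ψ‖² + ½ ∫ (V|ψ|² + F(|ψ|²)) μ` of the Schrödinger equation. -/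
def waveHamiltonian (ψ : M → ℂ) : ℝ :=
  (1 / 2) * ∫ x, gradNormSqC g ψ x ∂(vol g)
    + (1 / 2) * ∫ x, (V x * ‖ψ x‖ ^ 2 + F (‖ψ x‖ ^ 2)) ∂(vol g)

/-- `-Δψ + Vψ + f(|ψ|²)ψ`. -/
def schrodingerOp (ψ : M → ℂ) (x : M) : ℂ :=
  -lapC g ψ x + (V x : ℂ) * ψ x + (f (‖ψ x‖ ^ 2) : ℂ) * ψ x

/-- A curve of functions, given for times in `J`, is smooth jointly in time and space. -/
def JointlySmooth {W : Type*} [NormedAddCommGroup W] [NormedSpace ℝ W]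
    (J : Set ℝ) (u : ℝ → C^∞⟮𝓡 n, M; 𝓘(ℝ, W), W⟯) : Prop :=
  ContMDiffOn (𝓘(ℝ, ℝ).prod (𝓡 n)) 𝓘(ℝ, W) ∞ (fun p : ℝ × M => u p.1 p.2) (J ×ˢ univ)

/-- `θ̇ + ½|∇θ|² + 2V + 2f(ρ) - 2Δ√ρ/√ρ = 0` and `ρ̇ + div(ρ∇θ) = 0` for times in `J`. -/
def SolvesHam (J : Set ℝ) (ρ θ : ℝ → M → ℝ) : Prop :=
  ∀ t ∈ J, ∀ x,
    deriv (fun s => θ s x) t + (1 / 2) * normSq g x (grad g (θ t) x)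
      + quantumPotential g V f (ρ t) x = 0 ∧
    deriv (fun s => ρ s x) t + divg g (fun y => ρ t y • grad g (θ t) y) x = 0

/-- The time derivative of a time-dependent vector field, in the fixed vector space `T_x M`. -/
def timeDeriv (v : ℝ → ∀ x : M, TangentSpace (𝓡 n) x) (t : ℝ) (x : M) : TangentSpace (𝓡 n) x :=
  deriv (F := EuclideanSpace ℝ (Fin n)) (fun s => v s x) t

/-- `v̇ + ∇_v v + ∇(2V + 2f(ρ) - 2Δ√ρ/√ρ) = 0` and `ρ̇ + div(ρv) = 0` for times in `J`. -/
def SolvesBarotropic (J : Set ℝ) (ρ : ℝ → M → ℝ) (v : ℝ → ∀ x : M, TangentSpace (𝓡 n) x) : Prop :=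
  ∀ t ∈ J, ∀ x,
    timeDeriv v t x + covDeriv g (v t) (v t) x
      + grad g (quantumPotential g V f (ρ t)) x = 0 ∧
    deriv (fun s => ρ s x) t + divg g (fun y => ρ t y • v t y) x = 0

/-- `iψ̇ = -Δψ + Vψ + f(|ψ|²)ψ` for times in `J`. -/
def SolvesSchrodinger (J : Set ℝ) (ψ : ℝ → M → ℂ) : Prop :=
  ∀ t ∈ J, ∀ x, Complex.I * deriv (fun s => ψ s x) t = schrodingerOp g V f (ψ t) x

/-- `(ρ, θ)` is a smooth curve which represents the curve `c` in `T*Dens(M)` for times in `J`. -/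
def RepresentsCot (J : Set ℝ) (c : ℝ → CotDens g) (ρ θ : ℝ → CR n M) : Prop :=
  JointlySmooth J ρ ∧ JointlySmooth J θ ∧
    ∀ t ∈ J, ∃ h : (ρ t, θ t) ∈ cotPairs g, cotMk g ⟨(ρ t, θ t), h⟩ = c t

/-- `ψ` is a smooth curve which represents the curve `c` in `PC^∞(M, ℂ)` for times in `J`. -/
def RepresentsWave (J : Set ℝ) (c : ℝ → ProjWave g) (ψ : ℝ → CC n M) : Prop :=
  JointlySmooth J ψ ∧ ∀ t ∈ J, ∃ h : ψ t ∈ waveSphere g, projMk g ⟨ψ t, h⟩ = c t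

/-- The curve `c` is a solution of the Hamiltonian system on `T*Dens(M)`. -/
def IsHamTrajectory (J : Set ℝ) (c : ℝ → CotDens g) : Prop :=
  ∃ ρ θ : ℝ → CR n M, RepresentsCot g J c ρ θ ∧
    SolvesHam g V f J (fun t => ρ t) (fun t => θ t)

/-- The curve `c` is a solution of the Schrödinger equation on the projective space. -/
def IsSchrodingerTrajectory (J : Set ℝ) (c : ℝ → ProjWave g) : Prop :=
  ∃ ψ : ℝ → CC n M, RepresentsWave g J c ψ ∧ SolvesSchrodinger g V f J (fun t => ψ t)

end Equations

end PhaseSpaces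

end Madelung

end

set_option linter.unusedSectionVars false

noncomputable section

namespace Madelung

universe u v

/-! ### Smooth dependence of determinants and inverse matrices. -/

section MatrixCalculus

variable {G : Type*} [NormedAddCommGroup G] [NormedSpace ℝ G] {ι : Type*} [Fintype ι]
  [DecidableEq ι]

/-! Write ψ = √ρ e^{iθ/2}. The logarithmic derivative of this polar map is ρ̇/(2ρ) + iθ̇/2, and
three pointwise identities follow. First, Im(conj ψ̇₁ · ψ̇₂) = ¼(ρ̇₁θ̇₂ − ρ̇₂θ̇₁), which integrates
to the relation between the symplectic forms (`four_mul_waveForm_eq_cotForm`). Second, 4|∇ψ|² =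
|∇ρ|²/ρ + ρ|∇θ|², which relates the Hamiltonians (`gradNormSqC_madelungFun`). Third, e^{-iθ/2}(−Δψ +
Vψ + f(|ψ|²)ψ) has real part √ρ/2 times the spatial terms of the Hamilton-Jacobi equation and
imaginary part −div(ρ∇θ)/(2√ρ) (`schrodingerOp_madelungFun`). Comparing the latter with iψ̇ turns
(B) into (A).

The Madelung transform is injective because ρ = |ψ|² and because two continuous phases of the same
function differ by a function with values in 4πℤ, hence by a constant on a connected manifold. Near
ψ an explicit inverse is q ↦ (|q|², θ + 2 arg(q/ψ)) (`exists_local_phase`). Both the transform and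
this inverse are superposition operators u ↦ φ ∘ u. The derivative of such an operator is again a
superposition operator, which gives Fréchet smoothness by induction (`isCk_superpose`). On a simply
connected manifold a continuous logarithm of ψ supplies a global phase.

The Hamiltonian statements are first variations: differentiate under the integral over the compact
M, then integrate by parts (`integral_mul_divg`). The volume is defined by a partition of unity and
the divergence by a formula in the chart at each point. The divergence theorem is therefore proved
from change of variables and integration in ℝⁿ, and the independence of the divergence from the
chart follows from the local, weak form of it.

A curve of classes gives only one unrelated representative for each time. To obtain a jointly smooth
phase, constants are added so that the phase at a base point is continuous in time; connectedness
then forces the rest (`jointlySmooth_phase`). For v = ∇θ the left-hand side of the fluid equation is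
the gradient of the Hamilton-Jacobi expression, since ∇_v v = ∇(½|v|²) for gradient fields
(`covDeriv_grad_self`). If it vanishes, that expression depends on time only and can be absorbed
into θ without changing its class. -/

theorem contDiffOn_det {A : G → Matrix ι ι ℝ} {s : Set G}
    (h : ∀ i j, ContDiffOn ℝ ∞ (fun y => A y i j) s) :
    ContDiffOn ℝ ∞ (fun y => (A y).det) s := by
  simp only [Matrix.det_apply]
  exact ContDiffOn.sum fun σ _ => (contDiffOn_prod fun i _ => h _ _).const_smul _

/-- Cramer's rule: an entry of the inverse is a cofactor divided by the determinant, and a cofactor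
is the determinant of the matrix with one row replaced by constants. -/
theorem contDiffOn_inv_matrix {A : G → Matrix ι ι ℝ} {s : Set G}
    (h : ∀ i j, ContDiffOn ℝ ∞ (fun y => A y i j) s) (h0 : ∀ y ∈ s, (A y).det ≠ 0) (i j : ι) :
    ContDiffOn ℝ ∞ (fun y => (A y)⁻¹ i j) s := by
  have : (fun y => (A y)⁻¹ i j) = fun y => ((A y).det)⁻¹ * (A y).adjugate i j := by
    funext y
    simp [Matrix.inv_def, Matrix.smul_apply, Ring.inverse_eq_inv']
  rw [this]
  refine ((contDiffOn_det h).inv h0).mul ?_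
  simp only [Matrix.adjugate_apply]
  refine contDiffOn_det fun k l => ?_
  by_cases hk : k = j
  · subst hk
    simp only [Matrix.updateRow_self]
    exact contDiffOn_const
  · simp only [Matrix.updateRow_ne hk]
    exact h k l

end MatrixCalculus

/-! ### Metric, gradient and differential in coordinates. -/

section Charts

variable {n : ℕ} {M : Type u} [TopologicalSpace M] [ChartedSpace (EuclideanSpace ℝ (Fin n)) M]
  [IsManifold (𝓡 n) ∞ M]

section

omit [IsManifold (𝓡 n) ∞ M]

theorem isOpen_target (x₀ : M) : IsOpen (extChartAt (𝓡 n) x₀).target :=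
  isOpen_extChartAt_target x₀

theorem target_mem_nhds {x₀ : M} {y : EuclideanSpace ℝ (Fin n)}
    (hy : y ∈ (extChartAt (𝓡 n) x₀).target) : (extChartAt (𝓡 n) x₀).target ∈ 𝓝 y :=
  (isOpen_target x₀).mem_nhds hy

theorem sum_coord_smul_stdVec (w : EuclideanSpace ℝ (Fin n)) : ∑ i, coord w i • stdVec i = w := by
  ext j
  simp [coord, stdVec, Finset.sum_apply, Pi.single_apply]

theorem fderiv_eq_sum_pd (h : EuclideanSpace ℝ (Fin n) → ℝ) (y w : EuclideanSpace ℝ (Fin n)) :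
    fderiv ℝ h y w = ∑ i, coord w i * pd i h y := by
  conv_lhs => rw [← sum_coord_smul_stdVec w]
  simp [map_sum, pd]

end

theorem mdifferentiableAt_symm {x₀ : M} {y : EuclideanSpace ℝ (Fin n)}
    (hy : y ∈ (extChartAt (𝓡 n) x₀).target) :
    MDifferentiableAt 𝓘(ℝ, EuclideanSpace ℝ (Fin n)) (𝓡 n) (extChartAt (𝓡 n) x₀).symm y :=
  (((contMDiffOn_extChartAt_symm (n := ∞) x₀) y hy).contMDiffAt
    (target_mem_nhds hy)).mdifferentiableAt (by simp)

theorem mdifferentiableAt_chart {x₀ x : M} (hx : x ∈ (extChartAt (𝓡 n) x₀).source) :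
    MDifferentiableAt (𝓡 n) 𝓘(ℝ, EuclideanSpace ℝ (Fin n)) (extChartAt (𝓡 n) x₀) x :=
  mdifferentiableAt_extChartAt (by rwa [extChartAt_source] at hx)

/-- The derivative of the inverse of the chart at `x₀`. -/
def dsymm (x₀ : M) (y : EuclideanSpace ℝ (Fin n)) :
    EuclideanSpace ℝ (Fin n) →L[ℝ] TangentSpace (𝓡 n) ((extChartAt (𝓡 n) x₀).symm y) :=
  mfderiv 𝓘(ℝ, EuclideanSpace ℝ (Fin n)) (𝓡 n) (extChartAt (𝓡 n) x₀).symm y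

/-- The derivative of the chart at `x₀`. -/
def dchart (x₀ x : M) : TangentSpace (𝓡 n) x →L[ℝ] EuclideanSpace ℝ (Fin n) :=
  mfderiv (𝓡 n) 𝓘(ℝ, EuclideanSpace ℝ (Fin n)) (extChartAt (𝓡 n) x₀) x

theorem dchart_dsymm {x₀ : M} {y : EuclideanSpace ℝ (Fin n)}
    (hy : y ∈ (extChartAt (𝓡 n) x₀).target) (w : EuclideanSpace ℝ (Fin n)) :
    dchart x₀ ((extChartAt (𝓡 n) x₀).symm y) (dsymm x₀ y w) = w := by
  have h := mfderiv_extChartAt_comp_mfderivWithin_extChartAt_symm (I := 𝓡 n) hy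
  have hr : range (𝓡 n) = univ := ModelWithCorners.range_eq_univ _
  rw [hr, mfderivWithin_univ] at h
  exact congrArg (fun L : EuclideanSpace ℝ (Fin n) →L[ℝ] EuclideanSpace ℝ (Fin n) => L w) h

theorem dsymm_dchart {x₀ : M} {y : EuclideanSpace ℝ (Fin n)}
    (hy : y ∈ (extChartAt (𝓡 n) x₀).target)
    (v : TangentSpace (𝓡 n) ((extChartAt (𝓡 n) x₀).symm y)) :
    dsymm x₀ y (dchart x₀ ((extChartAt (𝓡 n) x₀).symm y) v) = v := by
  have h := mfderivWithin_extChartAt_symm_comp_mfderiv_extChartAt (I := 𝓡 n) hy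
  have hr : range (𝓡 n) = univ := ModelWithCorners.range_eq_univ _
  rw [hr, mfderivWithin_univ] at h
  exact congrArg (fun L : EuclideanSpace ℝ (Fin n) →L[ℝ] EuclideanSpace ℝ (Fin n) => L v) h

theorem dsymm_sum (x₀ : M) (y : EuclideanSpace ℝ (Fin n)) (a : Fin n → ℝ) :
    dsymm x₀ y (∑ i, a i • stdVec i) = ∑ i, a i • coordVec x₀ y i := by
  simp only [map_sum, map_smul]
  rfl

theorem eq_sum_comp {x₀ : M} {y : EuclideanSpace ℝ (Fin n)}
    (hy : y ∈ (extChartAt (𝓡 n) x₀).target) (X : ∀ x : M, TangentSpace (𝓡 n) x) :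
    X ((extChartAt (𝓡 n) x₀).symm y) = ∑ i, comp x₀ X y i • coordVec x₀ y i := by
  rw [← dsymm_sum, ← dsymm_dchart hy (X ((extChartAt (𝓡 n) x₀).symm y)),
    ← sum_coord_smul_stdVec (dchart x₀ _ (X ((extChartAt (𝓡 n) x₀).symm y)))]
  rfl

variable (g : Metric n M)

theorem inner_eq_sum {x₀ : M} {y : EuclideanSpace ℝ (Fin n)}
    (hy : y ∈ (extChartAt (𝓡 n) x₀).target) (X Y : ∀ x : M, TangentSpace (𝓡 n) x) :
    g.inner ((extChartAt (𝓡 n) x₀).symm y) (X ((extChartAt (𝓡 n) x₀).symm y))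
      (Y ((extChartAt (𝓡 n) x₀).symm y)) =
      ∑ i, ∑ j, gram g x₀ y i j * comp x₀ X y i * comp x₀ Y y j := by
  rw [eq_sum_comp hy X, eq_sum_comp hy Y]
  simp only [map_sum, map_smul, FunLike.coe_sum, Finset.sum_apply,
    smul_apply, smul_eq_mul, gram, Matrix.of_apply, Finset.mul_sum]
  refine Finset.sum_comm.trans ?_
  refine Finset.sum_congr rfl fun i _ => Finset.sum_congr rfl fun j _ => by ring

theorem pd_comp_symm {x₀ : M} {y : EuclideanSpace ℝ (Fin n)}
    (hy : y ∈ (extChartAt (𝓡 n) x₀).target) {u : M → ℝ}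
    (hu : MDifferentiableAt (𝓡 n) 𝓘(ℝ, ℝ) u ((extChartAt (𝓡 n) x₀).symm y)) (i : Fin n) :
    pd i (fun z => u ((extChartAt (𝓡 n) x₀).symm z)) y =
      mfderiv (𝓡 n) 𝓘(ℝ, ℝ) u ((extChartAt (𝓡 n) x₀).symm y) (coordVec x₀ y i) := by
  have h := mfderiv_comp (I' := 𝓡 n) (g := u) y hu (mdifferentiableAt_symm hy)
  rw [mfderiv_eq_fderiv] at h
  exact congrArg (fun L : EuclideanSpace ℝ (Fin n) →L[ℝ] ℝ => L (stdVec i)) h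

/-- The coordinate field is the tangent map of the inverse chart applied to a constant field.
Smoothness into the tangent bundle is the form in which it can be inserted into the metric. -/
theorem contMDiffOn_coordVec (x₀ : M) (i : Fin n) :
    ContMDiffOn 𝓘(ℝ, EuclideanSpace ℝ (Fin n)) (𝓡 n).tangent ∞
      (fun y => (⟨(extChartAt (𝓡 n) x₀).symm y, coordVec x₀ y i⟩ : TangentBundle (𝓡 n) M))
      (extChartAt (𝓡 n) x₀).target := by
  have h := (contMDiffOn_extChartAt_symm (n := ∞) (I := 𝓡 n) x₀).contMDiffOn_tangentMapWithin
    (m := ∞) le_rfl (isOpen_target x₀).uniqueMDiffOn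
  have h2 : ContMDiff 𝓘(ℝ, EuclideanSpace ℝ (Fin n)) (𝓘(ℝ, EuclideanSpace ℝ (Fin n)).tangent) ∞
      (fun y : EuclideanSpace ℝ (Fin n) => (⟨y, stdVec i⟩ :
        TangentBundle 𝓘(ℝ, EuclideanSpace ℝ (Fin n)) (EuclideanSpace ℝ (Fin n)))) :=
    contMDiff_vectorSpace_iff_contDiff.2 contDiff_const
  refine (h.comp h2.contMDiffOn (s := (extChartAt (𝓡 n) x₀).target)
    (fun y hy => hy)).congr fun y hy => ?_
  simp only [Function.comp, tangentMapWithin, coordVec]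
  rw [mfderivWithin_of_isOpen (isOpen_target x₀) hy]

/-- The metric is a smooth section of bilinear forms. Evaluating it on two coordinate fields gives a
smooth section of the trivial line bundle, whose fibre component is g_ij. -/
theorem contDiffOn_gram (x₀ : M) (i j : Fin n) :
    ContDiffOn ℝ ∞ (fun y => gram g x₀ y i j) (extChartAt (𝓡 n) x₀).target := by
  rw [← contMDiffOn_iff_contDiffOn]
  intro y hy
  have : ContMDiffWithinAt 𝓘(ℝ, EuclideanSpace ℝ (Fin n)) ((𝓡 n).prod 𝓘(ℝ)) ∞
      (fun m ↦ Bundle.TotalSpace.mk' ℝ (E := Bundle.Trivial M ℝ) ((extChartAt (𝓡 n) x₀).symm m)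
        (g.inner ((extChartAt (𝓡 n) x₀).symm m) (coordVec x₀ m i) (coordVec x₀ m j)))
      (extChartAt (𝓡 n) x₀).target y := by
    apply ContMDiffWithinAt.clm_bundle_apply₂ (F₁ := EuclideanSpace ℝ (Fin n))
      (F₂ := EuclideanSpace ℝ (Fin n))
    · exact ContMDiffAt.comp_contMDiffWithinAt y g.contMDiff.contMDiffAt
        (contMDiffOn_extChartAt_symm x₀ y hy)
    · exact contMDiffOn_coordVec x₀ i y hy
    · exact contMDiffOn_coordVec x₀ j y hy
  simp only [Bundle.contMDiffWithinAt_totalSpace] at this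
  exact this.2

theorem gram_symm (x₀ : M) (y : EuclideanSpace ℝ (Fin n)) (i j : Fin n) :
    gram g x₀ y i j = gram g x₀ y j i :=
  g.symm _ _ _

/-- The quadratic form at a is the squared length of Σ aᵢ ∂ᵢ. This vector is nonzero when a is,
because the derivative of the chart recovers a from it. -/
theorem gram_posDef {x₀ : M} {y : EuclideanSpace ℝ (Fin n)}
    (hy : y ∈ (extChartAt (𝓡 n) x₀).target) : (gram g x₀ y).PosDef := by
  refine Matrix.posDef_iff_dotProduct_mulVec.2 ⟨?_, fun {a} ha => ?_⟩
  · ext i j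
    simp only [Matrix.conjTranspose_apply, star_trivial]
    exact gram_symm g x₀ y j i
  · have hsum : star a ⬝ᵥ (gram g x₀ y).mulVec a = g.inner ((extChartAt (𝓡 n) x₀).symm y)
        (∑ i, a i • coordVec x₀ y i) (∑ i, a i • coordVec x₀ y i) := by
      simp only [map_sum, map_smul, FunLike.coe_sum, Finset.sum_apply,
        smul_apply, smul_eq_mul, gram, Matrix.of_apply, Finset.mul_sum,
        dotProduct, Matrix.mulVec, Pi.star_apply, star_trivial]
      refine Finset.sum_comm.trans ?_
      refine Finset.sum_congr rfl fun i _ => Finset.sum_congr rfl fun j _ => by ring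
    rw [hsum]
    refine g.pos _ _ fun h0 => ha ?_
    have h2 := dchart_dsymm hy (∑ i, a i • stdVec i)
    rw [dsymm_sum, h0, map_zero] at h2
    ext j
    have h3 := congrArg (fun w : EuclideanSpace ℝ (Fin n) => w j) h2
    simpa [stdVec, Pi.single_apply, PiLp.zero_apply] using! h3.symm

theorem det_gram_pos {x₀ : M} {y : EuclideanSpace ℝ (Fin n)}
    (hy : y ∈ (extChartAt (𝓡 n) x₀).target) : 0 < (gram g x₀ y).det :=
  (gram_posDef g hy).det_pos

theorem contDiffOn_sqrt_det (x₀ : M) :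
    ContDiffOn ℝ ∞ (fun y => √(gram g x₀ y).det) (extChartAt (𝓡 n) x₀).target :=
  (contDiffOn_det (contDiffOn_gram g x₀)).sqrt fun _ hy => (det_gram_pos g hy).ne'

theorem contDiffOn_inv_gram (x₀ : M) (i j : Fin n) :
    ContDiffOn ℝ ∞ (fun y => (gram g x₀ y)⁻¹ i j) (extChartAt (𝓡 n) x₀).target :=
  contDiffOn_inv_matrix (contDiffOn_gram g x₀) (fun _ hy => (det_gram_pos g hy).ne') i j

theorem inner_coordVec {x₀ : M} {y : EuclideanSpace ℝ (Fin n)}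
    (hy : y ∈ (extChartAt (𝓡 n) x₀).target) (X : ∀ x : M, TangentSpace (𝓡 n) x) (i : Fin n) :
    g.inner ((extChartAt (𝓡 n) x₀).symm y) (X ((extChartAt (𝓡 n) x₀).symm y)) (coordVec x₀ y i) =
      ∑ j, gram g x₀ y i j * comp x₀ X y j := by
  rw [eq_sum_comp hy X]
  simp only [map_sum, map_smul, FunLike.coe_sum, Finset.sum_apply,
    smul_apply, smul_eq_mul]
  refine Finset.sum_congr rfl fun j _ => ?_
  rw [mul_comm, gram_symm]
  rfl

/-- Pairing the gradient with ∂ᵢ gives the linear system G·X = du, and inverting the Gram matrix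
gives X. This is the bridge from the gradient, chosen abstractly, to coordinates. -/
theorem comp_grad {x₀ : M} {y : EuclideanSpace ℝ (Fin n)}
    (hy : y ∈ (extChartAt (𝓡 n) x₀).target) {u : M → ℝ}
    (hu : MDifferentiableAt (𝓡 n) 𝓘(ℝ, ℝ) u ((extChartAt (𝓡 n) x₀).symm y)) (i : Fin n) :
    comp x₀ (grad g u) y i =
      ∑ j, (gram g x₀ y)⁻¹ i j * pd j (fun z => u ((extChartAt (𝓡 n) x₀).symm z)) y := by
  have h : (gram g x₀ y).mulVec (comp x₀ (grad g u) y) =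
      fun j => pd j (fun z => u ((extChartAt (𝓡 n) x₀).symm z)) y := by
    funext j
    rw [pd_comp_symm hy hu, ← grad_spec g, inner_coordVec g hy]
    rfl
  have h2 := congrArg (fun w => (gram g x₀ y)⁻¹.mulVec w) h
  simp only [Matrix.mulVec_mulVec] at h2
  rw [Matrix.nonsing_inv_mul _ (det_gram_pos g hy).ne'.isUnit, Matrix.one_mulVec] at h2
  rw [h2]
  rfl

/-- A vector field all of whose components in charts are smooth. -/
def SmoothField (X : ∀ x : M, TangentSpace (𝓡 n) x) : Prop :=
  ∀ (x₀ : M) (i : Fin n),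
    ContDiffOn ℝ ∞ (fun y => comp x₀ X y i) (extChartAt (𝓡 n) x₀).target

theorem contDiffOn_comp_symm {W : Type*} [NormedAddCommGroup W] [NormedSpace ℝ W] {u : M → W}
    (hu : ContMDiff (𝓡 n) 𝓘(ℝ, W) ∞ u) (x₀ : M) :
    ContDiffOn ℝ ∞ (fun y => u ((extChartAt (𝓡 n) x₀).symm y)) (extChartAt (𝓡 n) x₀).target :=
  contMDiffOn_iff_contDiffOn.1 (hu.comp_contMDiffOn (contMDiffOn_extChartAt_symm x₀))

theorem contMDiff_of_contDiffOn_comp_symm {W : Type*} [NormedAddCommGroup W] [NormedSpace ℝ W]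
    {u : M → W} (h : ∀ x₀ : M, ContDiffOn ℝ ∞ (fun y => u ((extChartAt (𝓡 n) x₀).symm y))
      (extChartAt (𝓡 n) x₀).target) : ContMDiff (𝓡 n) 𝓘(ℝ, W) ∞ u := by
  intro x
  have h1 := (contMDiffOn_iff_contDiffOn.2 (h x)).comp
    (contMDiffOn_extChartAt (I := 𝓡 n) (x := x) (n := ∞)) (fun z hz =>
      (extChartAt (𝓡 n) x).map_source (by rwa [extChartAt_source]))
  have h2 := h1.contMDiffAt ((chartAt (EuclideanSpace ℝ (Fin n)) x).open_source.mem_nhds (mem_chart_source _ x))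
  refine h2.congr_of_eventuallyEq ?_
  filter_upwards [(chartAt (EuclideanSpace ℝ (Fin n)) x).open_source.mem_nhds (mem_chart_source _ x)] with z hz
  simp only [Function.comp]
  rw [(extChartAt (𝓡 n) x).left_inv (by rwa [extChartAt_source])]

omit [IsManifold (𝓡 n) ∞ M] in
theorem contDiffOn_pd {s : Set (EuclideanSpace ℝ (Fin n))} (hs : IsOpen s)
    {h : EuclideanSpace ℝ (Fin n) → ℝ} (hh : ContDiffOn ℝ ∞ h s) (i : Fin n) :
    ContDiffOn ℝ ∞ (pd i h) s :=
  (hh.fderiv_of_isOpen hs (m := ∞) le_rfl).clm_apply contDiffOn_const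

theorem smoothField_grad {u : M → ℝ} (hu : ContMDiff (𝓡 n) 𝓘(ℝ, ℝ) ∞ u) :
    SmoothField (grad g u) := by
  intro x₀ i
  refine (ContDiffOn.sum (f := fun j y => (gram g x₀ y)⁻¹ i j *
    pd j (fun z => u ((extChartAt (𝓡 n) x₀).symm z)) y) (s := Finset.univ) fun j _ =>
      (contDiffOn_inv_gram g x₀ i j).mul
        (contDiffOn_pd (isOpen_target x₀) (contDiffOn_comp_symm hu x₀) j)).congr fun y hy => ?_
  rw [comp_grad g hy (hu.mdifferentiableAt (by simp))]

omit [IsManifold (𝓡 n) ∞ M] in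
theorem comp_smul (x₀ : M) (a : M → ℝ) (X : ∀ x : M, TangentSpace (𝓡 n) x)
    (y : EuclideanSpace ℝ (Fin n)) (i : Fin n) :
    comp x₀ (fun x => a x • X x) y i =
      a ((extChartAt (𝓡 n) x₀).symm y) * comp x₀ X y i := by
  simp only [comp, map_smul]
  rfl

omit [IsManifold (𝓡 n) ∞ M] in
theorem comp_add (x₀ : M) (X Y : ∀ x : M, TangentSpace (𝓡 n) x)
    (y : EuclideanSpace ℝ (Fin n)) (i : Fin n) :
    comp x₀ (fun x => X x + Y x) y i = comp x₀ X y i + comp x₀ Y y i := by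
  simp only [comp, map_add]
  rfl

theorem SmoothField.smul {a : M → ℝ} (ha : ContMDiff (𝓡 n) 𝓘(ℝ, ℝ) ∞ a)
    {X : ∀ x : M, TangentSpace (𝓡 n) x} (hX : SmoothField X) :
    SmoothField (fun x => a x • X x) := by
  intro x₀ i
  simp only [comp_smul]
  exact (contDiffOn_comp_symm ha x₀).mul (hX x₀ i)

theorem contMDiff_inner {X Y : ∀ x : M, TangentSpace (𝓡 n) x} (hX : SmoothField X)
    (hY : SmoothField Y) : ContMDiff (𝓡 n) 𝓘(ℝ, ℝ) ∞ (fun x => g.inner x (X x) (Y x)) := by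
  refine contMDiff_of_contDiffOn_comp_symm fun x₀ => ?_
  refine (ContDiffOn.sum (s := Finset.univ) fun i _ => ContDiffOn.sum (s := Finset.univ)
    fun j _ => ((contDiffOn_gram g x₀ i j).mul (hX x₀ i)).mul (hY x₀ j)).congr fun y hy => ?_
  exact inner_eq_sum g hy X Y

theorem mfderiv_eq_sum {x₀ : M} {y : EuclideanSpace ℝ (Fin n)}
    (hy : y ∈ (extChartAt (𝓡 n) x₀).target) {u : M → ℝ}
    (hu : MDifferentiableAt (𝓡 n) 𝓘(ℝ, ℝ) u ((extChartAt (𝓡 n) x₀).symm y))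
    (X : ∀ x : M, TangentSpace (𝓡 n) x) :
    mfderiv (𝓡 n) 𝓘(ℝ, ℝ) u ((extChartAt (𝓡 n) x₀).symm y) (X ((extChartAt (𝓡 n) x₀).symm y)) =
      ∑ i, comp x₀ X y i * pd i (fun z => u ((extChartAt (𝓡 n) x₀).symm z)) y := by
  rw [eq_sum_comp hy X, map_sum]
  refine Finset.sum_congr rfl fun i _ => ?_
  rw [map_smul, pd_comp_symm hy hu]
  rfl

/-- The differential of a real-valued function. -/
def differential (u : M → ℝ) (x : M) : TangentSpace (𝓡 n) x →L[ℝ] ℝ :=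
  mfderiv (𝓡 n) 𝓘(ℝ, ℝ) u x

theorem inner_grad (u : M → ℝ) (x : M) (w : TangentSpace (𝓡 n) x) :
    g.inner x (grad g u x) w = differential u x w :=
  grad_spec g u x w

theorem hasMFDerivAt_differential {u : M → ℝ} {x : M}
    (hu : MDifferentiableAt (𝓡 n) 𝓘(ℝ, ℝ) u x) :
    HasMFDerivAt (𝓡 n) 𝓘(ℝ, ℝ) u x (differential u x) :=
  hu.hasMFDerivAt

theorem differential_eq {u : M → ℝ} {x : M} {l : TangentSpace (𝓡 n) x →L[ℝ] ℝ}
    (h : HasMFDerivAt (𝓡 n) 𝓘(ℝ, ℝ) u x l) : differential u x = l :=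
  h.mfderiv

theorem differential_const (c : ℝ) (x : M) : differential (n := n) (fun _ : M => c) x = 0 :=
  differential_eq (hasMFDerivAt_const c x)

theorem differential_add {u w : M → ℝ} {x : M} (hu : MDifferentiableAt (𝓡 n) 𝓘(ℝ, ℝ) u x)
    (hw : MDifferentiableAt (𝓡 n) 𝓘(ℝ, ℝ) w x) :
    differential (n := n) (fun z => u z + w z) x = differential (n := n) u x + differential w x :=
  differential_eq ((hasMFDerivAt_differential hu).add (hasMFDerivAt_differential hw))

theorem differential_mul {u w : M → ℝ} {x : M} (hu : MDifferentiableAt (𝓡 n) 𝓘(ℝ, ℝ) u x)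
    (hw : MDifferentiableAt (𝓡 n) 𝓘(ℝ, ℝ) w x) :
    differential (n := n) (fun z => u z * w z) x = u x • differential (n := n) w x + w x • differential (n := n) u x :=
  differential_eq ((hasMFDerivAt_differential hu).mul (hasMFDerivAt_differential hw))

theorem differential_comp {u : M → ℝ} {h : ℝ → ℝ} {h' : ℝ} {x : M}
    (hu : MDifferentiableAt (𝓡 n) 𝓘(ℝ, ℝ) u x) (hh : HasDerivAt h h' (u x)) :
    differential (n := n) (fun z => h (u z)) x = h' • differential (n := n) u x := by
  refine differential_eq ((hh.hasFDerivAt.hasMFDerivAt.comp x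
    (hasMFDerivAt_differential hu)).congr_mfderiv ?_)
  ext v
  change differential (n := n) u x v • h' = h' • differential u x v
  rw [smul_eq_mul, smul_eq_mul, mul_comm]

theorem differential_sum {ι : Type*} {u : ι → M → ℝ} (t : Finset ι) {x : M}
    (hu : ∀ i ∈ t, MDifferentiableAt (𝓡 n) 𝓘(ℝ, ℝ) (u i) x) :
    differential (n := n) (fun z => ∑ i ∈ t, u i z) x = ∑ i ∈ t, differential (n := n) (u i) x := by
  classical
  -- Additivity needs differentiability of the partial sums, so this is carried through the
  -- induction.
  suffices h : MDifferentiableAt (𝓡 n) 𝓘(ℝ, ℝ) (fun z => ∑ i ∈ t, u i z) x ∧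
      differential (n := n) (fun z => ∑ i ∈ t, u i z) x =
        ∑ i ∈ t, differential (n := n) (u i) x from h.2
  induction t using Finset.induction_on with
  | empty => exact ⟨by simpa using mdifferentiableAt_const, by simpa using differential_const 0 x⟩
  | insert i t hi ih =>
    have h1 := hu i (Finset.mem_insert_self i t)
    have h2 := ih fun j hj => hu j (Finset.mem_insert_of_mem hj)
    simp only [Finset.sum_insert hi]
    exact ⟨h1.add h2.1, by rw [differential_add h1 h2.1, h2.2]⟩

end Charts

/-! ### Extension by zero of functions with compact support in an open set. -/

section ZeroExtension

variable {G : Type*} [NormedAddCommGroup G] [NormedSpace ℝ G]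
  {W : Type*} [NormedAddCommGroup W] [NormedSpace ℝ W] {U K : Set G} {h : G → W}

/-- A point outside U has the open complement of K as a neighbourhood, and the extension vanishes
there. So the extension is locally either h or zero, and it inherits all regularity of h. -/
theorem indicator_eventuallyEq_zero (hK : IsClosed K) (hKU : K ⊆ U)
    (h0 : ∀ y ∈ U, y ∉ K → h y = 0) {y : G} (hy : y ∉ U) : U.indicator h =ᶠ[𝓝 y] 0 := by
  filter_upwards [hK.isOpen_compl.mem_nhds fun hyK => hy (hKU hyK)] with z hz
  by_cases hzU : z ∈ U
  · rw [indicator_of_mem hzU, h0 z hzU hz, Pi.zero_apply]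
  · rw [indicator_of_notMem hzU, Pi.zero_apply]

theorem indicator_eventuallyEq_self (hU : IsOpen U) {y : G} (hy : y ∈ U) :
    U.indicator h =ᶠ[𝓝 y] h := by
  filter_upwards [hU.mem_nhds hy] with z hz
  rw [indicator_of_mem hz]

theorem continuous_indicator_zero_extension (hU : IsOpen U) (hK : IsClosed K) (hKU : K ⊆ U)
    (hc : ContinuousOn h U) (h0 : ∀ y ∈ U, y ∉ K → h y = 0) : Continuous (U.indicator h) := by
  refine continuous_iff_continuousAt.2 fun y => ?_
  by_cases hy : y ∈ U
  · exact (hc.continuousAt (hU.mem_nhds hy)).congr (indicator_eventuallyEq_self hU hy).symm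
  · exact continuousAt_const.congr (indicator_eventuallyEq_zero hK hKU h0 hy).symm

theorem contDiff_indicator_zero_extension {m : WithTop ℕ∞} (hU : IsOpen U) (hK : IsClosed K)
    (hKU : K ⊆ U) (hc : ContDiffOn ℝ m h U) (h0 : ∀ y ∈ U, y ∉ K → h y = 0) :
    ContDiff ℝ m (U.indicator h) := by
  refine contDiff_iff_contDiffAt.2 fun y => ?_
  by_cases hy : y ∈ U
  · exact (hc.contDiffAt (hU.mem_nhds hy)).congr_of_eventuallyEq (indicator_eventuallyEq_self hU hy)
  · exact contDiffAt_const.congr_of_eventuallyEq (indicator_eventuallyEq_zero hK hKU h0 hy)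

theorem hasCompactSupport_indicator (hK : IsCompact K)
    (h0 : ∀ y ∈ U, y ∉ K → h y = 0) : HasCompactSupport (U.indicator h) :=
  HasCompactSupport.intro hK fun y hy => by
    by_cases hyU : y ∈ U
    · rw [indicator_of_mem hyU, h0 y hyU hy]
    · rw [indicator_of_notMem hyU]

variable [MeasurableSpace G] [BorelSpace G] {μ : Measure G} [IsFiniteMeasureOnCompacts μ]

theorem integrableOn_of_zero_off_compact (hU : IsOpen U) (hK : IsCompact K) (hKU : K ⊆ U)
    (hc : ContinuousOn h U) (h0 : ∀ y ∈ U, y ∉ K → h y = 0) : IntegrableOn h U μ :=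
  (integrable_indicator_iff hU.measurableSet).1
    ((continuous_indicator_zero_extension hU hK.isClosed hKU hc h0).integrable_of_hasCompactSupport
      (hasCompactSupport_indicator hK h0))

end ZeroExtension

/-- Extended by zero, h is smooth with compact support on the whole of ℝⁿ, where integration by
parts against the constant 1 applies. -/
theorem setIntegral_pd_eq_zero {n : ℕ} {U K : Set (EuclideanSpace ℝ (Fin n))}
    {h : EuclideanSpace ℝ (Fin n) → ℝ} (hU : IsOpen U) (hK : IsCompact K)
    (hKU : K ⊆ U) (hc : ContDiffOn ℝ ∞ h U) (h0 : ∀ y ∈ U, y ∉ K → h y = 0) (i : Fin n) :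
    ∫ y in U, pd i h y = 0 := by
  have hs := contDiff_indicator_zero_extension hU hK.isClosed hKU hc h0
  have hcs := hasCompactSupport_indicator hK h0
  have e : ∀ y, U.indicator (pd i h) y = fderiv ℝ (U.indicator h) y (stdVec i) := by
    intro y
    by_cases hy : y ∈ U
    · rw [indicator_of_mem hy, (indicator_eventuallyEq_self hU hy).fderiv_eq]
      rfl
    · rw [indicator_of_notMem hy, (indicator_eventuallyEq_zero hK.isClosed hKU h0 hy).fderiv_eq]
      simp
  rw [← integral_indicator hU.measurableSet]
  simp only [e]
  have hd : Integrable (fun y => fderiv ℝ (U.indicator h) y (stdVec i)) := by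
    refine Continuous.integrable_of_hasCompactSupport ?_ ?_
    · exact (hs.continuous_fderiv (by simp)).clm_apply continuous_const
    · exact (hcs.fderiv ℝ).comp_left (g := fun L : EuclideanSpace ℝ (Fin n) →L[ℝ] ℝ =>
        L (stdVec i)) rfl
  have := integral_mul_fderiv_eq_neg_fderiv_mul_of_integrable (μ := volume)
    (f := fun _ : EuclideanSpace ℝ (Fin n) => (1 : ℝ)) (g := U.indicator h) (v := stdVec i)
    (by simp) (by simpa using hd)
    (by simpa using hs.continuous.integrable_of_hasCompactSupport hcs) (by simp)
    (fun y _ => hs.differentiable (by simp) y)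
  simpa using this

/-! ### The volume measure as a finite sum over charts. -/

section Volume

variable {n : ℕ} {M : Type u} [TopologicalSpace M] [ChartedSpace (EuclideanSpace ℝ (Fin n)) M]
  [IsManifold (𝓡 n) ∞ M] [T2Space M] [CompactSpace M]

omit [IsManifold (𝓡 n) ∞ M] [T2Space M] in
theorem isCompact_image_tsupport {W : Type*} [Zero W] {k : M → W} {x₀ : M}
    (hk : tsupport k ⊆ (extChartAt (𝓡 n) x₀).source) :
    IsCompact (extChartAt (𝓡 n) x₀ '' tsupport k) :=
  (isClosed_tsupport k).isCompact.image_of_continuousOn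
    ((continuousOn_extChartAt x₀).mono hk)

omit [IsManifold (𝓡 n) ∞ M] [T2Space M] [CompactSpace M] in
theorem image_tsupport_subset {W : Type*} [Zero W] {k : M → W} {x₀ : M}
    (hk : tsupport k ⊆ (extChartAt (𝓡 n) x₀).source) :
    extChartAt (𝓡 n) x₀ '' tsupport k ⊆ (extChartAt (𝓡 n) x₀).target :=
  image_subset_iff.2 fun _ hx => (extChartAt (𝓡 n) x₀).map_source (hk hx)

omit [IsManifold (𝓡 n) ∞ M] [T2Space M] [CompactSpace M] in
theorem symm_notMem_tsupport {W : Type*} [Zero W] {k : M → W} {x₀ : M}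
    {y : EuclideanSpace ℝ (Fin n)} (hy : y ∈ (extChartAt (𝓡 n) x₀).target)
    (hyK : y ∉ extChartAt (𝓡 n) x₀ '' tsupport k) :
    (extChartAt (𝓡 n) x₀).symm y ∉ tsupport k := fun h =>
  hyK ⟨_, h, (extChartAt (𝓡 n) x₀).right_inv hy⟩

theorem tsupport_chartPartition (x₀ : M) :
    tsupport (chartPartition n M x₀) ⊆ (extChartAt (𝓡 n) x₀).source := by
  rw [extChartAt_source]
  exact (SmoothPartitionOfUnity.exists_isSubordinate_chartAt_source (𝓡 n) M).choose_spec x₀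

variable (n M) in
theorem finite_chartPartition : {x₀ : M | ∃ x, chartPartition n M x₀ x ≠ 0}.Finite := by
  have := (chartPartition n M).locallyFinite.finite_nonempty_of_compact
  exact this

variable (n M) in
/-- The indices of the partition of unity which matter. -/
def chartIndices : Finset M := (finite_chartPartition n M).toFinset

theorem chartPartition_eq_zero {x₀ : M} (h : x₀ ∉ chartIndices n M) (x : M) :
    chartPartition n M x₀ x = 0 := by
  by_contra hx
  exact h ((finite_chartPartition n M).mem_toFinset.2 ⟨x, hx⟩)

theorem sum_chartPartition (x : M) : ∑ x₀ ∈ chartIndices n M, chartPartition n M x₀ x = 1 := by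
  rw [← (chartPartition n M).sum_eq_one (mem_univ x)]
  refine (finsum_eq_sum_of_support_subset _ fun x₀ hx₀ => ?_).symm
  exact (finite_chartPartition n M).mem_toFinset.2 ⟨x, hx₀⟩

variable [MeasurableSpace M] [BorelSpace M] (g : Metric n M)

/-- The contribution of one chart to the volume measure. -/
def chartVol (x₀ : M) : Measure M :=
  (((volume : Measure (EuclideanSpace ℝ (Fin n))).restrict
      (extChartAt (𝓡 n) x₀).target).withDensity fun y =>
    ENNReal.ofReal
      (chartPartition n M x₀ ((extChartAt (𝓡 n) x₀).symm y) * √(gram g x₀ y).det)).map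
    (extChartAt (𝓡 n) x₀).symm

theorem continuousOn_symm (x₀ : M) :
    ContinuousOn (extChartAt (𝓡 n) x₀).symm (extChartAt (𝓡 n) x₀).target :=
  continuousOn_extChartAt_symm x₀

theorem continuousOn_chartDensity (x₀ : M) :
    ContinuousOn (fun y => chartPartition n M x₀ ((extChartAt (𝓡 n) x₀).symm y) *
      √(gram g x₀ y).det) (extChartAt (𝓡 n) x₀).target :=
  ((chartPartition n M x₀).contMDiff.continuous.comp_continuousOn (continuousOn_symm x₀)).mul
    (contDiffOn_sqrt_det g x₀).continuousOn

theorem aemeasurable_chartDensity (x₀ : M) :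
    AEMeasurable (fun y => ENNReal.ofReal
      (chartPartition n M x₀ ((extChartAt (𝓡 n) x₀).symm y) * √(gram g x₀ y).det))
      ((volume : Measure (EuclideanSpace ℝ (Fin n))).restrict (extChartAt (𝓡 n) x₀).target) :=
  ((continuousOn_chartDensity g x₀).aemeasurable (isOpen_target x₀).measurableSet).ennreal_ofReal

theorem aemeasurable_symm (x₀ : M) :
    AEMeasurable (extChartAt (𝓡 n) x₀).symm
      (((volume : Measure (EuclideanSpace ℝ (Fin n))).restrict
      (extChartAt (𝓡 n) x₀).target).withDensity fun y => ENNReal.ofReal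
      (chartPartition n M x₀ ((extChartAt (𝓡 n) x₀).symm y) * √(gram g x₀ y).det)) :=
  ((continuousOn_symm x₀).aemeasurable (isOpen_target x₀).measurableSet).mono_ac
    (withDensity_absolutelyContinuous _ _)

/-- The density is continuous on the chart target and vanishes off the compact image of the support
of the partition function, hence is integrable. -/
instance isFiniteMeasure_chartVol (x₀ : M) : IsFiniteMeasure (chartVol g x₀) := by
  constructor
  rw [chartVol, Measure.map_apply_of_aemeasurable (aemeasurable_symm g x₀) MeasurableSet.univ,
    preimage_univ, withDensity_apply _ MeasurableSet.univ, Measure.restrict_univ]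
  have h := integrableOn_of_zero_off_compact (μ := volume) (isOpen_target x₀)
    (isCompact_image_tsupport (tsupport_chartPartition x₀))
    (image_tsupport_subset (tsupport_chartPartition x₀))
    (continuousOn_chartDensity g x₀) (fun y hy hyK => by
      rw [image_eq_zero_of_notMem_tsupport (symm_notMem_tsupport hy hyK), zero_mul])
  refine lt_of_le_of_lt (lintegral_mono fun y => ?_) h.2
  rw [← ofReal_norm]
  exact ENNReal.ofReal_le_ofReal (le_abs_self _)

/-- By compactness and local finiteness only finitely many partition functions are nonzero, so the
sum over all points of M is finite. -/
theorem vol_eq_sum : vol g = ∑ x₀ ∈ chartIndices n M, chartVol g x₀ := by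
  ext s hs
  rw [vol, Measure.sum_apply _ hs, Measure.finsetSum_apply]
  refine tsum_eq_sum fun x₀ hx₀ => ?_
  change chartVol g x₀ s = 0
  simp [chartVol, chartPartition_eq_zero hx₀]

instance isFiniteMeasure_vol : IsFiniteMeasure (vol g) := by
  rw [vol_eq_sum]
  infer_instance

theorem integrable_vol {W : Type*} [NormedAddCommGroup W] {h : M → W} (hh : Continuous h)  :
    Integrable h (vol g) :=
  hh.integrable_of_hasCompactSupport (HasCompactSupport.of_compactSpace h)

theorem integral_chartVol {h : M → ℝ} (hh : Continuous h) (x₀ : M) :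
    ∫ x, h x ∂(chartVol g x₀) = ∫ y in (extChartAt (𝓡 n) x₀).target,
      chartPartition n M x₀ ((extChartAt (𝓡 n) x₀).symm y) * h ((extChartAt (𝓡 n) x₀).symm y) *
        √(gram g x₀ y).det := by
  rw [chartVol, integral_map (aemeasurable_symm g x₀) hh.aestronglyMeasurable,
    integral_withDensity_eq_integral_toReal_smul₀ (aemeasurable_chartDensity g x₀)
    (Eventually.of_forall fun y => ENNReal.ofReal_lt_top)]
  refine integral_congr_ae (Eventually.of_forall fun y => ?_)
  simp only [smul_eq_mul]
  rw [ENNReal.toReal_ofReal (mul_nonneg ((chartPartition n M).nonneg _ _) (Real.sqrt_nonneg _))]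
  ring

theorem chartIndices_integral {h : M → ℝ} (hh : Continuous h) :
    ∫ x, h x ∂(vol g) = ∑ x₁ ∈ chartIndices n M, ∫ x, h x ∂(chartVol g x₁) := by
  rw [vol_eq_sum, integral_finsetSum_measure]
  exact fun i _ => hh.integrable_of_hasCompactSupport (HasCompactSupport.of_compactSpace h)

end Volume

/-! ### Change of variables and the divergence theorem within one chart. -/

section ChangeOfChart

variable {n : ℕ} {M : Type u} [TopologicalSpace M] [ChartedSpace (EuclideanSpace ℝ (Fin n)) M]
  [IsManifold (𝓡 n) ∞ M]

/-- The part of the chart at `x₀` which is also covered by the chart at `x₁`. -/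
def overlap (x₀ x₁ : M) : Set (EuclideanSpace ℝ (Fin n)) :=
  (extChartAt (𝓡 n) x₀).target ∩ (extChartAt (𝓡 n) x₀).symm ⁻¹' (extChartAt (𝓡 n) x₁).source

/-- The change of coordinates. -/
def transition (x₀ x₁ : M) (y : EuclideanSpace ℝ (Fin n)) : EuclideanSpace ℝ (Fin n) :=
  extChartAt (𝓡 n) x₁ ((extChartAt (𝓡 n) x₀).symm y)

/-- The derivative of the change of coordinates. -/
def dtransition (x₀ x₁ : M) (y : EuclideanSpace ℝ (Fin n)) :
    EuclideanSpace ℝ (Fin n) →L[ℝ] EuclideanSpace ℝ (Fin n) :=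
  (dchart x₁ ((extChartAt (𝓡 n) x₀).symm y)).comp (dsymm x₀ y)

theorem isOpen_overlap (x₀ x₁ : M) : IsOpen (overlap (n := n) x₀ x₁) :=
  (continuousOn_extChartAt_symm x₀).isOpen_inter_preimage (isOpen_target x₀)
    (isOpen_extChartAt_source x₁)

theorem transition_mem {x₀ x₁ : M} {y : EuclideanSpace ℝ (Fin n)} (hy : y ∈ overlap x₀ x₁) :
    transition x₀ x₁ y ∈ overlap x₁ x₀ := by
  refine ⟨(extChartAt (𝓡 n) x₁).map_source hy.2, ?_⟩
  simp only [transition, mem_preimage]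
  rw [(extChartAt (𝓡 n) x₁).left_inv hy.2]
  exact (extChartAt (𝓡 n) x₀).map_target hy.1

theorem symm_transition {x₀ x₁ : M} {y : EuclideanSpace ℝ (Fin n)} (hy : y ∈ overlap x₀ x₁) :
    (extChartAt (𝓡 n) x₁).symm (transition x₀ x₁ y) = (extChartAt (𝓡 n) x₀).symm y :=
  (extChartAt (𝓡 n) x₁).left_inv hy.2

theorem transition_transition {x₀ x₁ : M} {y : EuclideanSpace ℝ (Fin n)}
    (hy : y ∈ overlap x₀ x₁) : transition x₁ x₀ (transition x₀ x₁ y) = y := by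
  rw [transition, symm_transition hy, (extChartAt (𝓡 n) x₀).right_inv hy.1]

theorem image_transition (x₀ x₁ : M) :
    transition x₀ x₁ '' overlap x₀ x₁ = overlap (n := n) x₁ x₀ := by
  refine Subset.antisymm (image_subset_iff.2 fun y hy => transition_mem hy) fun z hz => ?_
  exact ⟨transition x₁ x₀ z, transition_mem hz, transition_transition hz⟩

theorem hasFDerivAt_transition {x₀ x₁ : M} {y : EuclideanSpace ℝ (Fin n)}
    (hy : y ∈ overlap x₀ x₁) :
    HasFDerivAt (transition x₀ x₁) (dtransition x₀ x₁ y) y := by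
  have h := (mdifferentiableAt_chart hy.2).hasMFDerivAt.comp y
    (mdifferentiableAt_symm hy.1).hasMFDerivAt
  exact hasMFDerivAt_iff_hasFDerivAt.1 h

variable (g : Metric n M)

theorem gram_eq_transition {x₀ x₁ : M} {y : EuclideanSpace ℝ (Fin n)} (hy : y ∈ overlap x₀ x₁)
    (i j : Fin n) : gram g x₀ y i j =
      ∑ k, ∑ l, gram g x₁ (transition x₀ x₁ y) k l * coord (dtransition x₀ x₁ y (stdVec i)) k *
        coord (dtransition x₀ x₁ y (stdVec j)) l := by
  -- Every tangent space is the model space by definition, so one vector can be regarded as a field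
  -- on M. The base point can then be rewritten along `symm_transition` without transporting vectors
  -- between fibres.
  let X : Fin n → ∀ x : M, TangentSpace (𝓡 n) x := fun i _ =>
    (coordVec x₀ y i : EuclideanSpace ℝ (Fin n))
  have h1 : ∀ p : M, p = (extChartAt (𝓡 n) x₀).symm y →
      gram g x₀ y i j = g.inner p (X i p) (X j p) := by
    rintro p rfl
    rfl
  have h2 : ∀ (i : Fin n) (p : M), p = (extChartAt (𝓡 n) x₀).symm y →
      dtransition x₀ x₁ y (stdVec i) = dchart x₁ p (X i p) := by
    rintro i p rfl
    rfl
  rw [h1 _ (symm_transition hy), inner_eq_sum g (transition_mem hy).1 (X i) (X j)]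
  simp only [h2 _ _ (symm_transition hy)]
  rfl

/-- In matrices G₀ = Jᵀ G₁ J with J the Jacobian of the transition map. The factor |det J| is the
one in the change of variables formula. -/
theorem sqrt_det_transition {x₀ x₁ : M} {y : EuclideanSpace ℝ (Fin n)}
    (hy : y ∈ overlap x₀ x₁) :
    √(gram g x₀ y).det =
      |(dtransition x₀ x₁ y).det| * √(gram g x₁ (transition x₀ x₁ y)).det := by
  let b := (EuclideanSpace.basisFun (Fin n) ℝ).toBasis
  let J := LinearMap.toMatrix b b (dtransition x₀ x₁ y).toLinearMap
  have hJ : J.det = (dtransition x₀ x₁ y).det := LinearMap.det_toMatrix b _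
  have hJe : ∀ k i, J k i = coord (dtransition x₀ x₁ y (stdVec i)) k := by
    intro k i
    simp only [J, LinearMap.toMatrix_apply, b, OrthonormalBasis.coe_toBasis,
      EuclideanSpace.basisFun_apply]
    rfl
  have hG : gram g x₀ y = J.transpose * gram g x₁ (transition x₀ x₁ y) * J := by
    ext i j
    rw [gram_eq_transition g hy]
    simp only [Matrix.mul_apply, Matrix.transpose_apply, hJe, Finset.sum_mul]
    rw [Finset.sum_comm]
    refine Finset.sum_congr rfl fun k _ => Finset.sum_congr rfl fun l _ => by ring
  rw [hG, Matrix.det_mul, Matrix.det_mul, Matrix.det_transpose, ← hJ,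
    show J.det * (gram g x₁ (transition x₀ x₁ y)).det * J.det =
      J.det ^ 2 * (gram g x₁ (transition x₀ x₁ y)).det by ring,
    Real.sqrt_mul (sq_nonneg _), Real.sqrt_sq_eq_abs]

theorem setIntegral_overlap (x₀ x₁ : M) (k : M → ℝ) :
    ∫ y in overlap x₁ x₀, k ((extChartAt (𝓡 n) x₁).symm y) * √(gram g x₁ y).det =
      ∫ y in overlap x₀ x₁, k ((extChartAt (𝓡 n) x₀).symm y) * √(gram g x₀ y).det := by
  rw [← image_transition x₀ x₁, integral_image_eq_integral_abs_det_fderiv_smul volume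
    (isOpen_overlap x₀ x₁).measurableSet
    (fun y hy => (hasFDerivAt_transition hy).hasFDerivWithinAt)
    (fun y hy z hz h => by
      rw [← transition_transition hy, h, transition_transition hz])]
  refine setIntegral_congr_fun (isOpen_overlap x₀ x₁).measurableSet fun y hy => ?_
  simp only [smul_eq_mul]
  rw [symm_transition hy, sqrt_det_transition g hy]
  ring

theorem setIntegral_target_eq_overlap {x₀ x₁ : M} {k : EuclideanSpace ℝ (Fin n) → ℝ}
    (hk : ∀ y ∈ (extChartAt (𝓡 n) x₀).target,
      (extChartAt (𝓡 n) x₀).symm y ∉ (extChartAt (𝓡 n) x₁).source → k y = 0) :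
    ∫ y in (extChartAt (𝓡 n) x₀).target, k y = ∫ y in overlap x₀ x₁, k y := by
  refine setIntegral_eq_of_subset_of_forall_sdiff_eq_zero (isOpen_target x₀).measurableSet
    inter_subset_left fun y hy => hk y hy.1 fun h => hy.2 ⟨hy.1, h⟩

/-- Both integrands vanish off the overlap of the charts, where the change of variables formula
identifies the integrals. -/
theorem setIntegral_target_eq {x₀ x₁ : M} {k : M → ℝ}
    (h₀ : tsupport k ⊆ (extChartAt (𝓡 n) x₀).source)
    (h₁ : tsupport k ⊆ (extChartAt (𝓡 n) x₁).source) :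
    ∫ y in (extChartAt (𝓡 n) x₁).target, k ((extChartAt (𝓡 n) x₁).symm y) * √(gram g x₁ y).det =
      ∫ y in (extChartAt (𝓡 n) x₀).target,
        k ((extChartAt (𝓡 n) x₀).symm y) * √(gram g x₀ y).det := by
  rw [setIntegral_target_eq_overlap (x₀ := x₁) (x₁ := x₀), setIntegral_overlap,
    setIntegral_target_eq_overlap (x₀ := x₀) (x₁ := x₁)]
  · intro y _ hy
    rw [image_eq_zero_of_notMem_tsupport fun h => hy (h₁ h), zero_mul]
  · intro y _ hy
    rw [image_eq_zero_of_notMem_tsupport fun h => hy (h₀ h), zero_mul]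

variable [T2Space M] [CompactSpace M] [MeasurableSpace M] [BorelSpace M]

omit [T2Space M] [MeasurableSpace M] [BorelSpace M] in
theorem integrableOn_target {x₀ : M} {k : M → ℝ} {a : EuclideanSpace ℝ (Fin n) → ℝ}
    (hk : Continuous k) (h₀ : tsupport k ⊆ (extChartAt (𝓡 n) x₀).source)
    (ha : ContinuousOn a (extChartAt (𝓡 n) x₀).target) :
    IntegrableOn (fun y => k ((extChartAt (𝓡 n) x₀).symm y) * a y)
      (extChartAt (𝓡 n) x₀).target :=
  integrableOn_of_zero_off_compact (isOpen_target x₀) (isCompact_image_tsupport h₀)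
    (image_tsupport_subset h₀)
    ((hk.comp_continuousOn (continuousOn_extChartAt_symm x₀)).mul ha) (fun y hy hyK => by
      rw [image_eq_zero_of_notMem_tsupport (symm_notMem_tsupport hy hyK), zero_mul])

/-- The integral of a function supported in a chart domain, computed in this chart. -/
theorem integral_vol_eq_setIntegral {x₀ : M} {k : M → ℝ} (hk : Continuous k)
    (h₀ : tsupport k ⊆ (extChartAt (𝓡 n) x₀).source) :
    ∫ x, k x ∂(vol g) = ∫ y in (extChartAt (𝓡 n) x₀).target,
      k ((extChartAt (𝓡 n) x₀).symm y) * √(gram g x₀ y).det := by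
  have hc : ∀ x₁, Continuous (fun x => chartPartition n M x₁ x * k x) := fun x₁ =>
    (chartPartition n M x₁).contMDiff.continuous.mul hk
  have ht₀ : ∀ x₁, tsupport (fun x => chartPartition n M x₁ x * k x) ⊆
      (extChartAt (𝓡 n) x₀).source := fun x₁ => tsupport_mul_subset_right.trans h₀
  rw [chartIndices_integral g hk]
  -- The function χ k, with χ the partition function of the chart at x₁, is supported in both chart
  -- domains, so its integral can be moved to the chart at x₀. There the functions χ sum to 1.
  have e : ∀ x₁ ∈ chartIndices n M, ∫ x, k x ∂(chartVol g x₁) =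
      ∫ y in (extChartAt (𝓡 n) x₀).target, chartPartition n M x₁ ((extChartAt (𝓡 n) x₀).symm y) *
        k ((extChartAt (𝓡 n) x₀).symm y) * √(gram g x₀ y).det := by
    intro x₁ _
    rw [integral_chartVol g hk]
    exact setIntegral_target_eq g (k := fun x => chartPartition n M x₁ x * k x) (ht₀ x₁)
      (tsupport_mul_subset_left.trans (tsupport_chartPartition x₁))
  rw [Finset.sum_congr rfl e, ← integral_finsetSum]
  · refine integral_congr_ae (Eventually.of_forall fun y => ?_)
    simp only [mul_assoc, ← Finset.sum_mul]
    rw [sum_chartPartition, one_mul]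
  · intro x₁ _
    exact integrableOn_target (hc x₁) (ht₀ x₁) (contDiffOn_sqrt_det g x₀).continuousOn

/-- The divergence, computed in the chart at `x₀`. -/
def divAt (x₀ : M) (X : ∀ x : M, TangentSpace (𝓡 n) x) (y : EuclideanSpace ℝ (Fin n)) : ℝ :=
  (√(gram g x₀ y).det)⁻¹ * ∑ i, pd i (fun z => √(gram g x₀ z).det * comp x₀ X z i) y

theorem contDiffOn_divAt {X : ∀ x : M, TangentSpace (𝓡 n) x} (hX : SmoothField X) (x₀ : M) :
    ContDiffOn ℝ ∞ (divAt g x₀ X) (extChartAt (𝓡 n) x₀).target :=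
  ((contDiffOn_sqrt_det g x₀).inv fun _ hy => (Real.sqrt_pos.2 (det_gram_pos g hy)).ne').mul
    (ContDiffOn.sum fun i _ => contDiffOn_pd (isOpen_target x₀)
      ((contDiffOn_sqrt_det g x₀).mul (hX x₀ i)) i)

theorem tsupport_inner_grad_subset (φ : M → ℝ) (X : ∀ x : M, TangentSpace (𝓡 n) x) :
    tsupport (fun x => g.inner x (grad g φ x) (X x)) ⊆ tsupport φ := by
  refine closure_minimal (fun x hx => ?_) (isClosed_tsupport φ)
  by_contra hxs
  refine hx ?_
  have : φ =ᶠ[𝓝 x] fun _ => 0 := notMem_tsupport_iff_eventuallyEq.1 hxs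
  change g.inner x (grad g φ x) (X x) = 0
  rw [grad_spec, this.mfderiv_eq, mfderiv_const]
  rfl

/-- The product rule gives ∂ᵢ(φ √g Xⁱ) = φ ∂ᵢ(√g Xⁱ) + √g Xⁱ ∂ᵢφ. The left side integrates to zero
because φ has compact support in the chart, the first term on the right is √g φ div X, and the
second is √g ⟨∇φ, X⟩. -/
theorem setIntegral_mul_divAt {X : ∀ x : M, TangentSpace (𝓡 n) x} (hX : SmoothField X) {x₀ : M}
    {φ : M → ℝ} (hφ : ContMDiff (𝓡 n) 𝓘(ℝ, ℝ) ∞ φ)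
    (h₀ : tsupport φ ⊆ (extChartAt (𝓡 n) x₀).source) :
    ∫ y in (extChartAt (𝓡 n) x₀).target,
        φ ((extChartAt (𝓡 n) x₀).symm y) * divAt g x₀ X y * √(gram g x₀ y).det =
      -∫ y in (extChartAt (𝓡 n) x₀).target,
        g.inner ((extChartAt (𝓡 n) x₀).symm y) (grad g φ ((extChartAt (𝓡 n) x₀).symm y))
          (X ((extChartAt (𝓡 n) x₀).symm y)) * √(gram g x₀ y).det := by
  have hd : ∀ i, ContDiffOn ℝ ∞ (fun z => √(gram g x₀ z).det * comp x₀ X z i)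
      (extChartAt (𝓡 n) x₀).target := fun i => (contDiffOn_sqrt_det g x₀).mul (hX x₀ i)
  have hφc := contDiffOn_comp_symm hφ x₀
  have hz : ∀ i, ∫ y in (extChartAt (𝓡 n) x₀).target, pd i (fun z =>
      φ ((extChartAt (𝓡 n) x₀).symm z) * (√(gram g x₀ z).det * comp x₀ X z i)) y = 0 := fun i =>
    setIntegral_pd_eq_zero (isOpen_target x₀) (isCompact_image_tsupport h₀)
      (image_tsupport_subset h₀) (hφc.mul (hd i)) (fun y hy hyK => by
        rw [image_eq_zero_of_notMem_tsupport (symm_notMem_tsupport hy hyK), zero_mul]) i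
  have hcont : ∀ i, ContDiffOn ℝ ∞ (pd i fun z => φ ((extChartAt (𝓡 n) x₀).symm z) *
      (√(gram g x₀ z).det * comp x₀ X z i)) (extChartAt (𝓡 n) x₀).target :=
    fun i => contDiffOn_pd (isOpen_target x₀) (hφc.mul (hd i)) i
  have hpd : ∀ i, ∀ y ∈ (extChartAt (𝓡 n) x₀).target, pd i (fun z =>
      φ ((extChartAt (𝓡 n) x₀).symm z) * (√(gram g x₀ z).det * comp x₀ X z i)) y =
      φ ((extChartAt (𝓡 n) x₀).symm y) * pd i (fun z => √(gram g x₀ z).det * comp x₀ X z i) y +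
      √(gram g x₀ y).det * (comp x₀ X y i *
        pd i (fun z => φ ((extChartAt (𝓡 n) x₀).symm z)) y) := by
    intro i y hy
    have h1 := ((hφc y hy).contDiffAt (target_mem_nhds hy)).differentiableAt (by simp)
    have h2 := ((hd i y hy).contDiffAt (target_mem_nhds hy)).differentiableAt (by simp)
    simp only [pd]
    rw [fderiv_fun_mul h1 h2]
    simp only [add_apply, smul_apply, smul_eq_mul]
    ring
  have hint : ∀ i, IntegrableOn (pd i fun z => φ ((extChartAt (𝓡 n) x₀).symm z) *
      (√(gram g x₀ z).det * comp x₀ X z i)) (extChartAt (𝓡 n) x₀).target := fun i =>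
    integrableOn_of_zero_off_compact (isOpen_target x₀) (isCompact_image_tsupport h₀)
      (image_tsupport_subset h₀) (hcont i).continuousOn (fun y hy hyK => by
        have : (fun z => φ ((extChartAt (𝓡 n) x₀).symm z) *
            (√(gram g x₀ z).det * comp x₀ X z i)) =ᶠ[𝓝 y] fun _ => 0 := by
          filter_upwards [target_mem_nhds hy,
            (isCompact_image_tsupport h₀).isClosed.isOpen_compl.mem_nhds hyK] with z hz hzK
          rw [image_eq_zero_of_notMem_tsupport (symm_notMem_tsupport hz hzK), zero_mul]
        rw [pd, this.fderiv_eq]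
        simp)
  rw [← sub_eq_zero, sub_neg_eq_add, ← integral_add]
  · have h0 : ∑ i, ∫ y in (extChartAt (𝓡 n) x₀).target, pd i (fun z =>
        φ ((extChartAt (𝓡 n) x₀).symm z) * (√(gram g x₀ z).det * comp x₀ X z i)) y = 0 :=
      Finset.sum_eq_zero fun i _ => hz i
    rw [← integral_finsetSum _ fun i _ => hint i] at h0
    rw [← h0]
    refine setIntegral_congr_fun (isOpen_target x₀).measurableSet fun y hy => ?_
    have hs : √(gram g x₀ y).det ≠ 0 := (Real.sqrt_pos.2 (det_gram_pos g hy)).ne'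
    simp only [hpd _ y hy, Finset.sum_add_distrib, ← Finset.mul_sum]
    rw [grad_spec, mfderiv_eq_sum hy (hφ.mdifferentiableAt (by simp)), divAt]
    field_simp
  · simp only [mul_assoc]
    exact integrableOn_target hφ.continuous h₀ ((contDiffOn_divAt g hX x₀).mul
      (contDiffOn_sqrt_det g x₀)).continuousOn
  · refine integrableOn_target (k := fun x => g.inner x (grad g φ x) (X x))
      (contMDiff_inner g (smoothField_grad g hφ) hX).continuous
      ((tsupport_inner_grad_subset g φ X).trans h₀) (contDiffOn_sqrt_det g x₀).continuousOn

end ChangeOfChart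

/-! ### Invariance of the divergence and integration by parts on M. -/

section DivergenceTheorem

variable {n : ℕ} {M : Type u} [TopologicalSpace M] [ChartedSpace (EuclideanSpace ℝ (Fin n)) M]
  [IsManifold (𝓡 n) ∞ M] (g : Metric n M) [T2Space M] [CompactSpace M]
  [MeasurableSpace M] [BorelSpace M]

/-- The divergence does not depend on the chart. -/
theorem divAt_eq_divAt {X : ∀ x : M, TangentSpace (𝓡 n) x} (hX : SmoothField X) {x₀ x₁ x : M}
    (h₀ : x ∈ (extChartAt (𝓡 n) x₀).source) (h₁ : x ∈ (extChartAt (𝓡 n) x₁).source) :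
    divAt g x₀ X (extChartAt (𝓡 n) x₀ x) = divAt g x₁ X (extChartAt (𝓡 n) x₁ x) := by
  -- A weak argument avoids computing with transformation laws. If the two values differed, their
  -- difference d would keep its sign near x. Tested against a bump function φ supported there, both
  -- divergences give −∫⟨∇φ, X⟩, which does not depend on the chart; but φ · d · d(x) has positive
  -- integral.
  by_contra hne
  let d : M → ℝ := fun z =>
    divAt g x₀ X (extChartAt (𝓡 n) x₀ z) - divAt g x₁ X (extChartAt (𝓡 n) x₁ z)
  have hdx : d x ≠ 0 := sub_ne_zero.2 hne
  let O : Set M := (extChartAt (𝓡 n) x₀).source ∩ (extChartAt (𝓡 n) x₁).source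
  have hO : IsOpen O := (isOpen_extChartAt_source x₀).inter (isOpen_extChartAt_source x₁)
  have hdc : ContinuousOn d O :=
    ((contDiffOn_divAt g hX x₀).continuousOn.comp ((continuousOn_extChartAt x₀).mono
      inter_subset_left) fun z hz => (extChartAt (𝓡 n) x₀).map_source hz.1).sub
    ((contDiffOn_divAt g hX x₁).continuousOn.comp ((continuousOn_extChartAt x₁).mono
      inter_subset_right) fun z hz => (extChartAt (𝓡 n) x₁).map_source hz.2)
  have hO' : IsOpen (O ∩ {z | 0 < d z * d x}) := by
    have := (hdc.mul (continuousOn_const (c := d x))).isOpen_inter_preimage hO isOpen_Ioi (t := Ioi 0)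
    exact this
  obtain ⟨φ, -, hφ⟩ := (SmoothBumpFunction.nhds_basis_tsupport (I := 𝓡 n) x).mem_iff.1
    (hO'.mem_nhds ⟨⟨h₀, h₁⟩, mul_self_pos.2 hdx⟩)
  have hφs : ContMDiff (𝓡 n) 𝓘(ℝ, ℝ) ∞ φ := φ.contMDiff
  have hφ₀ : tsupport φ ⊆ (extChartAt (𝓡 n) x₀).source := fun z hz => (hφ hz).1.1
  have hφ₁ : tsupport φ ⊆ (extChartAt (𝓡 n) x₁).source := fun z hz => (hφ hz).1.2
  have e0 := setIntegral_mul_divAt g hX hφs hφ₀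
  have e1 := setIntegral_mul_divAt g hX hφs hφ₁
  have e2 := setIntegral_target_eq g (k := fun x => g.inner x (grad g φ x) (X x))
    ((tsupport_inner_grad_subset g φ X).trans hφ₀) ((tsupport_inner_grad_subset g φ X).trans hφ₁)
  have e3 := setIntegral_target_eq g
    (k := fun z => φ z * divAt g x₁ X (extChartAt (𝓡 n) x₁ z))
    (tsupport_mul_subset_left.trans hφ₀) (tsupport_mul_subset_left.trans hφ₁)
  have e4 : ∫ y in (extChartAt (𝓡 n) x₁).target,
      φ ((extChartAt (𝓡 n) x₁).symm y) * divAt g x₁ X (extChartAt (𝓡 n) x₁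
        ((extChartAt (𝓡 n) x₁).symm y)) * √(gram g x₁ y).det =
      ∫ y in (extChartAt (𝓡 n) x₁).target,
      φ ((extChartAt (𝓡 n) x₁).symm y) * divAt g x₁ X y * √(gram g x₁ y).det := by
    refine setIntegral_congr_fun (isOpen_target x₁).measurableSet fun y hy => ?_
    simp only [(extChartAt (𝓡 n) x₁).right_inv hy]
  -- The difference d is continuous only on the overlap of the chart domains. Elsewhere the
  -- integrand vanishes locally because the support of φ lies inside the overlap.
  have hs : ContinuousOn (fun y => φ ((extChartAt (𝓡 n) x₀).symm y) *
      (d ((extChartAt (𝓡 n) x₀).symm y) * d x) * √(gram g x₀ y).det)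
      (extChartAt (𝓡 n) x₀).target := by
    intro y hy
    by_cases hyO : (extChartAt (𝓡 n) x₀).symm y ∈ O
    · have c1 : ContinuousAt (extChartAt (𝓡 n) x₀).symm y :=
        (continuousOn_symm x₀).continuousAt (target_mem_nhds hy)
      have c2 := (hdc.continuousAt (hO.mem_nhds hyO)).comp c1
      have c3 := φ.continuous.continuousAt.comp c1
      have c4 := (contDiffOn_sqrt_det g x₀).continuousOn.continuousAt (target_mem_nhds hy)
      exact ((c3.mul (c2.mul continuousAt_const)).mul c4).continuousWithinAt
    · have hn : (extChartAt (𝓡 n) x₀).symm y ∉ tsupport φ := fun h => hyO (hφ h).1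
      have c1 : ContinuousAt (extChartAt (𝓡 n) x₀).symm y :=
        (continuousOn_symm x₀).continuousAt (target_mem_nhds hy)
      have : (fun y => φ ((extChartAt (𝓡 n) x₀).symm y) *
          (d ((extChartAt (𝓡 n) x₀).symm y) * d x) * √(gram g x₀ y).det) =ᶠ[𝓝 y] fun _ => 0 := by
        filter_upwards [c1.eventually ((isClosed_tsupport φ).isOpen_compl.mem_nhds hn)] with z hz
        rw [image_eq_zero_of_notMem_tsupport hz]
        ring
      exact (continuousAt_const.congr this.symm).continuousWithinAt
  have hz : ∀ y ∈ (extChartAt (𝓡 n) x₀).target, y ∉ extChartAt (𝓡 n) x₀ '' tsupport φ →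
      φ ((extChartAt (𝓡 n) x₀).symm y) *
      (d ((extChartAt (𝓡 n) x₀).symm y) * d x) * √(gram g x₀ y).det = 0 := fun y hy hyK => by
    rw [image_eq_zero_of_notMem_tsupport (symm_notMem_tsupport hy hyK)]
    ring
  have hpos := (continuous_indicator_zero_extension (isOpen_target x₀)
    (isCompact_image_tsupport hφ₀).isClosed (image_tsupport_subset hφ₀) hs
    hz).integral_pos_of_hasCompactSupport_nonneg_nonzero (μ := volume)
    (x := extChartAt (𝓡 n) x₀ x) (hasCompactSupport_indicator (isCompact_image_tsupport hφ₀) hz)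
    (fun y => indicator_nonneg (fun z _ => ?_) y) ?_
  · rw [integral_indicator (isOpen_target x₀).measurableSet] at hpos
    have i0 : IntegrableOn (fun y => φ ((extChartAt (𝓡 n) x₀).symm y) * divAt g x₀ X y *
        √(gram g x₀ y).det) (extChartAt (𝓡 n) x₀).target := by
      simp only [mul_assoc]
      exact integrableOn_target φ.continuous hφ₀ ((contDiffOn_divAt g hX x₀).mul
        (contDiffOn_sqrt_det g x₀)).continuousOn
    have i1 : IntegrableOn (fun y => φ ((extChartAt (𝓡 n) x₀).symm y) *
        (d ((extChartAt (𝓡 n) x₀).symm y) * d x) * √(gram g x₀ y).det)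
        (extChartAt (𝓡 n) x₀).target :=
      integrableOn_of_zero_off_compact (isOpen_target x₀) (isCompact_image_tsupport hφ₀)
        (image_tsupport_subset hφ₀) hs hz
    have e5 : ∫ y in (extChartAt (𝓡 n) x₀).target, φ ((extChartAt (𝓡 n) x₀).symm y) *
        (d ((extChartAt (𝓡 n) x₀).symm y) * d x) * √(gram g x₀ y).det = d x *
        ((∫ y in (extChartAt (𝓡 n) x₀).target, φ ((extChartAt (𝓡 n) x₀).symm y) * divAt g x₀ X y *
        √(gram g x₀ y).det) - ∫ y in (extChartAt (𝓡 n) x₀).target,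
          φ ((extChartAt (𝓡 n) x₀).symm y) * divAt g x₁ X (extChartAt (𝓡 n) x₁
          ((extChartAt (𝓡 n) x₀).symm y)) * √(gram g x₀ y).det) := by
      -- The integrand with the divergence of the chart at x₁ is written through two integrands
      -- already known to be integrable, so that the integral splits.
      have key : ∀ y ∈ (extChartAt (𝓡 n) x₀).target, φ ((extChartAt (𝓡 n) x₀).symm y) *
          divAt g x₁ X (extChartAt (𝓡 n) x₁
          ((extChartAt (𝓡 n) x₀).symm y)) * √(gram g x₀ y).det =
          φ ((extChartAt (𝓡 n) x₀).symm y) * divAt g x₀ X y * √(gram g x₀ y).det - (d x)⁻¹ *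
          (φ ((extChartAt (𝓡 n) x₀).symm y) *
          (d ((extChartAt (𝓡 n) x₀).symm y) * d x) * √(gram g x₀ y).det) := by
        intro y hy
        have : d ((extChartAt (𝓡 n) x₀).symm y) = divAt g x₀ X y - divAt g x₁ X
            (extChartAt (𝓡 n) x₁ ((extChartAt (𝓡 n) x₀).symm y)) := by
          simp only [d, (extChartAt (𝓡 n) x₀).right_inv hy]
        rw [this]
        field_simp
        ring
      rw [setIntegral_congr_fun (isOpen_target x₀).measurableSet key,
        integral_sub i0 (i1.const_mul _), integral_const_mul, sub_sub_cancel,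
        mul_inv_cancel_left₀ hdx]
    rw [e5, ← e3, e4, e0, e1, e2, sub_self, mul_zero] at hpos
    exact lt_irrefl _ hpos
  · refine mul_nonneg ?_ (Real.sqrt_nonneg _)
    by_cases hzs : (extChartAt (𝓡 n) x₀).symm z ∈ tsupport φ
    · exact mul_nonneg φ.nonneg (le_of_lt (hφ hzs).2)
    · rw [image_eq_zero_of_notMem_tsupport hzs, zero_mul]
  · have hy := (extChartAt (𝓡 n) x₀).map_source h₀
    rw [indicator_of_mem hy, (extChartAt (𝓡 n) x₀).left_inv h₀, φ.eq_one, one_mul]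
    exact mul_ne_zero (mul_ne_zero hdx hdx) (Real.sqrt_pos.2 (det_gram_pos g hy)).ne'

/-- By definition `divg` uses a different chart at each point. Chart independence lets one chart
compute it on its whole domain, which makes it accessible to differentiation. -/
theorem divg_symm {X : ∀ x : M, TangentSpace (𝓡 n) x} (hX : SmoothField X) {x₀ : M}
    {y : EuclideanSpace ℝ (Fin n)} (hy : y ∈ (extChartAt (𝓡 n) x₀).target) :
    divg g X ((extChartAt (𝓡 n) x₀).symm y) = divAt g x₀ X y := by
  have h := divAt_eq_divAt g hX (mem_extChartAt_source ((extChartAt (𝓡 n) x₀).symm y))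
    ((extChartAt (𝓡 n) x₀).map_target hy)
  rw [(extChartAt (𝓡 n) x₀).right_inv hy] at h
  exact h

theorem contMDiff_divg {X : ∀ x : M, TangentSpace (𝓡 n) x} (hX : SmoothField X) :
    ContMDiff (𝓡 n) 𝓘(ℝ, ℝ) ∞ (divg g X) :=
  contMDiff_of_contDiffOn_comp_symm fun x₀ =>
    (contDiffOn_divAt g hX x₀).congr fun _ hy => divg_symm g hX hy

theorem contMDiff_lap {u : M → ℝ} (hu : ContMDiff (𝓡 n) 𝓘(ℝ, ℝ) ∞ u) :
    ContMDiff (𝓡 n) 𝓘(ℝ, ℝ) ∞ (lap g u) :=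
  contMDiff_divg g (smoothField_grad g hu)

theorem integral_mul_divg_of_tsupport {X : ∀ x : M, TangentSpace (𝓡 n) x} (hX : SmoothField X)
    {x₀ : M} {φ : M → ℝ} (hφ : ContMDiff (𝓡 n) 𝓘(ℝ, ℝ) ∞ φ)
    (h₀ : tsupport φ ⊆ (extChartAt (𝓡 n) x₀).source) :
    ∫ x, φ x * divg g X x ∂(vol g) = -∫ x, g.inner x (grad g φ x) (X x) ∂(vol g) := by
  rw [integral_vol_eq_setIntegral g (k := fun x => φ x * divg g X x)
    (hφ.continuous.mul (contMDiff_divg g hX).continuous)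
    (tsupport_mul_subset_left.trans h₀),
    integral_vol_eq_setIntegral g (contMDiff_inner g (smoothField_grad g hφ) hX).continuous
    ((tsupport_inner_grad_subset g φ X).trans h₀), ← setIntegral_mul_divAt g hX hφ h₀]
  refine setIntegral_congr_fun (isOpen_target x₀).measurableSet fun y hy => ?_
  simp only [divg_symm g hX hy]

/-- Integration by parts. -/
theorem integral_mul_divg {X : ∀ x : M, TangentSpace (𝓡 n) x} (hX : SmoothField X)
    {u : M → ℝ} (hu : ContMDiff (𝓡 n) 𝓘(ℝ, ℝ) ∞ u) :
    ∫ x, u x * divg g X x ∂(vol g) = -∫ x, g.inner x (grad g u x) (X x) ∂(vol g) := by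
  -- Decompose u = Σ χ u by the partition of unity: each summand is supported in one chart, and both
  -- sides are linear in u.
  have hs : ∀ x₀, ContMDiff (𝓡 n) 𝓘(ℝ, ℝ) ∞ (fun x => chartPartition n M x₀ x * u x) :=
    fun x₀ => (chartPartition n M x₀).contMDiff.mul hu
  have hsum : ∀ x, ∑ x₀ ∈ chartIndices n M, chartPartition n M x₀ x * u x = u x := fun x => by
    rw [← Finset.sum_mul, sum_chartPartition, one_mul]
  have e1 : ∀ x, u x * divg g X x =
      ∑ x₀ ∈ chartIndices n M, chartPartition n M x₀ x * u x * divg g X x := fun x => by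
    rw [← Finset.sum_mul, hsum]
  have e2 : ∀ x, g.inner x (grad g u x) (X x) = ∑ x₀ ∈ chartIndices n M,
      g.inner x (grad g (fun z => chartPartition n M x₀ z * u z) x) (X x) := fun x => by
    simp only [inner_grad]
    rw [← sum_apply, ← differential_sum _ fun x₀ _ => (hs x₀).mdifferentiableAt (by simp)]
    simp only [hsum]
  simp only [e1, e2]
  rw [integral_finsetSum, integral_finsetSum, ← Finset.sum_neg_distrib]
  · exact Finset.sum_congr rfl fun x₀ _ => integral_mul_divg_of_tsupport g hX (hs x₀)
      (tsupport_mul_subset_left.trans (tsupport_chartPartition x₀))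
  · exact fun x₀ _ => integrable_vol g
      (contMDiff_inner g (smoothField_grad g (hs x₀)) hX).continuous
  · exact fun x₀ _ => integrable_vol g ((hs x₀).continuous.mul (contMDiff_divg g hX).continuous)

end DivergenceTheorem

/-! ### Calculus rules for gradient, divergence and Laplacian. -/

section GradientCalculus

variable {n : ℕ} {M : Type u} [TopologicalSpace M] [ChartedSpace (EuclideanSpace ℝ (Fin n)) M]
  [IsManifold (𝓡 n) ∞ M] (g : Metric n M)

/-- Positive definiteness makes the gradient unique. Hence its sum, product and chain rules reduce
to those of the differential. -/
theorem grad_eq_of_inner {u : M → ℝ} {x : M} {v : TangentSpace (𝓡 n) x}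
    (h : ∀ w, g.inner x v w = differential u x w) : grad g u x = v := by
  by_contra hne
  have h1 := g.pos x (grad g u x - v) (sub_ne_zero.2 hne)
  have h2 : ∀ w, g.inner x (grad g u x - v) w = 0 := fun w => by
    rw [map_sub]
    exact sub_eq_zero.2 ((inner_grad g u x w).trans (h w).symm)
  exact h1.ne' (h2 _)

/-- The scalar product of two gradients. -/
def gradInner (u w : M → ℝ) (x : M) : ℝ := g.inner x (grad g u x) (grad g w x)

theorem gradInner_comm (u w : M → ℝ) (x : M) : gradInner g u w x = gradInner g w u x :=
  g.symm _ _ _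

theorem normSq_grad (u : M → ℝ) (x : M) : normSq g x (grad g u x) = gradInner g u u x := rfl

theorem gradInner_eq (u w : M → ℝ) (x : M) :
    gradInner g u w x = differential u x (grad g w x) := inner_grad g u x _

theorem contMDiff_gradInner {u w : M → ℝ} (hu : ContMDiff (𝓡 n) 𝓘(ℝ, ℝ) ∞ u)
    (hw : ContMDiff (𝓡 n) 𝓘(ℝ, ℝ) ∞ w) : ContMDiff (𝓡 n) 𝓘(ℝ, ℝ) ∞ (gradInner g u w) :=
  contMDiff_inner g (smoothField_grad g hu) (smoothField_grad g hw)

theorem gradInner_add_left {u v : M → ℝ} (w : M → ℝ) {x : M}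
    (hu : MDifferentiableAt (𝓡 n) 𝓘(ℝ, ℝ) u x) (hv : MDifferentiableAt (𝓡 n) 𝓘(ℝ, ℝ) v x) :
    gradInner g (fun z => u z + v z) w x = gradInner g u w x + gradInner g v w x := by
  simp only [gradInner_eq]
  rw [differential_add hu hv, add_apply]

theorem gradInner_mul_left {u v : M → ℝ} (w : M → ℝ) {x : M}
    (hu : MDifferentiableAt (𝓡 n) 𝓘(ℝ, ℝ) u x) (hv : MDifferentiableAt (𝓡 n) 𝓘(ℝ, ℝ) v x) :
    gradInner g (fun z => u z * v z) w x = u x * gradInner g v w x + v x * gradInner g u w x := by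
  simp only [gradInner_eq]
  rw [differential_mul hu hv]
  rfl

theorem gradInner_comp_left {u : M → ℝ} {h : ℝ → ℝ} {h' : ℝ} (w : M → ℝ) {x : M}
    (hu : MDifferentiableAt (𝓡 n) 𝓘(ℝ, ℝ) u x) (hh : HasDerivAt h h' (u x)) :
    gradInner g (fun z => h (u z)) w x = h' * gradInner g u w x := by
  simp only [gradInner_eq]
  rw [differential_comp hu hh]
  rfl

theorem gradInner_comp_self {u : M → ℝ} {h : ℝ → ℝ} {h' : ℝ} {x : M}
    (hu : MDifferentiableAt (𝓡 n) 𝓘(ℝ, ℝ) u x) (hh : HasDerivAt h h' (u x)) :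
    gradInner g (fun z => h (u z)) (fun z => h (u z)) x = h' ^ 2 * gradInner g u u x := by
  rw [gradInner_comp_left g _ hu hh, gradInner_comm, gradInner_comp_left g _ hu hh]
  ring

/-- Along an affine variation the Dirichlet density is a quadratic polynomial in the parameter; all
the first variations below start from this expansion. -/
theorem gradInner_add_mul {u v : M → ℝ} {x : M} (c : ℝ)
    (hu : MDifferentiableAt (𝓡 n) 𝓘(ℝ, ℝ) u x) (hv : MDifferentiableAt (𝓡 n) 𝓘(ℝ, ℝ) v x) :
    gradInner g (fun z => u z + c * v z) (fun z => u z + c * v z) x =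
      gradInner g u u x + c * (2 * gradInner g u v x) + c ^ 2 * gradInner g v v x := by
  have hl : ∀ w : M → ℝ, gradInner g (fun z => u z + c * v z) w x =
      gradInner g u w x + c * gradInner g v w x := by
    intro w
    have hc : HasDerivAt (fun t : ℝ => c * t) c (v x) := by
      simpa using (hasDerivAt_id (v x)).const_mul c
    have hcv : MDifferentiableAt (𝓡 n) 𝓘(ℝ, ℝ) (fun z => c * v z) x :=
      hc.differentiableAt.mdifferentiableAt.comp x hv
    rw [gradInner_add_left g w hu hcv, gradInner_comp_left g w hv hc]
  rw [hl, gradInner_comm g u, gradInner_comm g v, hl, hl, gradInner_comm g v u]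
  ring

theorem exists_symm_eq (x : M) : ∃ (x₀ : M) (y : EuclideanSpace ℝ (Fin n)),
    y ∈ (extChartAt (𝓡 n) x₀).target ∧ (extChartAt (𝓡 n) x₀).symm y = x :=
  ⟨x, _, (extChartAt (𝓡 n) x).map_source (mem_extChartAt_source x),
    (extChartAt (𝓡 n) x).left_inv (mem_extChartAt_source x)⟩

variable [T2Space M] [CompactSpace M] [MeasurableSpace M] [BorelSpace M]

theorem divg_smul {a : M → ℝ} (ha : ContMDiff (𝓡 n) 𝓘(ℝ, ℝ) ∞ a)
    {X : ∀ x : M, TangentSpace (𝓡 n) x} (hX : SmoothField X) (x : M) :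
    divg g (fun z => a z • X z) x = a x * divg g X x + differential a x (X x) := by
  obtain ⟨x₀, y, hy, rfl⟩ := exists_symm_eq (n := n) x
  have hac := contDiffOn_comp_symm ha x₀
  have hd : ∀ i, ContDiffOn ℝ ∞ (fun z => √(gram g x₀ z).det * comp x₀ X z i)
      (extChartAt (𝓡 n) x₀).target := fun i => (contDiffOn_sqrt_det g x₀).mul (hX x₀ i)
  have hpd : ∀ i, pd i (fun z => √(gram g x₀ z).det * comp x₀ (fun z => a z • X z) z i) y =
      a ((extChartAt (𝓡 n) x₀).symm y) * pd i (fun z => √(gram g x₀ z).det * comp x₀ X z i) y +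
      √(gram g x₀ y).det * (comp x₀ X y i *
        pd i (fun z => a ((extChartAt (𝓡 n) x₀).symm z)) y) := by
    intro i
    have h1 := ((hac y hy).contDiffAt (target_mem_nhds hy)).differentiableAt (by simp)
    have h2 := ((hd i y hy).contDiffAt (target_mem_nhds hy)).differentiableAt (by simp)
    simp only [comp_smul, mul_left_comm _ (a _)]
    simp only [pd]
    rw [fderiv_fun_mul h1 h2]
    simp only [add_apply, smul_apply, smul_eq_mul]
    ring
  have hs : √(gram g x₀ y).det ≠ 0 := (Real.sqrt_pos.2 (det_gram_pos g hy)).ne'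
  have hm : differential a ((extChartAt (𝓡 n) x₀).symm y) (X ((extChartAt (𝓡 n) x₀).symm y)) =
      ∑ i, comp x₀ X y i * pd i (fun z => a ((extChartAt (𝓡 n) x₀).symm z)) y :=
    mfderiv_eq_sum hy (ha.mdifferentiableAt (by simp)) X
  rw [divg_symm g (hX.smul ha) hy, divg_symm g hX hy, hm, divAt, divAt]
  simp only [hpd, Finset.sum_add_distrib, ← Finset.mul_sum]
  field_simp

theorem divg_add {X Y : ∀ x : M, TangentSpace (𝓡 n) x} (hX : SmoothField X) (hY : SmoothField Y)
    (x : M) : divg g (fun z => X z + Y z) x = divg g X x + divg g Y x := by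
  obtain ⟨x₀, y, hy, rfl⟩ := exists_symm_eq (n := n) x
  have hd : ∀ {Z : ∀ x : M, TangentSpace (𝓡 n) x}, SmoothField Z → ∀ i,
      DifferentiableAt ℝ (fun z => √(gram g x₀ z).det * comp x₀ Z z i) y := fun hZ i =>
    (((contDiffOn_sqrt_det g x₀).mul (hZ x₀ i)).contDiffAt
      (target_mem_nhds hy)).differentiableAt (by simp)
  have hXY : SmoothField (fun z => X z + Y z) := fun x₀ i => by
    simp only [comp_add]
    exact (hX x₀ i).add (hY x₀ i)
  rw [divg_symm g hX hy, divg_symm g hY hy, divg_symm g hXY hy, divAt, divAt, divAt, ← mul_add,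
    ← Finset.sum_add_distrib]
  congr 1
  refine Finset.sum_congr rfl fun i _ => ?_
  simp only [comp_add, mul_add]
  simp only [pd]
  rw [fderiv_fun_add (hd hX i) (hd hY i), add_apply]

theorem divg_smul_grad {a u : M → ℝ} (ha : ContMDiff (𝓡 n) 𝓘(ℝ, ℝ) ∞ a)
    (hu : ContMDiff (𝓡 n) 𝓘(ℝ, ℝ) ∞ u) (x : M) :
    divg g (fun z => a z • grad g u z) x = a x * lap g u x + gradInner g a u x := by
  rw [divg_smul g ha (smoothField_grad g hu), gradInner_eq]
  rfl

theorem lap_mul {u w : M → ℝ} (hu : ContMDiff (𝓡 n) 𝓘(ℝ, ℝ) ∞ u)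
    (hw : ContMDiff (𝓡 n) 𝓘(ℝ, ℝ) ∞ w) (x : M) :
    lap g (fun z => u z * w z) x = u x * lap g w x + w x * lap g u x + 2 * gradInner g u w x := by
  have h : grad g (fun z => u z * w z) = fun z => u z • grad g w z + w z • grad g u z := by
    funext z
    refine grad_eq_of_inner g fun v => ?_
    rw [differential_mul (hu.mdifferentiableAt (by simp)) (hw.mdifferentiableAt (by simp)),
      map_add, map_smul, map_smul, add_apply, smul_apply, smul_apply, inner_grad, inner_grad]
    rfl
  rw [lap, h, divg_add g ((smoothField_grad g hw).smul hu) ((smoothField_grad g hu).smul hw),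
    divg_smul_grad g hu hw, divg_smul_grad g hw hu, gradInner_comm g w u]
  ring

theorem lap_comp {u : M → ℝ} (hu : ContMDiff (𝓡 n) 𝓘(ℝ, ℝ) ∞ u) {h h' h'' : ℝ → ℝ}
    (hh : ∀ x, HasDerivAt h (h' (u x)) (u x)) (hh' : ∀ x, HasDerivAt h' (h'' (u x)) (u x))
    (hs : ContMDiff (𝓡 n) 𝓘(ℝ, ℝ) ∞ (fun x => h' (u x))) (x : M) :
    lap g (fun z => h (u z)) x = h' (u x) * lap g u x + h'' (u x) * gradInner g u u x := by
  have e : grad g (fun z => h (u z)) = fun z => h' (u z) • grad g u z := by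
    funext z
    refine grad_eq_of_inner g fun v => ?_
    rw [differential_comp (hu.mdifferentiableAt (by simp)) (hh z), map_smul, smul_apply,
      inner_grad]
    rfl
  rw [lap, e, divg_smul_grad g hs hu,
    gradInner_comp_left g u (hu.mdifferentiableAt (by simp)) (hh' x)]

/-- Green's first identity, with a weight. -/
theorem integral_mul_divg_smul_grad {u a w : M → ℝ} (hu : ContMDiff (𝓡 n) 𝓘(ℝ, ℝ) ∞ u)
    (ha : ContMDiff (𝓡 n) 𝓘(ℝ, ℝ) ∞ a) (hw : ContMDiff (𝓡 n) 𝓘(ℝ, ℝ) ∞ w) :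
    ∫ x, u x * divg g (fun z => a z • grad g w z) x ∂(vol g) =
      -∫ x, a x * gradInner g u w x ∂(vol g) := by
  rw [integral_mul_divg g ((smoothField_grad g hw).smul ha) hu]
  simp only [map_smul]
  rfl

theorem integral_mul_lap {u w : M → ℝ} (hu : ContMDiff (𝓡 n) 𝓘(ℝ, ℝ) ∞ u)
    (hw : ContMDiff (𝓡 n) 𝓘(ℝ, ℝ) ∞ w) :
    ∫ x, u x * lap g w x ∂(vol g) = -∫ x, gradInner g u w x ∂(vol g) :=
  integral_mul_divg g (smoothField_grad g hw) hu

end GradientCalculus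

/-! ### Gradient, Laplacian and Schrödinger operator in polar form. -/

section MadelungCalculus

variable {n : ℕ} {M : Type u} [TopologicalSpace M] [ChartedSpace (EuclideanSpace ℝ (Fin n)) M]
  [IsManifold (𝓡 n) ∞ M] (g : Metric n M)

theorem contMDiff_comp_of_contDiffOn {W W' : Type*} [NormedAddCommGroup W] [NormedSpace ℝ W]
    [NormedAddCommGroup W'] [NormedSpace ℝ W'] {u : M → W} {φ : W → W'} {Ω : Set W}
    (hΩ : IsOpen Ω) (hφ : ContDiffOn ℝ ∞ φ Ω) (hu : ContMDiff (𝓡 n) 𝓘(ℝ, W) ∞ u)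
    (h : ∀ x, u x ∈ Ω) : ContMDiff (𝓡 n) 𝓘(ℝ, W') ∞ (fun x => φ (u x)) := fun x =>
  ((hφ.contDiffAt (hΩ.mem_nhds (h x))).contMDiffAt).comp x (hu x)

theorem contMDiff_sqrt {ρ : M → ℝ} (hρ : ContMDiff (𝓡 n) 𝓘(ℝ, ℝ) ∞ ρ) (h0 : ∀ x, 0 < ρ x) :
    ContMDiff (𝓡 n) 𝓘(ℝ, ℝ) ∞ (fun x => √(ρ x)) :=
  contMDiff_comp_of_contDiffOn isOpen_Ioi
    (contDiffOn_id.sqrt fun t (ht : t ∈ Ioi (0 : ℝ)) => (ne_of_gt ht)) hρ h0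

theorem hasDerivAt_cos_half (t : ℝ) :
    HasDerivAt (fun t => Real.cos (t / 2)) (-(1 / 2) * Real.sin (t / 2)) t := by
  convert ((hasDerivAt_id' t).div_const 2).cos using 1
  ring

theorem hasDerivAt_sin_half (t : ℝ) :
    HasDerivAt (fun t => Real.sin (t / 2)) ((1 / 2) * Real.cos (t / 2)) t := by
  convert ((hasDerivAt_id' t).div_const 2).sin using 1
  ring

theorem contMDiff_cos_half {θ : M → ℝ} (hθ : ContMDiff (𝓡 n) 𝓘(ℝ, ℝ) ∞ θ) :
    ContMDiff (𝓡 n) 𝓘(ℝ, ℝ) ∞ (fun x => Real.cos (θ x / 2)) :=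
  ((Real.contDiff_cos.comp (contDiff_id.div_const 2)).contMDiff).comp hθ

theorem contMDiff_sin_half {θ : M → ℝ} (hθ : ContMDiff (𝓡 n) 𝓘(ℝ, ℝ) ∞ θ) :
    ContMDiff (𝓡 n) 𝓘(ℝ, ℝ) ∞ (fun x => Real.sin (θ x / 2)) :=
  ((Real.contDiff_sin.comp (contDiff_id.div_const 2)).contMDiff).comp hθ

omit [TopologicalSpace M] in
theorem madelungFun_re (ρ θ : M → ℝ) (x : M) :
    (madelungFun ρ θ x).re = √(ρ x) * Real.cos (θ x / 2) := by
  rw [madelungFun, Complex.re_ofReal_mul, Complex.exp_ofReal_mul_I_re]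

omit [TopologicalSpace M] in
theorem madelungFun_im (ρ θ : M → ℝ) (x : M) :
    (madelungFun ρ θ x).im = √(ρ x) * Real.sin (θ x / 2) := by
  rw [madelungFun, Complex.im_ofReal_mul, Complex.exp_ofReal_mul_I_im]

/-- With r = √ρ the cross terms of r cos(θ/2) and r sin(θ/2) cancel, leaving |∇ψ|² = |∇r|² +
r²|∇θ|²/4, and ∇r = ∇ρ/(2r). -/
theorem gradNormSqC_madelungFun {ρ θ : M → ℝ} (hρ : ContMDiff (𝓡 n) 𝓘(ℝ, ℝ) ∞ ρ)
    (hθ : ContMDiff (𝓡 n) 𝓘(ℝ, ℝ) ∞ θ) (h0 : ∀ x, 0 < ρ x) (x : M) :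
    4 * gradNormSqC g (madelungFun ρ θ) x =
      gradInner g ρ ρ x / ρ x + gradInner g θ θ x * ρ x := by
  have hr := (contMDiff_sqrt hρ h0).mdifferentiableAt (x := x) (by simp)
  have hc := (contMDiff_cos_half hθ).mdifferentiableAt (x := x) (by simp)
  have hs := (contMDiff_sin_half hθ).mdifferentiableAt (x := x) (by simp)
  have ht := hθ.mdifferentiableAt (x := x) (by simp)
  have hp := hρ.mdifferentiableAt (x := x) (by simp)
  simp only [gradNormSqC, madelungFun_re, madelungFun_im, normSq_grad]
  rw [gradInner_mul_left g _ hr hc, gradInner_comm g _ (fun z => √(ρ z) * Real.cos (θ z / 2)),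
    gradInner_comm g _ (fun z => √(ρ z) * Real.cos (θ z / 2)), gradInner_mul_left g _ hr hc,
    gradInner_mul_left g _ hr hc,
    gradInner_mul_left g _ hr hs, gradInner_comm g _ (fun z => √(ρ z) * Real.sin (θ z / 2)),
    gradInner_comm g _ (fun z => √(ρ z) * Real.sin (θ z / 2)), gradInner_mul_left g _ hr hs,
    gradInner_mul_left g _ hr hs,
    gradInner_comp_self g ht (hasDerivAt_cos_half _),
    gradInner_comp_self g ht (hasDerivAt_sin_half _),
    gradInner_comp_left g _ ht (hasDerivAt_cos_half _),
    gradInner_comp_left g _ ht (hasDerivAt_sin_half _),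
    gradInner_comm g _ (fun z => Real.cos (θ z / 2)),
    gradInner_comm g _ (fun z => Real.sin (θ z / 2)),
    gradInner_comp_left g _ ht (hasDerivAt_cos_half _),
    gradInner_comp_left g _ ht (hasDerivAt_sin_half _),
    gradInner_comp_self g hp (Real.hasDerivAt_sqrt (h0 x).ne')]
  have hcs := Real.cos_sq_add_sin_sq (θ x / 2)
  have hsq := Real.sq_sqrt (h0 x).le
  have hr0 : √(ρ x) ≠ 0 := (Real.sqrt_pos.2 (h0 x)).ne'
  have hs2 : Real.sin (θ x / 2) ^ 2 = 1 - Real.cos (θ x / 2) ^ 2 := by linarith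
  -- After substituting ρ = r², the claim becomes an algebraic identity in r, the sine and the
  -- cosine, settled by s² + c² = 1.
  rw [← hsq]
  simp only [Real.sqrt_sq (Real.sqrt_nonneg _)]
  generalize √(ρ x) = r at *
  generalize Real.sin (θ x / 2) = s at *
  generalize Real.cos (θ x / 2) = c at *
  field_simp
  ring_nf
  rw [hs2]
  ring

variable [T2Space M] [CompactSpace M] [MeasurableSpace M] [BorelSpace M]

theorem lap_mul_cos_half {r θ : M → ℝ} (hr : ContMDiff (𝓡 n) 𝓘(ℝ, ℝ) ∞ r)
    (hθ : ContMDiff (𝓡 n) 𝓘(ℝ, ℝ) ∞ θ) (x : M) :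
    lap g (fun z => r z * Real.cos (θ z / 2)) x =
      Real.cos (θ x / 2) * (lap g r x - r x * gradInner g θ θ x / 4) -
      Real.sin (θ x / 2) * (r x * lap g θ x / 2 + gradInner g r θ x) := by
  rw [lap_mul g hr (contMDiff_cos_half hθ), lap_comp g hθ (h := fun t => Real.cos (t / 2))
    (h' := fun t => -(1 / 2) * Real.sin (t / 2))
    (h'' := fun t => -(1 / 2) * ((1 / 2) * Real.cos (t / 2))) (fun _ => hasDerivAt_cos_half _)
    (fun y => (hasDerivAt_sin_half (θ y)).const_mul _)
    (contMDiff_const.mul (contMDiff_sin_half hθ)),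
    gradInner_comm g r (fun z => Real.cos (θ z / 2)),
    gradInner_comp_left g _ (hθ.mdifferentiableAt (by simp)) (hasDerivAt_cos_half _),
    gradInner_comm g r]
  ring

theorem lap_mul_sin_half {r θ : M → ℝ} (hr : ContMDiff (𝓡 n) 𝓘(ℝ, ℝ) ∞ r)
    (hθ : ContMDiff (𝓡 n) 𝓘(ℝ, ℝ) ∞ θ) (x : M) :
    lap g (fun z => r z * Real.sin (θ z / 2)) x =
      Real.sin (θ x / 2) * (lap g r x - r x * gradInner g θ θ x / 4) +
      Real.cos (θ x / 2) * (r x * lap g θ x / 2 + gradInner g r θ x) := by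
  rw [lap_mul g hr (contMDiff_sin_half hθ), lap_comp g hθ (h := fun t => Real.sin (t / 2))
    (h' := fun t => (1 / 2) * Real.cos (t / 2))
    (h'' := fun t => (1 / 2) * (-(1 / 2) * Real.sin (t / 2))) (fun _ => hasDerivAt_sin_half _)
    (fun y => (hasDerivAt_cos_half (θ y)).const_mul _)
    (contMDiff_const.mul (contMDiff_cos_half hθ)),
    gradInner_comm g r (fun z => Real.sin (θ z / 2)),
    gradInner_comp_left g _ (hθ.mdifferentiableAt (by simp)) (hasDerivAt_sin_half _),
    gradInner_comm g r]
  ring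

/-- The Laplacians of r cos(θ/2) and r sin(θ/2) are the real and imaginary parts of a single complex
number multiplied by e^{iθ/2}. Factoring out this phase is what separates the two Madelung
equations. -/
theorem lapC_madelungFun {ρ θ : M → ℝ} (hρ : ContMDiff (𝓡 n) 𝓘(ℝ, ℝ) ∞ ρ)
    (hθ : ContMDiff (𝓡 n) 𝓘(ℝ, ℝ) ∞ θ) (h0 : ∀ x, 0 < ρ x) (x : M) :
    lapC g (madelungFun ρ θ) x = Complex.exp ((θ x / 2 : ℝ) * Complex.I) *
      (((lap g (fun z => √(ρ z)) x - √(ρ x) * gradInner g θ θ x / 4 : ℝ) : ℂ) +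
        ((√(ρ x) * lap g θ x / 2 + gradInner g (fun z => √(ρ z)) θ x : ℝ) : ℂ) * Complex.I) := by
  simp only [lapC, madelungFun_re, madelungFun_im]
  rw [lap_mul_cos_half g (contMDiff_sqrt hρ h0) hθ, lap_mul_sin_half g (contMDiff_sqrt hρ h0) hθ,
    Complex.exp_mul_I, ← Complex.ofReal_cos, ← Complex.ofReal_sin]
  apply Complex.ext
  · simp only [Complex.add_re, Complex.mul_re, Complex.ofReal_re, Complex.ofReal_im, Complex.I_re,
      Complex.I_im, Complex.add_im, Complex.mul_im]
    ring
  · simp only [Complex.add_re, Complex.mul_re, Complex.ofReal_re, Complex.ofReal_im, Complex.I_re,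
      Complex.I_im, Complex.add_im, Complex.mul_im]
    ring

/-- Two regroupings: −Δr + r|∇θ|²/4 + (V + f)r is r/2 times ½|∇θ|² plus the quantum potential, and
rΔθ/2 + ⟨∇r, ∇θ⟩ is div(r²∇θ)/(2r). -/
theorem schrodingerOp_madelungFun (V : M → ℝ) (f : ℝ → ℝ) {ρ θ : M → ℝ}
    (hρ : ContMDiff (𝓡 n) 𝓘(ℝ, ℝ) ∞ ρ)
    (hθ : ContMDiff (𝓡 n) 𝓘(ℝ, ℝ) ∞ θ) (h0 : ∀ x, 0 < ρ x) (x : M) :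
    schrodingerOp g V f (madelungFun ρ θ) x = Complex.exp ((θ x / 2 : ℝ) * Complex.I) *
      (((√(ρ x) / 2 * ((1 / 2) * normSq g x (grad g θ x) + quantumPotential g V f ρ x) : ℝ) : ℂ) -
        (((2 * √(ρ x))⁻¹ * divg g (fun y => ρ y • grad g θ y) x : ℝ) : ℂ) * Complex.I) := by
  have hr0 : √(ρ x) ≠ 0 := (Real.sqrt_pos.2 (h0 x)).ne'
  have hB : gradInner g ρ θ x = 2 * √(ρ x) * gradInner g (fun z => √(ρ z)) θ x := by
    rw [gradInner_comp_left g _ (hρ.mdifferentiableAt (by simp))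
      (Real.hasDerivAt_sqrt (h0 x).ne')]
    field_simp
  have e1 : √(ρ x) / 2 * ((1 / 2) * normSq g x (grad g θ x) + quantumPotential g V f ρ x) =
      -(lap g (fun z => √(ρ z)) x - √(ρ x) * gradInner g θ θ x / 4) +
        (V x + f (ρ x)) * √(ρ x) := by
    rw [quantumPotential, normSq_grad]
    field_simp
    ring
  have e2 : (2 * √(ρ x))⁻¹ * divg g (fun y => ρ y • grad g θ y) x =
      √(ρ x) * lap g θ x / 2 + gradInner g (fun z => √(ρ z)) θ x := by
    rw [divg_smul_grad g hρ hθ, hB]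
    nth_rw 2 [← Real.sq_sqrt (h0 x).le]
    field_simp
  rw [schrodingerOp, lapC_madelungFun g hρ hθ h0, norm_sq_madelungFun _ _ _ (h0 x).le, e1, e2,
    madelungFun]
  push_cast
  ring

end MadelungCalculus

/-! ### First variations of the potential and of the cotangent Hamiltonian. -/

section Variations

variable {n : ℕ} {M : Type u} [TopologicalSpace M] [ChartedSpace (EuclideanSpace ℝ (Fin n)) M]
  [IsManifold (𝓡 n) ∞ M] (g : Metric n M) [T2Space M] [CompactSpace M] [MeasurableSpace M]
  [BorelSpace M]

/-- Differentiation under the integral sign over a compact manifold. -/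
theorem hasDerivAt_integral_vol {G G' : ℝ → M → ℝ} {δ : ℝ} (hδ : 0 < δ)
    (hc : ∀ ε, |ε| < δ → Continuous (G ε))
    (hc' : ContinuousOn (fun p : ℝ × M => G' p.1 p.2) ({ε | |ε| < δ} ×ˢ univ))
    (hd : ∀ ε, |ε| < δ → ∀ x, HasDerivAt (fun e => G e x) (G' ε x) ε) :
    HasDerivAt (fun ε => ∫ x, G ε x ∂(vol g)) (∫ x, G' 0 x ∂(vol g)) 0 := by
  have hsub : Metric.closedBall (0 : ℝ) (δ / 2) ⊆ {ε | |ε| < δ} := fun ε hε => by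
    rw [mem_closedBall_zero_iff, Real.norm_eq_abs] at hε
    exact lt_of_le_of_lt hε (half_lt_self hδ)
  -- The derivative is continuous on the compact product of a time interval and M. A constant bound
  -- dominates it, and constants are integrable because the volume is finite.
  obtain ⟨C, hC⟩ := ((isCompact_closedBall (0 : ℝ) (δ / 2)).prod
    (isCompact_univ (X := M))).exists_bound_of_continuousOn
    (hc'.mono (prod_mono hsub Subset.rfl))
  have h0 : |(0 : ℝ)| < δ := by simpa using hδ
  have hG0 : Continuous (G' 0) := by
    rw [← continuousOn_univ]
    exact hc'.comp (f := fun x => ((0 : ℝ), x)) (by fun_prop) fun x _ => ⟨h0, mem_univ x⟩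
  refine (hasDerivAt_integral_of_dominated_loc_of_deriv_le (F := G) (F' := G')
    (bound := fun _ => C) (Metric.ball_mem_nhds 0 (half_pos hδ)) ?_
    (integrable_vol g (hc 0 h0)) hG0.aestronglyMeasurable ?_ (integrable_const C) ?_).2
  · filter_upwards [Metric.ball_mem_nhds (0 : ℝ) hδ] with ε hε
    refine (hc ε ?_).aestronglyMeasurable
    simpa using hε
  · exact Eventually.of_forall fun x ε hε => hC (ε, x) ⟨Metric.ball_subset_closedBall hε, mem_univ x⟩
  · exact Eventually.of_forall fun x ε hε => hd ε (hsub (Metric.ball_subset_closedBall hε)) x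

omit [T2Space M] [MeasurableSpace M] [BorelSpace M] [IsManifold (𝓡 n) ∞ M]
  [ChartedSpace (EuclideanSpace ℝ (Fin n)) M] in
-- The tube lemma over the compact M. It keeps densities positive along small variations, which
-- matters because f and F are controlled on positive numbers only.
theorem exists_forall_pos {Q : ℝ × M → ℝ} (hQ : Continuous Q) (h0 : ∀ x, 0 < Q (0, x)) :
    ∃ δ > 0, ∀ ε : ℝ, |ε| < δ → ∀ x, 0 < Q (ε, x) := by
  have h := (isCompact_univ (X := M)).eventually_forall_of_forall_eventually (x₀ := (0 : ℝ))
    (P := fun ε x => 0 < Q (ε, x)) fun x _ => hQ.continuousAt.eventually (lt_mem_nhds (h0 x))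
  obtain ⟨δ, hδ, hb⟩ := Metric.eventually_nhds_iff.1 h
  exact ⟨δ, hδ, fun ε hε x => hb (by simpa using hε) x (mem_univ x)⟩

theorem hasDerivAt_quadratic (a b c ε : ℝ) :
    HasDerivAt (fun e => a + e * b + e ^ 2 * c) (b + 2 * ε * c) ε := by
  refine ((((hasDerivAt_id' ε).mul_const b).const_add a).fun_add
    ((hasDerivAt_pow 2 ε).mul_const c)).congr_deriv ?_
  norm_num

theorem hasDerivAt_affine (a b ε : ℝ) : HasDerivAt (fun e => a + e * b) b ε := by
  simpa using ((hasDerivAt_id' ε).mul_const b).const_add a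

theorem hasDerivAt_integral_quadratic {A B C : M → ℝ} (hA : Continuous A) (hB : Continuous B)
    (hC : Continuous C) :
    HasDerivAt (fun ε => ∫ x, (A x + ε * B x + ε ^ 2 * C x) ∂(vol g)) (∫ x, B x ∂(vol g)) 0 := by
  have h := hasDerivAt_integral_vol g (G := fun ε x => A x + ε * B x + ε ^ 2 * C x)
    (G' := fun ε x => B x + 2 * ε * C x) one_pos (fun ε _ => by fun_prop)
    (Continuous.continuousOn (by fun_prop)) (fun ε _ x => hasDerivAt_quadratic _ _ _ _)
  simpa using h

/-- Stated for quadratic arguments so as to serve both ρ + εα, where c = 0, and |ψ + εη|². -/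
theorem hasDerivAt_integral_comp_quadratic {f F : ℝ → ℝ} (hf : ContinuousOn f (Ioi 0))
    (hF : ∀ a > 0, HasDerivAt F (f a) a) {a b c : M → ℝ} (ha : Continuous a) (hb : Continuous b)
    (hc : Continuous c) (h0 : ∀ x, 0 < a x) :
    HasDerivAt (fun ε => ∫ x, F (a x + ε * b x + ε ^ 2 * c x) ∂(vol g))
      (∫ x, f (a x) * b x ∂(vol g)) 0 := by
  obtain ⟨δ, hδ, hpos⟩ := exists_forall_pos
    (Q := fun p : ℝ × M => a p.2 + p.1 * b p.2 + p.1 ^ 2 * c p.2) (by fun_prop)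
    (by simpa using h0)
  have hFc : ContinuousOn F (Ioi 0) := fun t ht => (hF t ht).continuousAt.continuousWithinAt
  have h := hasDerivAt_integral_vol g (G := fun ε x => F (a x + ε * b x + ε ^ 2 * c x))
    (G' := fun ε x => f (a x + ε * b x + ε ^ 2 * c x) * (b x + 2 * ε * c x)) hδ
    (fun ε hε => by
      rw [← continuousOn_univ]
      exact hFc.comp (f := fun x => a x + ε * b x + ε ^ 2 * c x)
        (Continuous.continuousOn (by fun_prop)) fun x _ => hpos ε hε x)
    ((hf.comp (f := fun p : ℝ × M => a p.2 + p.1 * b p.2 + p.1 ^ 2 * c p.2)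
      (Continuous.continuousOn (by fun_prop)) fun p hp => hpos p.1 hp.1 p.2).mul
      (Continuous.continuousOn (by fun_prop)))
    (fun ε hε x => (hF _ (hpos ε hε x)).comp ε (hasDerivAt_quadratic _ _ _ _))
  simpa using h

theorem hasDerivAt_integral_quadratic_mul {A B C ρ α : M → ℝ} (hA : Continuous A)
    (hB : Continuous B) (hC : Continuous C) (hρ : Continuous ρ) (hα : Continuous α) :
    HasDerivAt (fun ε => ∫ x, (A x + ε * B x + ε ^ 2 * C x) * (ρ x + ε * α x) ∂(vol g))
      (∫ x, (B x * ρ x + A x * α x) ∂(vol g)) 0 := by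
  have h := hasDerivAt_integral_vol g
    (G := fun ε x => (A x + ε * B x + ε ^ 2 * C x) * (ρ x + ε * α x))
    (G' := fun ε x => (B x + 2 * ε * C x) * (ρ x + ε * α x) +
      (A x + ε * B x + ε ^ 2 * C x) * α x) one_pos (fun ε _ => by fun_prop)
    (Continuous.continuousOn (by fun_prop))
    (fun ε _ x => (hasDerivAt_quadratic _ _ _ _).mul (hasDerivAt_affine _ _ _))
  simpa using h

theorem hasDerivAt_integral_quadratic_div {A B C ρ α : M → ℝ} (hA : Continuous A)
    (hB : Continuous B) (hC : Continuous C) (hρ : Continuous ρ) (hα : Continuous α)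
    (h0 : ∀ x, 0 < ρ x) :
    HasDerivAt (fun ε => ∫ x, (A x + ε * B x + ε ^ 2 * C x) / (ρ x + ε * α x) ∂(vol g))
      (∫ x, (B x * ρ x - A x * α x) / ρ x ^ 2 ∂(vol g)) 0 := by
  obtain ⟨δ, hδ, hpos⟩ := exists_forall_pos
    (Q := fun p : ℝ × M => ρ p.2 + p.1 * α p.2) (by fun_prop) (by simpa using h0)
  have h := hasDerivAt_integral_vol g
    (G := fun ε x => (A x + ε * B x + ε ^ 2 * C x) / (ρ x + ε * α x))
    (G' := fun ε x => ((B x + 2 * ε * C x) * (ρ x + ε * α x) -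
      (A x + ε * B x + ε ^ 2 * C x) * α x) / (ρ x + ε * α x) ^ 2) hδ
    (fun ε hε => Continuous.div (by fun_prop) (by fun_prop) fun x => (hpos ε hε x).ne')
    (ContinuousOn.div (Continuous.continuousOn (by fun_prop))
      (Continuous.continuousOn (by fun_prop)) fun p hp => (pow_pos (hpos p.1 hp.1 p.2) 2).ne')
    (fun ε hε x => (hasDerivAt_quadratic _ _ _ _).div (hasDerivAt_affine _ _ _)
      (hpos ε hε x).ne')
  simpa using h

/-- From ρ = r·r one gets Δρ = 2rΔr + 2|∇r|², which eliminates Δ√ρ. In this form the quantum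
potential can be compared with the variation of the Fisher information, and its dependence on time
is visibly smooth. -/
theorem quantumPotential_eq (V : M → ℝ) (f : ℝ → ℝ) {ρ : M → ℝ}
    (hρ : ContMDiff (𝓡 n) 𝓘(ℝ, ℝ) ∞ ρ) (h0 : ∀ x, 0 < ρ x) (x : M) :
    quantumPotential g V f ρ x = 2 * V x + 2 * f (ρ x) +
      (-(lap g ρ x / ρ x) + 1 / 2 * (gradInner g ρ ρ x / ρ x ^ 2)) := by
  have hr := contMDiff_sqrt hρ h0
  have h1 := lap_mul g hr hr x
  simp only [Real.mul_self_sqrt (h0 _).le] at h1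
  rw [gradInner_comp_self g (hρ.mdifferentiableAt (by simp)) (Real.hasDerivAt_sqrt (h0 x).ne')]
    at h1
  have hr0 : √(ρ x) ≠ 0 := (Real.sqrt_pos.2 (h0 x)).ne'
  rw [quantumPotential, h1]
  have hsq := Real.sq_sqrt (h0 x).le
  rw [← hsq]
  simp only [Real.sqrt_sq (Real.sqrt_nonneg _)]
  field_simp
  ring

theorem contMDiff_quantumPotential {V : M → ℝ} (hV : ContMDiff (𝓡 n) 𝓘(ℝ, ℝ) ∞ V) {f : ℝ → ℝ}
    (hf : ContDiffOn ℝ ∞ f (Ioi 0)) {ρ : M → ℝ}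
    (hρ : ContMDiff (𝓡 n) 𝓘(ℝ, ℝ) ∞ ρ) (h0 : ∀ x, 0 < ρ x) :
    ContMDiff (𝓡 n) 𝓘(ℝ, ℝ) ∞ (quantumPotential g V f ρ) := by
  have h1 := contMDiff_comp_of_contDiffOn isOpen_Ioi hf hρ h0
  have h2 := contMDiff_comp_of_contDiffOn (φ := fun t : ℝ => t⁻¹) isOpen_Ioi
    (contDiffOn_id.inv fun t (ht : t ∈ Ioi (0 : ℝ)) => (ne_of_gt ht)) (contMDiff_sqrt hρ h0)
    fun x => Real.sqrt_pos.2 (h0 x)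
  exact ((contMDiff_const.mul hV).add (contMDiff_const.mul h1)).sub
    ((contMDiff_const.mul (contMDiff_lap g (contMDiff_sqrt hρ h0))).mul h2)

/-- The variation of ½∫|∇ρ|²/ρ is ∫⟨∇ρ, ∇α⟩/ρ − ½∫α|∇ρ|²/ρ². Moving the derivative off α produces
exactly the terms of `quantumPotential_eq`. -/
theorem hasDerivAt_potential {V : M → ℝ} (hV : ContMDiff (𝓡 n) 𝓘(ℝ, ℝ) ∞ V) {f F : ℝ → ℝ}
    (hf : ContDiffOn ℝ ∞ f (Ioi 0)) (hF : ∀ a > 0, HasDerivAt F (f a) a) {ρ α : M → ℝ}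
    (hρ : ContMDiff (𝓡 n) 𝓘(ℝ, ℝ) ∞ ρ) (h0 : ∀ x, 0 < ρ x)
    (hα : ContMDiff (𝓡 n) 𝓘(ℝ, ℝ) ∞ α) :
    HasDerivAt (fun ε : ℝ => potential g V F fun x => ρ x + ε * α x)
      (∫ x, quantumPotential g V f ρ x * α x ∂(vol g)) 0 := by
  have hρc := hρ.continuous
  have hαc := hα.continuous
  have hVc := hV.continuous
  have hAs := contMDiff_gradInner g hρ hρ
  have hA := hAs.continuous
  have hB := (contMDiff_gradInner g hρ hα).continuous
  have hC := (contMDiff_gradInner g hα hα).continuous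
  have hL := (contMDiff_lap g hρ).continuous
  have hfc : Continuous (fun x => f (ρ x)) :=
    (contMDiff_comp_of_contDiffOn isOpen_Ioi hf hρ h0).continuous
  have e1 : ∀ ε x, normSq g x (grad g (fun x => ρ x + ε * α x) x) =
      gradInner g ρ ρ x + ε * (2 * gradInner g ρ α x) + ε ^ 2 * gradInner g α α x := fun ε x =>
    gradInner_add_mul g ε (hρ.mdifferentiableAt (by simp)) (hα.mdifferentiableAt (by simp))
  have hinv : ContMDiff (𝓡 n) 𝓘(ℝ, ℝ) ∞ (fun x => (ρ x)⁻¹) :=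
    contMDiff_comp_of_contDiffOn (φ := fun t : ℝ => t⁻¹) isOpen_Ioi
      (contDiffOn_id.inv fun t (ht : t ∈ Ioi (0 : ℝ)) => (ne_of_gt ht)) hρ h0
  have hinvc := hinv.continuous
  have i1 := hasDerivAt_integral_quadratic_div g hA (hB.const_mul 2) hC hρc hαc h0
  have i2 := hasDerivAt_integral_quadratic g (A := fun x => V x * ρ x) (B := fun x => V x * α x)
    (hVc.mul hρc) (hVc.mul hαc) (continuous_const (y := (0 : ℝ)))
  have i3 := hasDerivAt_integral_comp_quadratic g hf.continuousOn hF hρc hαc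
    (continuous_const (y := (0 : ℝ))) h0
  have i := (((i1.const_mul (1 / 8)).const_mul 4).add (i2.const_mul 2)).add (i3.const_mul 2)
  -- Green's identity with weight 1/ρ: the divergence −div(ρ⁻¹∇ρ) expands to −Δρ/ρ + |∇ρ|²/ρ².
  have green : ∫ x, α x * (-(lap g ρ x / ρ x) + gradInner g ρ ρ x / ρ x ^ 2) ∂(vol g) =
      ∫ x, gradInner g ρ α x / ρ x ∂(vol g) := by
    have h := integral_mul_divg_smul_grad g hα hinv hρ
    rw [← neg_eq_iff_eq_neg, ← integral_neg] at h
    refine (integral_congr_ae (Eventually.of_forall fun x => ?_)).trans (h.trans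
      (integral_congr_ae (Eventually.of_forall fun x => ?_)))
    · rw [divg_smul_grad g hinv hρ, gradInner_comp_left g ρ (hρ.mdifferentiableAt (by simp))
        (hasDerivAt_inv (h0 x).ne')]
      have := (h0 x).ne'
      field_simp
      ring
    · change (ρ x)⁻¹ * gradInner g α ρ x = gradInner g ρ α x / ρ x
      rw [gradInner_comm]
      ring
  have hq : ∫ x, quantumPotential g V f ρ x * α x ∂(vol g) =
      4 * (1 / 8 * ∫ x, (2 * gradInner g ρ α x * ρ x - gradInner g ρ ρ x * α x) / ρ x ^ 2 ∂(vol g))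
      + 2 * ∫ x, V x * α x ∂(vol g) + 2 * ∫ x, f (ρ x) * α x ∂(vol g) := by
    have hne : ∀ x, ρ x ≠ 0 := fun x => (h0 x).ne'
    have hne2 : ∀ x, ρ x ^ 2 ≠ 0 := fun x => pow_ne_zero 2 (hne x)
    have j1 : Integrable (fun x => gradInner g ρ α x / ρ x) (vol g) :=
      integrable_vol g (hB.div hρc hne)
    have j2 : Integrable (fun x => gradInner g ρ ρ x * α x / ρ x ^ 2) (vol g) :=
      integrable_vol g ((hA.mul hαc).div (hρc.pow 2) hne2)
    have j3 : Integrable (fun x => α x * (-(lap g ρ x / ρ x) + gradInner g ρ ρ x / ρ x ^ 2))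
        (vol g) := integrable_vol g
      (hαc.mul ((hL.div hρc hne).neg.add (hA.div (hρc.pow 2) hne2)))
    have j4 : Integrable (fun x => V x * α x) (vol g) := integrable_vol g (hVc.mul hαc)
    have j5 : Integrable (fun x => f (ρ x) * α x) (vol g) := integrable_vol g (hfc.mul hαc)
    have k1 : ∀ x, quantumPotential g V f ρ x * α x =
        α x * (-(lap g ρ x / ρ x) + gradInner g ρ ρ x / ρ x ^ 2) -
        1 / 2 * (gradInner g ρ ρ x * α x / ρ x ^ 2) + 2 * (V x * α x) + 2 * (f (ρ x) * α x) := by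
      intro x
      rw [quantumPotential_eq g V f hρ h0]
      ring
    have k2 : ∀ x, (2 * gradInner g ρ α x * ρ x - gradInner g ρ ρ x * α x) / ρ x ^ 2 =
        2 * (gradInner g ρ α x / ρ x) - gradInner g ρ ρ x * α x / ρ x ^ 2 := by
      intro x
      have := hne x
      field_simp
    simp only [k1, k2]
    have j6 : Integrable (fun x => α x * (-(lap g ρ x / ρ x) + gradInner g ρ ρ x / ρ x ^ 2) -
        1 / 2 * (gradInner g ρ ρ x * α x / ρ x ^ 2)) (vol g) := j3.sub (j2.const_mul _)
    have j7 : Integrable (fun x => α x * (-(lap g ρ x / ρ x) + gradInner g ρ ρ x / ρ x ^ 2) -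
        1 / 2 * (gradInner g ρ ρ x * α x / ρ x ^ 2) + 2 * (V x * α x)) (vol g) :=
      j6.add (j4.const_mul _)
    rw [integral_add j7 (j5.const_mul _),
      integral_add j6 (j4.const_mul _), integral_sub j3 (j2.const_mul _),
      integral_sub (j1.const_mul _) j2, green]
    simp only [integral_const_mul]
    ring
  rw [hq]
  refine i.congr_of_eventuallyEq (Eventually.of_forall fun ε => ?_)
  simp only [potential, fisherInfo, e1, mul_zero, add_zero, Pi.add_apply, mul_add]
  simp only [mul_left_comm (V _)]

/-- The derivative in θ is ∫ρ⟨∇θ, ∇β⟩ = −∫β div(ρ∇θ), and the derivative in ρ is ∫α(½|∇θ|² + δŪ/δϱ).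
The signs of `cotForm` turn this pair into the field of the system. -/
theorem hasDerivAt_cotHamiltonian {V : M → ℝ} (hV : ContMDiff (𝓡 n) 𝓘(ℝ, ℝ) ∞ V) {f F : ℝ → ℝ}
    (hf : ContDiffOn ℝ ∞ f (Ioi 0)) (hF : ∀ a > 0, HasDerivAt F (f a) a) {ρ θ α β : M → ℝ}
    (hρ : ContMDiff (𝓡 n) 𝓘(ℝ, ℝ) ∞ ρ) (h0 : ∀ x, 0 < ρ x)
    (hθ : ContMDiff (𝓡 n) 𝓘(ℝ, ℝ) ∞ θ) (hα : ContMDiff (𝓡 n) 𝓘(ℝ, ℝ) ∞ α)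
    (hβ : ContMDiff (𝓡 n) 𝓘(ℝ, ℝ) ∞ β) :
    HasDerivAt (fun ε : ℝ => cotHamiltonian g V F
        (fun x => ρ x + ε * α x, fun x => θ x + ε * β x))
      (cotForm g (cotField g V f (ρ, θ)) (α, β)) 0 := by
  have hA := (contMDiff_gradInner g hθ hθ).continuous
  have hB := (contMDiff_gradInner g hθ hβ).continuous
  have hC := (contMDiff_gradInner g hβ hβ).continuous
  have hQ := (contMDiff_quantumPotential g hV hf hρ h0).continuous
  have hD := (contMDiff_divg g ((smoothField_grad g hθ).smul hρ)).continuous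
  have hρc := hρ.continuous
  have hαc := hα.continuous
  have hβc := hβ.continuous
  have e1 : ∀ ε x, normSq g x (grad g (fun x => θ x + ε * β x) x) =
      gradInner g θ θ x + ε * (2 * gradInner g θ β x) + ε ^ 2 * gradInner g β β x := fun ε x =>
    gradInner_add_mul g ε (hθ.mdifferentiableAt (by simp)) (hβ.mdifferentiableAt (by simp))
  have i := ((hasDerivAt_integral_quadratic_mul g hA (hB.const_mul 2) hC hρc hαc).const_mul
    (1 / 2)).add (hasDerivAt_potential g hV hf hF hρ h0 hα)
  have hq : cotForm g (cotField g V f (ρ, θ)) (α, β) =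
      1 / 2 * ∫ x, (2 * gradInner g θ β x * ρ x + gradInner g θ θ x * α x) ∂(vol g) +
        ∫ x, quantumPotential g V f ρ x * α x ∂(vol g) := by
    have green := integral_mul_divg_smul_grad g hβ hρ hθ
    have j1 : Integrable (fun x => β x * divg g (fun z => ρ z • grad g θ z) x) (vol g) :=
      integrable_vol g (hβc.mul hD)
    have j2 : Integrable (fun x => quantumPotential g V f ρ x * α x) (vol g) :=
      integrable_vol g (hQ.mul hαc)
    have j3 : Integrable (fun x => gradInner g θ θ x * α x) (vol g) :=
      integrable_vol g (hA.mul hαc)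
    have j4 : Integrable (fun x => ρ x * gradInner g β θ x) (vol g) :=
      integrable_vol g (hρc.mul (contMDiff_gradInner g hβ hθ).continuous)
    have k1 : ∀ x, -divg g (fun y => ρ y • grad g θ y) x * β x - α x *
        (-(1 / 2 * normSq g x (grad g θ x)) - quantumPotential g V f ρ x) =
        -(β x * divg g (fun z => ρ z • grad g θ z) x) + 1 / 2 * (gradInner g θ θ x * α x) +
        quantumPotential g V f ρ x * α x := fun x => by
      rw [normSq_grad]
      ring
    have k2 : ∀ x, 2 * gradInner g θ β x * ρ x + gradInner g θ θ x * α x =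
        2 * (ρ x * gradInner g β θ x) + gradInner g θ θ x * α x := fun x => by
      rw [gradInner_comm g β]
      ring
    simp only [cotForm, cotField, k1, k2]
    have j5 : Integrable (fun x => -(β x * divg g (fun z => ρ z • grad g θ z) x) +
        1 / 2 * (gradInner g θ θ x * α x)) (vol g) := j1.neg.add (j3.const_mul _)
    have j6 : Integrable (fun x => -(β x * divg g (fun z => ρ z • grad g θ z) x)) (vol g) := j1.neg
    rw [integral_add j5 j2, integral_add j6 (j3.const_mul _),
      integral_neg, green, integral_add (j4.const_mul _) j3]
    simp only [integral_const_mul]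
    ring
  rw [hq]
  refine i.congr_of_eventuallyEq (Eventually.of_forall fun ε => ?_)
  simp only [cotHamiltonian, e1, Pi.add_apply]

/-- The integrated form of `gradNormSqC_madelungFun`; the part of 4|∇ψ|² without θ is the density of
eight times the Fisher information. -/
theorem four_mul_waveHamiltonian_madelungFun {V : M → ℝ} (hV : ContMDiff (𝓡 n) 𝓘(ℝ, ℝ) ∞ V)
    {F : ℝ → ℝ} (hF : ContinuousOn F (Ioi 0)) {ρ θ : M → ℝ}
    (hρ : ContMDiff (𝓡 n) 𝓘(ℝ, ℝ) ∞ ρ) (h0 : ∀ x, 0 < ρ x)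
    (hθ : ContMDiff (𝓡 n) 𝓘(ℝ, ℝ) ∞ θ) :
    4 * waveHamiltonian g V F (madelungFun ρ θ) = cotHamiltonian g V F (ρ, θ) := by
  have hρc := hρ.continuous
  have hFc : Continuous (fun x => F (ρ x)) := by
    rw [← continuousOn_univ]
    exact hF.comp hρc.continuousOn fun x _ => h0 x
  have j1 : Integrable (fun x => gradInner g ρ ρ x / ρ x) (vol g) := integrable_vol g
    ((contMDiff_gradInner g hρ hρ).continuous.div hρc fun x => (h0 x).ne')
  have j2 : Integrable (fun x => gradInner g θ θ x * ρ x) (vol g) := integrable_vol g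
    ((contMDiff_gradInner g hθ hθ).continuous.mul hρc)
  have j3 : Integrable (fun x => V x * ρ x) (vol g) := integrable_vol g (hV.continuous.mul hρc)
  have j4 : Integrable (fun x => F (ρ x)) (vol g) := integrable_vol g hFc
  have k : ∀ x, gradNormSqC g (madelungFun ρ θ) x = 1 / 4 *
      (gradInner g ρ ρ x / ρ x + gradInner g θ θ x * ρ x) := fun x => by
    rw [← gradNormSqC_madelungFun g hρ hθ h0]
    ring
  simp only [waveHamiltonian, cotHamiltonian, potential, fisherInfo, k, normSq_grad,
    norm_sq_madelungFun _ _ _ (h0 _).le]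
  rw [integral_const_mul, integral_add j1 j2, integral_add j3 j4]
  ring

end Variations

/-! ### First variation of the Schrödinger Hamiltonian. -/

section WaveVariation

variable {n : ℕ} {M : Type u} [TopologicalSpace M] [ChartedSpace (EuclideanSpace ℝ (Fin n)) M]
  [IsManifold (𝓡 n) ∞ M] (g : Metric n M) [T2Space M] [CompactSpace M] [MeasurableSpace M]
  [BorelSpace M]

theorem contMDiff_re {ψ : M → ℂ} (hψ : ContMDiff (𝓡 n) 𝓘(ℝ, ℂ) ∞ ψ) :
    ContMDiff (𝓡 n) 𝓘(ℝ, ℝ) ∞ (fun x => (ψ x).re) :=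
  Complex.reCLM.contDiff.contMDiff.comp hψ

theorem contMDiff_im {ψ : M → ℂ} (hψ : ContMDiff (𝓡 n) 𝓘(ℝ, ℂ) ∞ ψ) :
    ContMDiff (𝓡 n) 𝓘(ℝ, ℝ) ∞ (fun x => (ψ x).im) :=
  Complex.imCLM.contDiff.contMDiff.comp hψ

theorem integral_im_vol {h : M → ℂ} (hh : Continuous h) :
    (∫ x, h x ∂(vol g)).im = ∫ x, (h x).im ∂(vol g) :=
  (integral_im (𝕜 := ℂ) (integrable_vol g hh)).symm

theorem waveForm_eq_integral {η ζ : M → ℂ} (hη : Continuous η) (hζ : Continuous ζ) :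
    waveForm g η ζ = ∫ x, ((η x).re * (ζ x).im - (η x).im * (ζ x).re) ∂(vol g) := by
  rw [waveForm, integral_im_vol g (h := fun x => (starRingEnd ℂ) (η x) * ζ x)
    ((Complex.continuous_conj.comp hη).mul hζ)]
  refine integral_congr_ae (Eventually.of_forall fun x => ?_)
  simp only [Complex.mul_im, Complex.conj_re, Complex.conj_im]
  ring

/-- With S the Schrödinger operator, the first variation is Re∫ conj(Sψ)·η after integrating by
parts. Since conj(−iSψ) = i·conj(Sψ), this is Ω(−iSψ, η), so the Hamiltonian flow is ψ̇ = −iSψ. -/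
theorem hasDerivAt_waveHamiltonian {V : M → ℝ} (hV : ContMDiff (𝓡 n) 𝓘(ℝ, ℝ) ∞ V) {f F : ℝ → ℝ}
    (hf : ContDiffOn ℝ ∞ f (Ioi 0)) (hF : ∀ a > 0, HasDerivAt F (f a) a) {ψ η : M → ℂ}
    (hψ : ContMDiff (𝓡 n) 𝓘(ℝ, ℂ) ∞ ψ) (h0 : ∀ x, ψ x ≠ 0)
    (hη : ContMDiff (𝓡 n) 𝓘(ℝ, ℂ) ∞ η) :
    HasDerivAt (fun ε : ℝ => waveHamiltonian g V F (fun x => ψ x + ε * η x))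
      (waveForm g (fun x => -Complex.I * schrodingerOp g V f ψ x) η) 0 := by
  have hp := contMDiff_re hψ
  have hq := contMDiff_im hψ
  have ha := contMDiff_re hη
  have hb := contMDiff_im hη
  have hpc := hp.continuous
  have hqc := hq.continuous
  have hac := ha.continuous
  have hbc := hb.continuous
  have hVc := hV.continuous
  have hψc := hψ.continuous
  have hηc := hη.continuous
  set N : M → ℝ := fun x => ‖ψ x‖ ^ 2 with hN
  set B : M → ℝ := fun x => 2 * ((ψ x).re * (η x).re + (ψ x).im * (η x).im) with hB
  set C : M → ℝ := fun x => ‖η x‖ ^ 2 with hC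
  have hNc : Continuous N := by fun_prop
  have hBc : Continuous B := by fun_prop
  have hCc : Continuous C := by fun_prop
  have hN0 : ∀ x, 0 < N x := fun x => pow_pos (norm_pos_iff.2 (h0 x)) 2
  have hsq : ∀ (ε : ℝ) x, ‖ψ x + ε * η x‖ ^ 2 = N x + ε * B x + ε ^ 2 * C x := fun ε x => by
    simp only [hN, hB, hC, Complex.sq_norm, Complex.normSq_apply, Complex.add_re, Complex.add_im,
      Complex.re_ofReal_mul, Complex.im_ofReal_mul]
    ring
  have hgr : ∀ (ε : ℝ) x, gradNormSqC g (fun x => ψ x + ε * η x) x =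
      (gradInner g (fun x => (ψ x).re) (fun x => (ψ x).re) x +
        gradInner g (fun x => (ψ x).im) (fun x => (ψ x).im) x) +
      ε * (2 * (gradInner g (fun x => (η x).re) (fun x => (ψ x).re) x +
        gradInner g (fun x => (η x).im) (fun x => (ψ x).im) x)) +
      ε ^ 2 * (gradInner g (fun x => (η x).re) (fun x => (η x).re) x +
        gradInner g (fun x => (η x).im) (fun x => (η x).im) x) := fun ε x => by
    simp only [gradNormSqC, normSq_grad, Complex.add_re, Complex.add_im,
      Complex.re_ofReal_mul, Complex.im_ofReal_mul]
    rw [gradInner_add_mul g ε (hp.mdifferentiableAt (by simp)) (ha.mdifferentiableAt (by simp)),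
      gradInner_add_mul g ε (hq.mdifferentiableAt (by simp)) (hb.mdifferentiableAt (by simp)),
      gradInner_comm g (fun x => (η x).re) (fun x => (ψ x).re),
      gradInner_comm g (fun x => (η x).im) (fun x => (ψ x).im)]
    ring
  have hGre := (contMDiff_gradInner g ha hp).continuous
  have hGim := (contMDiff_gradInner g hb hq).continuous
  have i1 := hasDerivAt_integral_quadratic g
    (A := fun x => gradInner g (fun x => (ψ x).re) (fun x => (ψ x).re) x +
        gradInner g (fun x => (ψ x).im) (fun x => (ψ x).im) x)
    (B := fun x => 2 * (gradInner g (fun x => (η x).re) (fun x => (ψ x).re) x +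
        gradInner g (fun x => (η x).im) (fun x => (ψ x).im) x))
    (C := fun x => gradInner g (fun x => (η x).re) (fun x => (η x).re) x +
        gradInner g (fun x => (η x).im) (fun x => (η x).im) x)
    ((contMDiff_gradInner g hp hp).continuous.add (contMDiff_gradInner g hq hq).continuous)
    ((hGre.add hGim).const_mul 2)
    ((contMDiff_gradInner g ha ha).continuous.add (contMDiff_gradInner g hb hb).continuous)
  have i2 := hasDerivAt_integral_quadratic g (A := fun x => V x * N x)
    (B := fun x => V x * B x) (C := fun x => V x * C x) (hVc.mul hNc) (hVc.mul hBc) (hVc.mul hCc)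
  have i3 := hasDerivAt_integral_comp_quadratic g hf.continuousOn hF hNc hBc hCc hN0
  have i := (i1.const_mul (1 / 2)).add ((i2.add i3).const_mul (1 / 2))
  have hfc : Continuous (fun x => f (N x)) := by
    rw [← continuousOn_univ]
    exact hf.continuousOn.comp hNc.continuousOn fun x _ => hN0 x
  have hL1 := (contMDiff_lap g hp).continuous
  have hL2 := (contMDiff_lap g hq).continuous
  have hS : Continuous (schrodingerOp g V f ψ) := by
    unfold schrodingerOp lapC
    have h1 : Continuous (fun x => ((f (‖ψ x‖ ^ 2) : ℝ) : ℂ)) := Complex.continuous_ofReal.comp hfc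
    fun_prop
  have hform : waveForm g (fun x => -Complex.I * schrodingerOp g V f ψ x) η =
      1 / 2 * ∫ x, 2 * (gradInner g (fun x => (η x).re) (fun x => (ψ x).re) x +
        gradInner g (fun x => (η x).im) (fun x => (ψ x).im) x) ∂(vol g) +
      1 / 2 * ((∫ x, V x * B x ∂(vol g)) + ∫ x, f (N x) * B x ∂(vol g)) := by
    have k : ∀ x, (-Complex.I * schrodingerOp g V f ψ x).re * (η x).im -
        (-Complex.I * schrodingerOp g V f ψ x).im * (η x).re =
        -((η x).re * lap g (fun x => (ψ x).re) x) + -((η x).im * lap g (fun x => (ψ x).im) x) +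
          (1 / 2 * (V x * B x) + 1 / 2 * (f (N x) * B x)) := fun x => by
      simp only [schrodingerOp, lapC, hB, hN, Complex.mul_re, Complex.mul_im, Complex.neg_re,
        Complex.neg_im, Complex.add_re, Complex.add_im, Complex.ofReal_re, Complex.ofReal_im,
        Complex.I_re, Complex.I_im]
      ring
    rw [waveForm_eq_integral g (η := fun x => -Complex.I * schrodingerOp g V f ψ x)
      (continuous_const.mul hS) hηc]
    simp only [k]
    have j1 : Integrable (fun x => -((η x).re * lap g (fun x => (ψ x).re) x)) (vol g) :=
      integrable_vol g (hac.mul hL1).neg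
    have j2 : Integrable (fun x => -((η x).im * lap g (fun x => (ψ x).im) x)) (vol g) :=
      integrable_vol g (hbc.mul hL2).neg
    have j3 : Integrable (fun x => 1 / 2 * (V x * B x)) (vol g) :=
      integrable_vol g ((hVc.mul hBc).const_mul _)
    have j4 : Integrable (fun x => 1 / 2 * (f (N x) * B x)) (vol g) :=
      integrable_vol g ((hfc.mul hBc).const_mul _)
    have j12 : Integrable (fun x => -((η x).re * lap g (fun x => (ψ x).re) x) +
      -((η x).im * lap g (fun x => (ψ x).im) x)) (vol g) := j1.add j2
    have j34 : Integrable (fun x => 1 / 2 * (V x * B x) + 1 / 2 * (f (N x) * B x)) (vol g) :=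
      j3.add j4
    rw [integral_add j12 j34, integral_add j1 j2, integral_add j3 j4, integral_neg, integral_neg,
      integral_mul_lap g ha hp, integral_mul_lap g hb hq]
    simp only [integral_const_mul]
    rw [integral_add (integrable_vol g hGre) (integrable_vol g hGim)]
    ring
  rw [hform]
  -- For small ε the function ψ + εη still has no zero. Then F(|ψ + εη|²) is continuous, hence
  -- integrable, and the potential integral may be split.
  obtain ⟨δ, hδ, hpos⟩ := exists_forall_pos
    (Q := fun p : ℝ × M => N p.2 + p.1 * B p.2 + p.1 ^ 2 * C p.2) (by fun_prop)
    (by simpa using hN0)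
  refine i.congr_of_eventuallyEq ?_
  filter_upwards [Metric.ball_mem_nhds (0 : ℝ) hδ] with ε hε
  have hε' : |ε| < δ := by simpa using hε
  have hFc : Continuous (fun x => F (N x + ε * B x + ε ^ 2 * C x)) := by
    have : ContinuousOn F (Ioi 0) := fun t ht => (hF t ht).continuousAt.continuousWithinAt
    rw [← continuousOn_univ]
    exact this.comp (f := fun x => N x + ε * B x + ε ^ 2 * C x)
      (Continuous.continuousOn (by fun_prop)) fun x _ => hpos ε hε' x
  have hVN : Integrable (fun x => V x * N x + ε * (V x * B x) + ε ^ 2 * (V x * C x)) (vol g) :=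
    integrable_vol g (by fun_prop)
  have e : ∀ x, V x * (N x + ε * B x + ε ^ 2 * C x) =
    V x * N x + ε * (V x * B x) + ε ^ 2 * (V x * C x) := fun x => by ring
  simp only [waveHamiltonian, hgr, hsq, e, Pi.add_apply]
  rw [integral_add hVN (integrable_vol g hFc)]

end WaveVariation

/-! ### Convergence of all derivatives, stable under composition with smooth maps. -/

section SmoothConvergence

variable {E : Type} [NormedAddCommGroup E] [NormedSpace ℝ E] {ι : Type*} {l : Filter ι} {T : Set E}

/-- Convergence of all derivatives up to order `k`, in the sense of continuous convergence at the
points of `T`. -/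
def SmoothTendsto {W : Type*} [NormedAddCommGroup W] [NormedSpace ℝ W] (T : Set E) (k : ℕ)
    (l : Filter ι) (h : ι → E → W) (h₀ : E → W) : Prop :=
  ∀ j ≤ k, ∀ y ∈ T, Tendsto (fun p : ι × E => iteratedFDeriv ℝ j (h p.1) p.2) (l ×ˢ 𝓝 y)
    (𝓝 (iteratedFDeriv ℝ j h₀ y))

variable {W : Type} [NormedAddCommGroup W] [NormedSpace ℝ W]
  {W' : Type} [NormedAddCommGroup W'] [NormedSpace ℝ W']

theorem tendsto_iteratedFDeriv_zero_iff {h : ι → E → W} {h₀ : E → W} {y : E} :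
    Tendsto (fun p : ι × E => iteratedFDeriv ℝ 0 (h p.1) p.2) (l ×ˢ 𝓝 y)
      (𝓝 (iteratedFDeriv ℝ 0 h₀ y)) ↔
    Tendsto (fun p : ι × E => h p.1 p.2) (l ×ˢ 𝓝 y) (𝓝 (h₀ y)) := by
  simp only [iteratedFDeriv_zero_eq_comp]
  exact ((continuousMultilinearCurryFin0 ℝ E W).symm.toHomeomorph.isInducing.tendsto_nhds_iff
    (f := fun p : ι × E => h p.1 p.2)).symm

theorem tendsto_iteratedFDeriv_succ_iff {h : ι → E → W} {h₀ : E → W} {y : E} {j : ℕ} :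
    Tendsto (fun p : ι × E => iteratedFDeriv ℝ (j + 1) (h p.1) p.2) (l ×ˢ 𝓝 y)
      (𝓝 (iteratedFDeriv ℝ (j + 1) h₀ y)) ↔
    Tendsto (fun p : ι × E => iteratedFDeriv ℝ j (fderiv ℝ (h p.1)) p.2) (l ×ˢ 𝓝 y)
      (𝓝 (iteratedFDeriv ℝ j (fderiv ℝ h₀) y)) := by
  simp only [iteratedFDeriv_succ_eq_comp_right]
  exact ((continuousMultilinearCurryRightEquiv' ℝ j E W).symm.toHomeomorph.isInducing.tendsto_nhds_iff
    (f := fun p : ι × E => iteratedFDeriv ℝ j (fderiv ℝ (h p.1)) p.2)).symm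

theorem smoothTendsto_zero_iff {h : ι → E → W} {h₀ : E → W} :
    SmoothTendsto T 0 l h h₀ ↔
      ∀ y ∈ T, Tendsto (fun p : ι × E => h p.1 p.2) (l ×ˢ 𝓝 y) (𝓝 (h₀ y)) := by
  constructor
  · exact fun H y hy => tendsto_iteratedFDeriv_zero_iff.1 (H 0 le_rfl y hy)
  · intro H j hj y hy
    obtain rfl := Nat.le_zero.1 hj
    exact tendsto_iteratedFDeriv_zero_iff.2 (H y hy)

/-- This recursion drives the inductions below. Their target spaces are quantified inside the
statement because the induction step replaces W by the space of linear maps from E to W. -/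
theorem smoothTendsto_succ_iff {k : ℕ} {h : ι → E → W} {h₀ : E → W} :
    SmoothTendsto T (k + 1) l h h₀ ↔
      (∀ y ∈ T, Tendsto (fun p : ι × E => h p.1 p.2) (l ×ˢ 𝓝 y) (𝓝 (h₀ y))) ∧
      SmoothTendsto T k l (fun i => fderiv ℝ (h i)) (fderiv ℝ h₀) := by
  constructor
  · refine fun H => ⟨fun y hy => tendsto_iteratedFDeriv_zero_iff.1 (H 0 (Nat.zero_le _) y hy),
      fun j hj y hy => tendsto_iteratedFDeriv_succ_iff.1 (H (j + 1) (by omega) y hy)⟩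
  · rintro ⟨H, H'⟩ (_ | j) hj y hy
    · exact tendsto_iteratedFDeriv_zero_iff.2 (H y hy)
    · exact tendsto_iteratedFDeriv_succ_iff.2 (H' j (by omega) y hy)

theorem SmoothTendsto.tendsto {k : ℕ} {h : ι → E → W} {h₀ : E → W}
    (H : SmoothTendsto T k l h h₀) {y : E} (hy : y ∈ T) :
    Tendsto (fun p : ι × E => h p.1 p.2) (l ×ˢ 𝓝 y) (𝓝 (h₀ y)) :=
  tendsto_iteratedFDeriv_zero_iff.1 (H 0 (Nat.zero_le _) y hy)

theorem SmoothTendsto.mono {k m : ℕ} (hkm : k ≤ m) {h : ι → E → W} {h₀ : E → W}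
    (H : SmoothTendsto T m l h h₀) : SmoothTendsto T k l h h₀ :=
  fun j hj => H j (hj.trans hkm)

theorem SmoothTendsto.congr (hT : IsOpen T) {k : ℕ} {h h' : ι → E → W} {h₀ h₀' : E → W}
    (H : SmoothTendsto T k l h h₀) (e : ∀ᶠ i in l, EqOn (h i) (h' i) T) (e₀ : EqOn h₀ h₀' T) :
    SmoothTendsto T k l h' h₀' := by
  intro j hj y hy
  have aux : ∀ {a b : E → W}, EqOn a b T → EqOn (iteratedFDeriv ℝ j a) (iteratedFDeriv ℝ j b) T :=
    fun {a b} hab z hz => by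
      have : a =ᶠ[𝓝 z] b := hab.eventuallyEq_of_mem (hT.mem_nhds hz)
      exact (this.iteratedFDeriv ℝ j).eq_of_nhds
  rw [← aux e₀ hy]
  refine (H j hj y hy).congr' ?_
  filter_upwards [e.prod_mk (hT.mem_nhds hy)] with p hp
  exact aux hp.1 hp.2

theorem SmoothTendsto.clm_comp (hT : IsOpen T) {k : ℕ} :
    ∀ {W W' : Type} [NormedAddCommGroup W] [NormedSpace ℝ W] [NormedAddCommGroup W']
      [NormedSpace ℝ W'] (L : W →L[ℝ] W') {h : ι → E → W} {h₀ : E → W},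
      SmoothTendsto T k l h h₀ → (∀ᶠ i in l, ContDiffOn ℝ ∞ (h i) T) → ContDiffOn ℝ ∞ h₀ T →
      SmoothTendsto T k l (fun i y => L (h i y)) (fun y => L (h₀ y)) := by
  induction k with
  | zero =>
    intro W W' _ _ _ _ L h h₀ H _ _
    rw [smoothTendsto_zero_iff] at H ⊢
    exact fun y hy => (L.continuous.tendsto _).comp (H y hy)
  | succ k ih =>
    intro W W' _ _ _ _ L h h₀ H hs hs₀
    rw [smoothTendsto_succ_iff] at H ⊢
    refine ⟨fun y hy => (L.continuous.tendsto _).comp (H.1 y hy), ?_⟩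
    have aux : ∀ {a : E → W}, ContDiffOn ℝ ∞ a T →
        EqOn (fun y => ContinuousLinearMap.compL ℝ E W W' L (fderiv ℝ a y))
          (fderiv ℝ fun y => L (a y)) T := fun {a} ha y hy =>
      (L.hasFDerivAt.comp y ((ha.contDiffAt (hT.mem_nhds hy)).differentiableAt
        (by simp)).hasFDerivAt).fderiv.symm
    refine (ih (ContinuousLinearMap.compL ℝ E W W' L) H.2 (hs.mono fun i hi =>
      hi.fderiv_of_isOpen hT (by simp)) (hs₀.fderiv_of_isOpen hT (by simp))).congr hT
      (hs.mono fun i hi => aux hi) (aux hs₀)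

theorem SmoothTendsto.prodMk (hT : IsOpen T) {k : ℕ} :
    ∀ {W W' : Type} [NormedAddCommGroup W] [NormedSpace ℝ W] [NormedAddCommGroup W']
      [NormedSpace ℝ W'] {h : ι → E → W} {h₀ : E → W} {h' : ι → E → W'} {h₀' : E → W'},
      SmoothTendsto T k l h h₀ → SmoothTendsto T k l h' h₀' →
      (∀ᶠ i in l, ContDiffOn ℝ ∞ (h i) T) → ContDiffOn ℝ ∞ h₀ T →
      (∀ᶠ i in l, ContDiffOn ℝ ∞ (h' i) T) → ContDiffOn ℝ ∞ h₀' T →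
      SmoothTendsto T k l (fun i y => (h i y, h' i y)) (fun y => (h₀ y, h₀' y)) := by
  induction k with
  | zero =>
    intro W W' _ _ _ _ h h₀ h' h₀' H H' _ _ _ _
    rw [smoothTendsto_zero_iff] at H H' ⊢
    exact fun y hy => (H y hy).prodMk_nhds (H' y hy)
  | succ k ih =>
    intro W W' _ _ _ _ h h₀ h' h₀' H H' hs hs₀ hs' hs₀'
    rw [smoothTendsto_succ_iff] at H H' ⊢
    refine ⟨fun y hy => (H.1 y hy).prodMk_nhds (H'.1 y hy), ?_⟩
    have aux : ∀ {a : E → W} {a' : E → W'}, ContDiffOn ℝ ∞ a T → ContDiffOn ℝ ∞ a' T →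
        EqOn (fun y => (ContinuousLinearMap.prodₗᵢ (𝕜 := ℝ) (E := E) (F := W) (G := W') ℝ
          ).toContinuousLinearEquiv.toContinuousLinearMap (fderiv ℝ a y, fderiv ℝ a' y))
          (fderiv ℝ fun y => (a y, a' y)) T := fun {a a'} ha ha' y hy =>
      ((((ha.contDiffAt (hT.mem_nhds hy)).differentiableAt (by simp)).hasFDerivAt).prodMk
        (((ha'.contDiffAt (hT.mem_nhds hy)).differentiableAt (by simp)).hasFDerivAt)).fderiv.symm
    have d : ∀ᶠ i in l, ContDiffOn ℝ ∞ (fderiv ℝ (h i)) T :=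
      hs.mono fun i hi => hi.fderiv_of_isOpen hT (by simp)
    have d' : ∀ᶠ i in l, ContDiffOn ℝ ∞ (fderiv ℝ (h' i)) T :=
      hs'.mono fun i hi => hi.fderiv_of_isOpen hT (by simp)
    have d₀ := hs₀.fderiv_of_isOpen (m := ∞) hT (by simp)
    have d₀' := hs₀'.fderiv_of_isOpen (m := ∞) hT (by simp)
    refine ((ih H.2 H'.2 d d₀ d' d₀').clm_comp hT _ ?_ (d₀.prodMk d₀')).congr hT ?_ (aux hs₀ hs₀')
    · filter_upwards [d, d'] with i hi hi'
      exact hi.prodMk hi'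
    · filter_upwards [hs, hs'] with i hi hi'
      exact aux hi hi'

/-- The derivative of `φ ∘ h` in terms of `(h, Dh)`. -/
def prolong (E : Type) [NormedAddCommGroup E] [NormedSpace ℝ E] (φ : W → W')
    (q : W × (E →L[ℝ] W)) : E →L[ℝ] W' :=
  (fderiv ℝ φ q.1).comp q.2

theorem contDiffOn_prolong {φ : W → W'} {Ω : Set W} (hΩ : IsOpen Ω) (hφ : ContDiffOn ℝ ∞ φ Ω) :
    ContDiffOn ℝ ∞ (prolong E φ) (Ω ×ˢ univ) :=
  ((hφ.fderiv_of_isOpen (m := ∞) hΩ (by simp)).comp contDiffOn_fst fun _ hq => hq.1).clm_comp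
    contDiffOn_snd

theorem fderiv_comp_eq_prolong {φ : W → W'} {Ω : Set W} (hΩ : IsOpen Ω) (hφ : ContDiffOn ℝ ∞ φ Ω)
    (hT : IsOpen T) {h : E → W} (hs : ContDiffOn ℝ ∞ h T) (hm : MapsTo h T Ω) {y : E} (hy : y ∈ T) :
    fderiv ℝ (fun y => φ (h y)) y = prolong E φ (h y, fderiv ℝ h y) :=
  (((hφ.contDiffAt (hΩ.mem_nhds (hm hy))).differentiableAt (by simp)).hasFDerivAt.comp y
    ((hs.contDiffAt (hT.mem_nhds hy)).differentiableAt (by simp)).hasFDerivAt).fderiv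

/-- The derivative of φ ∘ h is `prolong E φ` composed with the pair (h, Dh). This is again a smooth
map composed with a convergent family, one order lower. -/
theorem SmoothTendsto.comp_smooth (hT : IsOpen T) {k : ℕ} :
    ∀ {W W' : Type} [NormedAddCommGroup W] [NormedSpace ℝ W] [NormedAddCommGroup W']
      [NormedSpace ℝ W'] {φ : W → W'} {Ω : Set W}, IsOpen Ω → ContDiffOn ℝ ∞ φ Ω →
      ∀ {h : ι → E → W} {h₀ : E → W}, SmoothTendsto T k l h h₀ →
      (∀ᶠ i in l, ContDiffOn ℝ ∞ (h i) T ∧ MapsTo (h i) T Ω) → ContDiffOn ℝ ∞ h₀ T →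
      MapsTo h₀ T Ω →
      SmoothTendsto T k l (fun i y => φ (h i y)) (fun y => φ (h₀ y)) := by
  induction k with
  | zero =>
    intro W W' _ _ _ _ φ Ω hΩ hφ h h₀ H _ _ hm₀
    rw [smoothTendsto_zero_iff] at H ⊢
    exact fun y hy => (hφ.continuousOn.continuousAt (hΩ.mem_nhds (hm₀ hy))).tendsto.comp (H y hy)
  | succ k ih =>
    intro W W' _ _ _ _ φ Ω hΩ hφ h h₀ H hs hs₀ hm₀
    rw [smoothTendsto_succ_iff]
    refine ⟨fun y hy =>
      (hφ.continuousOn.continuousAt (hΩ.mem_nhds (hm₀ hy))).tendsto.comp (H.tendsto hy), ?_⟩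
    have d : ∀ᶠ i in l, ContDiffOn ℝ ∞ (fderiv ℝ (h i)) T :=
      hs.mono fun i hi => hi.1.fderiv_of_isOpen hT (by simp)
    have d₀ := hs₀.fderiv_of_isOpen (m := ∞) hT (by simp)
    refine (ih (hΩ.prod isOpen_univ) (contDiffOn_prolong hΩ hφ)
      ((H.mono (Nat.le_succ k)).prodMk hT (smoothTendsto_succ_iff.1 H).2
        (hs.mono fun i hi => hi.1) hs₀ d d₀) ?_ (hs₀.prodMk d₀)
      fun y hy => ⟨hm₀ hy, mem_univ _⟩).congr hT ?_ ?_
    · filter_upwards [hs, d] with i hi hi'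
      exact ⟨hi.1.prodMk hi', fun y hy => ⟨hi.2 hy, mem_univ _⟩⟩
    · filter_upwards [hs] with i hi y hy
      exact (fderiv_comp_eq_prolong hΩ hφ hT hi.1 hi.2 hy).symm
    · exact fun y hy => (fderiv_comp_eq_prolong hΩ hφ hT hs₀ hm₀ hy).symm

/-- Strict differentiability of φ at a(y) is essential: the limit is taken jointly, as t tends to 0
and the point moves to y. Applied to the pair (a + tb, a), it gives an error o(tb) and hence o(b)
after division by t. -/
theorem tendsto_slope_comp {φ : W → W'} {Ω : Set W} (hΩ : IsOpen Ω) (hφ : ContDiffOn ℝ ∞ φ Ω)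
    (hT : IsOpen T) {a b : E → W} (ha : ContDiffOn ℝ ∞ a T) (hb : ContDiffOn ℝ ∞ b T)
    (hm : MapsTo a T Ω) {y : E} (hy : y ∈ T) :
    Tendsto (fun p : ℝ × E => p.1⁻¹ • (φ (a p.2 + p.1 • b p.2) - φ (a p.2))) (𝓝[≠] 0 ×ˢ 𝓝 y)
      (𝓝 (fderiv ℝ φ (a y) (b y))) := by
  have hst := (hφ.contDiffAt (hΩ.mem_nhds (hm hy))).hasStrictFDerivAt (n := ∞) (by simp)
  have hac : ContinuousAt a y := (ha.continuousOn).continuousAt (hT.mem_nhds hy)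
  have hbc : ContinuousAt b y := (hb.continuousOn).continuousAt (hT.mem_nhds hy)
  have ht1 : Tendsto (fun p : ℝ × E => p.1) (𝓝[≠] 0 ×ˢ 𝓝 y) (𝓝 0) :=
    tendsto_fst.mono_right nhdsWithin_le_nhds
  have ht2 : Tendsto (fun p : ℝ × E => a p.2) (𝓝[≠] 0 ×ˢ 𝓝 y) (𝓝 (a y)) :=
    hac.tendsto.comp tendsto_snd
  have ht3 : Tendsto (fun p : ℝ × E => b p.2) (𝓝[≠] 0 ×ˢ 𝓝 y) (𝓝 (b y)) :=
    hbc.tendsto.comp tendsto_snd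
  have ht4 : Tendsto (fun p : ℝ × E => (a p.2 + p.1 • b p.2, a p.2)) (𝓝[≠] 0 ×ˢ 𝓝 y)
      (𝓝 (a y, a y)) := by
    have := ht2.add (ht1.smul ht3)
    rw [zero_smul, add_zero] at this
    exact this.prodMk_nhds ht2
  have hne : ∀ᶠ p : ℝ × E in 𝓝[≠] 0 ×ˢ 𝓝 y, p.1 ≠ 0 :=
    tendsto_fst.eventually (eventually_mem_nhdsWithin (s := {(0 : ℝ)}ᶜ) (a := 0))
  have h1 : (fun p : ℝ × E => p.1⁻¹ • (φ (a p.2 + p.1 • b p.2) - φ (a p.2)) -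
      fderiv ℝ φ (a y) (b p.2)) =o[𝓝[≠] 0 ×ˢ 𝓝 y] (fun p => b p.2) := by
    have h2 := (hst.isLittleO.comp_tendsto ht4)
    have h3 := (Asymptotics.isBigO_refl (fun p : ℝ × E => p.1⁻¹) (𝓝[≠] 0 ×ˢ 𝓝 y)).smul_isLittleO h2
    refine h3.congr' ?_ ?_
    · filter_upwards [hne] with p hp
      simp [smul_sub, smul_smul, inv_mul_cancel₀ hp]
    · filter_upwards [hne] with p hp
      simp [smul_smul, inv_mul_cancel₀ hp]
  have h2 := (Asymptotics.isLittleO_one_iff ℝ).1 (h1.trans_isBigO (ht3.isBigO_one ℝ))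
  have h3 := h2.add (((fderiv ℝ φ (a y)).continuous.tendsto _).comp ht3)
  rw [zero_add] at h3
  exact h3.congr fun p => by simp

/-- Both sides equal D²φ(a)(Da, b) + Dφ(a)Db, up to the order of the arguments of D²φ; symmetry of
the second derivative closes the gap. -/
theorem fderiv_fderiv_apply_eq {φ : W → W'} {Ω : Set W} (hΩ : IsOpen Ω)
    (hφ : ContDiffOn ℝ ∞ φ Ω) (hT : IsOpen T) {a b : E → W} (ha : ContDiffOn ℝ ∞ a T)
    (hb : ContDiffOn ℝ ∞ b T) (hm : MapsTo a T Ω) {y : E} (hy : y ∈ T) :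
    fderiv ℝ (fun y => fderiv ℝ φ (a y) (b y)) y =
      fderiv ℝ (prolong E φ) (a y, fderiv ℝ a y) (b y, fderiv ℝ b y) := by
  have hφa := hφ.contDiffAt (hΩ.mem_nhds (hm hy))
  have hφ' : HasFDerivAt (fderiv ℝ φ) (fderiv ℝ (fderiv ℝ φ) (a y)) (a y) :=
    ((((hφ.fderiv_of_isOpen (m := ∞) hΩ (by simp))).contDiffAt
      (hΩ.mem_nhds (hm hy))).differentiableAt (by simp)).hasFDerivAt
  have ha' := ((ha.contDiffAt (hT.mem_nhds hy)).differentiableAt (by simp)).hasFDerivAt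
  have hb' := ((hb.contDiffAt (hT.mem_nhds hy)).differentiableAt (by simp)).hasFDerivAt
  have h1 := (hφ'.comp y ha').clm_apply hb'
  have h2 : HasFDerivAt (prolong E φ) _ (a y, fderiv ℝ a y) :=
    (hφ'.comp (a y, fderiv ℝ a y) hasFDerivAt_fst).clm_comp hasFDerivAt_snd
  rw [h2.fderiv]
  refine h1.fderiv.trans ?_
  ext e
  have hsymm := hφa.isSymmSndFDerivAt
    (by simpa using WithTop.coe_le_coe.2 (le_top (a := (2 : ℕ∞)))) (fderiv ℝ a y e) (b y)
  simp [hsymm, add_comm]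

/-- The spatial derivative of a difference quotient of φ at a along b is the difference quotient of
`prolong E φ` at (a, Da) along (b, Db). The induction hypothesis applies to it, and
`fderiv_fderiv_apply_eq` identifies its limit. -/
theorem smoothTendsto_slope_comp (hT : IsOpen T) {k : ℕ} :
    ∀ {W W' : Type} [NormedAddCommGroup W] [NormedSpace ℝ W] [NormedAddCommGroup W']
      [NormedSpace ℝ W'] {φ : W → W'} {Ω : Set W}, IsOpen Ω → ContDiffOn ℝ ∞ φ Ω →
      ∀ {a b : E → W}, ContDiffOn ℝ ∞ a T → ContDiffOn ℝ ∞ b T → MapsTo a T Ω →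
      (∀ᶠ t : ℝ in 𝓝[≠] 0, MapsTo (fun y => a y + t • b y) T Ω) →
      SmoothTendsto T k (𝓝[≠] (0 : ℝ)) (fun t y => t⁻¹ • (φ (a y + t • b y) - φ (a y)))
        (fun y => fderiv ℝ φ (a y) (b y)) := by
  induction k with
  | zero =>
    intro W W' _ _ _ _ φ Ω hΩ hφ a b ha hb hm _
    rw [smoothTendsto_zero_iff]
    exact fun y hy => tendsto_slope_comp hΩ hφ hT ha hb hm hy
  | succ k ih =>
    intro W W' _ _ _ _ φ Ω hΩ hφ a b ha hb hm hmt
    rw [smoothTendsto_succ_iff]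
    refine ⟨fun y hy => tendsto_slope_comp hΩ hφ hT ha hb hm hy, ?_⟩
    have da := ha.fderiv_of_isOpen (m := ∞) hT (by simp)
    have db := hb.fderiv_of_isOpen (m := ∞) hT (by simp)
    refine (ih (hΩ.prod isOpen_univ) (contDiffOn_prolong (E := E) hΩ hφ) (ha.prodMk da)
      (hb.prodMk db) (fun y hy => ⟨hm hy, mem_univ _⟩)
      (hmt.mono fun t ht y hy => ⟨ht hy, mem_univ _⟩)).congr hT ?_
      fun y hy => (fderiv_fderiv_apply_eq hΩ hφ hT ha hb hm hy).symm
    filter_upwards [hmt] with t ht y hy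
    have hab : ContDiffOn ℝ ∞ (fun y => a y + t • b y) T := ha.add (hb.const_smul t)
    have d : ∀ {c : E → W}, ContDiffOn ℝ ∞ c T → MapsTo c T Ω →
        DifferentiableAt ℝ (fun y => φ (c y)) y := fun hc hcm =>
      ((hφ.comp hc hcm).contDiffAt (hT.mem_nhds hy)).differentiableAt (by simp)
    have ha' := (ha.contDiffAt (hT.mem_nhds hy)).differentiableAt (n := ∞) (by simp)
    have hb' := (hb.contDiffAt (hT.mem_nhds hy)).differentiableAt (n := ∞) (by simp)
    have e1 : fderiv ℝ (fun y => a y + t • b y) y = fderiv ℝ a y + t • fderiv ℝ b y :=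
      (ha'.hasFDerivAt.add (hb'.hasFDerivAt.const_smul t)).fderiv
    have e2 : fderiv ℝ (fun y => t⁻¹ • (φ (a y + t • b y) - φ (a y))) y =
        t⁻¹ • (fderiv ℝ (fun y => φ (a y + t • b y)) y - fderiv ℝ (fun y => φ (a y)) y) :=
      (((d hab ht).hasFDerivAt.sub (d ha hm).hasFDerivAt).const_smul t⁻¹).fderiv
    change t⁻¹ • (prolong E φ (a y + t • b y, fderiv ℝ a y + t • fderiv ℝ b y) -
      prolong E φ (a y, fderiv ℝ a y)) = _
    rw [e2, fderiv_comp_eq_prolong hΩ hφ hT hab ht hy, fderiv_comp_eq_prolong hΩ hφ hT ha hm hy, e1]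

end SmoothConvergence

/-! ### The Fréchet spaces of smooth functions and superposition operators. -/

section FrechetSpaces

variable {n : ℕ} {M : Type u} [TopologicalSpace M] [ChartedSpace (EuclideanSpace ℝ (Fin n)) M]
  [IsManifold (𝓡 n) ∞ M]
  {W : Type} [NormedAddCommGroup W] [NormedSpace ℝ W]
  {W' : Type} [NormedAddCommGroup W'] [NormedSpace ℝ W'] {ι : Type*} {l : Filter ι}

/-- When the limit is continuous, local uniform convergence is continuous convergence. The latter
composes with continuous maps without any estimates. -/
theorem tendsto_uniformity_iff_tendsto {X Y : Type*} [TopologicalSpace X] [UniformSpace Y]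
    {F : ι → X → Y} {f : X → Y} {y : X} (hf : ContinuousAt f y) :
    Tendsto (fun p : ι × X => (f p.2, F p.1 p.2)) (l ×ˢ 𝓝 y) (uniformity Y) ↔
      Tendsto (fun p : ι × X => F p.1 p.2) (l ×ˢ 𝓝 y) (𝓝 (f y)) := by
  have h1 : Tendsto (fun p : ι × X => f p.2) (l ×ˢ 𝓝 y) (𝓝 (f y)) := hf.tendsto.comp tendsto_snd
  rw [Uniform.tendsto_nhds_right]
  constructor
  · exact fun h => (Uniform.tendsto_nhds_right.1 h1).uniformity_trans h
  · exact fun h => (Uniform.tendsto_nhds_left.1 h1).uniformity_trans h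

/-- Uniform convergence on compact subsets of an open set of ℝⁿ is locally uniform convergence. As
all derivatives of the limit are continuous, this is continuous convergence. From here on the
topology is used only through this criterion. -/
theorem tendsto_smooth_iff {F : ι → C^∞⟮𝓡 n, M; 𝓘(ℝ, W), W⟯} {u : C^∞⟮𝓡 n, M; 𝓘(ℝ, W), W⟯} :
    Tendsto F l (𝓝 u) ↔ ∀ (x₀ : M) (k : ℕ), SmoothTendsto (extChartAt (𝓡 n) x₀).target k l
      (fun i y => F i ((extChartAt (𝓡 n) x₀).symm y))
      (fun y => u ((extChartAt (𝓡 n) x₀).symm y)) := by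
  have h1 : Tendsto F l (𝓝 u) ↔ ∀ (x₀ : M) (k : ℕ), ∀ y ∈ (extChartAt (𝓡 n) x₀).target,
      Tendsto (fun p : ι × EuclideanSpace ℝ (Fin n) =>
        iteratedFDeriv ℝ k (fun y => F p.1 ((extChartAt (𝓡 n) x₀).symm y)) p.2) (l ×ˢ 𝓝 y)
      (𝓝 (iteratedFDeriv ℝ k (fun y => u ((extChartAt (𝓡 n) x₀).symm y)) y)) := by
    rw [smoothTopology, nhds_iInf, tendsto_iInf]
    refine forall_congr' fun x₀ => ?_
    rw [nhds_iInf, tendsto_iInf]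
    refine forall_congr' fun k => ?_
    rw [nhds_induced, tendsto_comap_iff]
    have hT := isOpen_target (n := n) x₀
    have hc : ContinuousOn (iteratedFDeriv ℝ k (fun y => u ((extChartAt (𝓡 n) x₀).symm y)))
        (extChartAt (𝓡 n) x₀).target :=
      ((contDiffOn_comp_symm u.contMDiff x₀).continuousOn_iteratedFDerivWithin
        (m := k) (by exact_mod_cast le_top) hT.uniqueDiffOn).congr fun y hy =>
          (iteratedFDerivWithin_of_isOpen k hT hy).symm
    rw [UniformOnFun.tendsto_iff_tendstoUniformlyOn]
    trans TendstoLocallyUniformlyOn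
      (fun i => iteratedFDeriv ℝ k (fun y => F i ((extChartAt (𝓡 n) x₀).symm y)))
      (iteratedFDeriv ℝ k (fun y => u ((extChartAt (𝓡 n) x₀).symm y))) l
      (extChartAt (𝓡 n) x₀).target
    · rw [tendstoLocallyUniformlyOn_iff_forall_isCompact hT]
      exact ⟨fun h K hK hK' => h K ⟨hK', hK⟩, fun h K hK => h K hK.2 hK.1⟩
    · rw [hT.tendstoLocallyUniformlyOn_iff_forall_tendsto]
      exact forall₂_congr fun y hy =>
        tendsto_uniformity_iff_tendsto
          (F := fun i => iteratedFDeriv ℝ k (fun y => F i ((extChartAt (𝓡 n) x₀).symm y))) (hc.continuousAt (hT.mem_nhds hy))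
  rw [h1]
  exact ⟨fun h x₀ k j _ => h x₀ j, fun h x₀ k => h x₀ k k le_rfl⟩

/-- The order-zero case of convergence in the chart at x already contains joint continuity in the
function and the point. -/
theorem tendsto_smooth_eval (u : C^∞⟮𝓡 n, M; 𝓘(ℝ, W), W⟯) (x : M) :
    Tendsto (fun p : C^∞⟮𝓡 n, M; 𝓘(ℝ, W), W⟯ × M => p.1 p.2) (𝓝 u ×ˢ 𝓝 x) (𝓝 (u x)) := by
  have h := ((tendsto_smooth_iff (l := 𝓝 u) (F := fun w => w)).1 tendsto_id x 0).tendsto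
    (mem_extChartAt_target (I := 𝓡 n) x)
  rw [extChartAt_to_inv] at h
  have h2 : Tendsto (fun p : C^∞⟮𝓡 n, M; 𝓘(ℝ, W), W⟯ × M => (p.1, extChartAt (𝓡 n) x p.2))
      (𝓝 u ×ˢ 𝓝 x) (𝓝 u ×ˢ 𝓝 (extChartAt (𝓡 n) x x)) :=
    tendsto_fst.prodMk ((continuousAt_extChartAt (I := 𝓡 n) x).tendsto.comp tendsto_snd)
  refine (h.comp h2).congr' ?_
  filter_upwards [prod_mem_prod univ_mem (extChartAt_source_mem_nhds (I := 𝓡 n) x)] with p hp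
  exact congrArg p.1 ((extChartAt (𝓡 n) x).left_inv hp.2)

theorem continuous_smooth_eval :
    Continuous (fun p : C^∞⟮𝓡 n, M; 𝓘(ℝ, W), W⟯ × M => p.1 p.2) :=
  continuous_iff_continuousAt.2 fun p => by
    rw [ContinuousAt, nhds_prod_eq]
    exact tendsto_smooth_eval p.1 p.2

theorem continuous_smooth_apply (x : M) :
    Continuous (fun u : C^∞⟮𝓡 n, M; 𝓘(ℝ, W), W⟯ => u x) :=
  continuous_smooth_eval.comp (continuous_id.prodMk continuous_const)

instance : T2Space C^∞⟮𝓡 n, M; 𝓘(ℝ, W), W⟯ :=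
  T2Space.of_injective_continuous (f := fun u : C^∞⟮𝓡 n, M; 𝓘(ℝ, W), W⟯ => (u : M → W))
    DFunLike.coe_injective (continuous_pi continuous_smooth_apply)

/-- The function `x ↦ (u x, w x)`. -/
def smoothPair (u : C^∞⟮𝓡 n, M; 𝓘(ℝ, W), W⟯) (w : C^∞⟮𝓡 n, M; 𝓘(ℝ, W'), W'⟯) :
    C^∞⟮𝓡 n, M; 𝓘(ℝ, W × W'), W × W'⟯ :=
  ⟨fun x => (u x, w x), u.contMDiff.prodMk_space w.contMDiff⟩

theorem continuous_smoothPair : Continuous (fun p : C^∞⟮𝓡 n, M; 𝓘(ℝ, W), W⟯ ×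
    C^∞⟮𝓡 n, M; 𝓘(ℝ, W'), W'⟯ => smoothPair p.1 p.2) :=
  continuous_iff_continuousAt.2 fun p => by
    rw [ContinuousAt, tendsto_smooth_iff]
    intro x₀ k
    exact (tendsto_smooth_iff.1 (continuous_fst.tendsto p) x₀ k).prodMk (isOpen_target x₀)
      (tendsto_smooth_iff.1 (continuous_snd.tendsto p) x₀ k)
      (Eventually.of_forall fun q => contDiffOn_comp_symm q.1.contMDiff x₀)
      (contDiffOn_comp_symm p.1.contMDiff x₀)
      (Eventually.of_forall fun q => contDiffOn_comp_symm q.2.contMDiff x₀)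
      (contDiffOn_comp_symm p.2.contMDiff x₀)

theorem contMDiff_comp_smooth {φ : W → W'} {Ω : Set W} (hΩ : IsOpen Ω) (hφ : ContDiffOn ℝ ∞ φ Ω)
    (u : C^∞⟮𝓡 n, M; 𝓘(ℝ, W), W⟯) (h : ∀ x, u x ∈ Ω) :
    ContMDiff (𝓡 n) 𝓘(ℝ, W') ∞ (fun x => φ (u x)) := fun x =>
  ((hφ.contDiffAt (hΩ.mem_nhds (h x))).contMDiffAt).comp x (u.contMDiff x)

open Classical in
/-- The superposition operator `u ↦ φ ∘ u`, on functions with values in the open set `Ω`. -/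
def superpose {φ : W → W'} {Ω : Set W} (hΩ : IsOpen Ω) (hφ : ContDiffOn ℝ ∞ φ Ω)
    (u : C^∞⟮𝓡 n, M; 𝓘(ℝ, W), W⟯) : C^∞⟮𝓡 n, M; 𝓘(ℝ, W'), W'⟯ :=
  if h : ∀ x, u x ∈ Ω then
    ⟨fun x => φ (u x), contMDiff_comp_smooth hΩ hφ u h⟩
  else 0

theorem superpose_apply {φ : W → W'} {Ω : Set W} (hΩ : IsOpen Ω) (hφ : ContDiffOn ℝ ∞ φ Ω)
    {u : C^∞⟮𝓡 n, M; 𝓘(ℝ, W), W⟯} (h : ∀ x, u x ∈ Ω) (x : M) :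
    superpose hΩ hφ u x = φ (u x) :=
  congrArg (fun w : C^∞⟮𝓡 n, M; 𝓘(ℝ, W'), W'⟯ => w x) (dif_pos h)

theorem tendsto_superpose {φ : W → W'} {Ω : Set W} (hΩ : IsOpen Ω) (hφ : ContDiffOn ℝ ∞ φ Ω)
    {F : ι → C^∞⟮𝓡 n, M; 𝓘(ℝ, W), W⟯} {u : C^∞⟮𝓡 n, M; 𝓘(ℝ, W), W⟯} (H : Tendsto F l (𝓝 u))
    (h : ∀ᶠ i in l, ∀ x, F i x ∈ Ω) (h₀ : ∀ x, u x ∈ Ω) :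
    Tendsto (fun i => superpose hΩ hφ (F i)) l (𝓝 (superpose hΩ hφ u)) := by
  rw [tendsto_smooth_iff] at H ⊢
  intro x₀ k
  refine ((H x₀ k).comp_smooth (isOpen_target x₀) hΩ hφ ?_ (contDiffOn_comp_symm u.contMDiff x₀)
    fun y _ => h₀ _).congr (isOpen_target x₀) ?_ fun y _ => (superpose_apply hΩ hφ h₀ _).symm
  · exact h.mono fun i hi => ⟨contDiffOn_comp_symm (F i).contMDiff x₀, fun y _ => hi _⟩
  · exact h.mono fun i hi y _ => (superpose_apply hΩ hφ hi _).symm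

theorem continuousOn_superpose {φ : W → W'} {Ω : Set W} (hΩ : IsOpen Ω)
    (hφ : ContDiffOn ℝ ∞ φ Ω) :
    ContinuousOn (superpose (n := n) (M := M) hΩ hφ) {u | ∀ x, u x ∈ Ω} := fun _ hu =>
  tendsto_superpose hΩ hφ (tendsto_id.mono_left nhdsWithin_le_nhds)
    (eventually_mem_nhdsWithin (s := {u : C^∞⟮𝓡 n, M; 𝓘(ℝ, W), W⟯ | ∀ x, u x ∈ Ω})) hu

instance : ContinuousAdd C^∞⟮𝓡 n, M; 𝓘(ℝ, W), W⟯ where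
  continuous_add := by
    -- Addition is the superposition operator of the addition of W, applied to pairs.
    have hφ : ContDiffOn ℝ ∞ (fun q : W × W => q.1 + q.2) univ :=
      contDiffOn_fst.add contDiffOn_snd
    have h := (continuousOn_superpose (n := n) (M := M) isOpen_univ hφ)
    simp only [mem_univ, implies_true, ofPred_true, continuousOn_univ] at h
    refine (h.comp continuous_smoothPair).congr fun p => ?_
    ext x
    exact superpose_apply isOpen_univ hφ (fun _ => mem_univ _) x

/-- The constant function. -/
def smoothConst (c : W) : C^∞⟮𝓡 n, M; 𝓘(ℝ, W), W⟯ := ⟨fun _ => c, contMDiff_const⟩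

/-- The derivatives of constants vanish, so only values have to converge. Through this embedding,
multiplication by scalars becomes a superposition operator. -/
theorem continuous_smoothConst : Continuous (smoothConst (n := n) (M := M) (W := W)) :=
  continuous_iff_continuousAt.2 fun c => by
    rw [ContinuousAt, tendsto_smooth_iff]
    intro x₀ k
    induction k with
    | zero => exact smoothTendsto_zero_iff.2 fun y _ => tendsto_fst
    | succ k ih =>
      refine smoothTendsto_succ_iff.2 ⟨fun y _ => tendsto_fst, fun j _ y _ => ?_⟩
      have e : ∀ c : W, fderiv ℝ (fun _ : EuclideanSpace ℝ (Fin n) => c) = fun _ => 0 :=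
        fun c => by
          ext1 y
          exact fderiv_const_apply c
      change Tendsto (fun p : W × EuclideanSpace ℝ (Fin n) => iteratedFDeriv ℝ j
        (fderiv ℝ (fun _ : EuclideanSpace ℝ (Fin n) => p.1)) p.2) _
        (𝓝 (iteratedFDeriv ℝ j (fderiv ℝ (fun _ : EuclideanSpace ℝ (Fin n) => c)) y))
      simp only [e, iteratedFDeriv_fun_zero]
      exact tendsto_const_nhds

instance : ContinuousSMul ℝ C^∞⟮𝓡 n, M; 𝓘(ℝ, W), W⟯ where
  continuous_smul := by
    have hφ : ContDiffOn ℝ ∞ (fun q : ℝ × W => q.1 • q.2) univ :=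
      contDiffOn_fst.smul contDiffOn_snd
    have h := (continuousOn_superpose (n := n) (M := M) isOpen_univ hφ)
    simp only [mem_univ, implies_true, ofPred_true, continuousOn_univ] at h
    refine (h.comp (continuous_smoothPair.comp ((continuous_smoothConst.comp continuous_fst).prodMk
      continuous_snd))).congr fun p => ?_
    ext x
    exact superpose_apply isOpen_univ hφ (fun _ => mem_univ _) x

variable [CompactSpace M]

/-- Joint continuity of evaluation and compactness of M. On a compact manifold the domains of
superposition operators are therefore open. -/
theorem isOpen_setOf_forall_mem {Ω : Set W} (hΩ : IsOpen Ω) :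
    IsOpen {u : C^∞⟮𝓡 n, M; 𝓘(ℝ, W), W⟯ | ∀ x, u x ∈ Ω} :=
  isOpen_iff_mem_nhds.2 fun u hu => by
    have h := (isCompact_univ (X := M)).eventually_forall_of_forall_eventually (x₀ := u)
      (P := fun w x => w x ∈ Ω) fun x _ =>
        continuous_smooth_eval.continuousAt.eventually (hΩ.mem_nhds (hu x))
    exact h.mono fun w hw x => hw x (mem_univ x)

theorem hasDirDeriv_superpose {φ : W → W'} {Ω : Set W} (hΩ : IsOpen Ω)
    (hφ : ContDiffOn ℝ ∞ φ Ω) {φ' : W × W → W'} (hφ' : ContDiffOn ℝ ∞ φ' (Ω ×ˢ univ))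
    (e : ∀ a ∈ Ω, ∀ b, φ' (a, b) = fderiv ℝ φ a b)
    {u : C^∞⟮𝓡 n, M; 𝓘(ℝ, W), W⟯} (hu : ∀ x, u x ∈ Ω) (w : C^∞⟮𝓡 n, M; 𝓘(ℝ, W), W⟯) :
    HasDirDeriv (superpose hΩ hφ) u w (superpose (hΩ.prod isOpen_univ) hφ' (smoothPair u w)) := by
  have ht : ∀ᶠ t : ℝ in 𝓝[≠] 0, ∀ x, (u + t • w) x ∈ Ω := by
    have hc : ContinuousAt (fun t : ℝ => u + t • w) 0 := by fun_prop
    refine (hc.eventually ((isOpen_setOf_forall_mem hΩ).mem_nhds ?_)).filter_mono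
      nhdsWithin_le_nhds
    simpa using hu
  rw [HasDirDeriv, tendsto_smooth_iff]
  intro x₀ k
  refine (smoothTendsto_slope_comp (isOpen_target x₀) hΩ hφ (contDiffOn_comp_symm u.contMDiff x₀)
    (contDiffOn_comp_symm w.contMDiff x₀) (fun y _ => hu _) (ht.mono fun t ht y _ => ht _)).congr
    (isOpen_target x₀) ?_ fun y _ => ?_
  · refine ht.mono fun t ht y _ => ?_
    change _ = t⁻¹ • (superpose hΩ hφ (u + t • w) _ - superpose hΩ hφ u _)
    rw [superpose_apply hΩ hφ ht, superpose_apply hΩ hφ hu]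
    rfl
  · rw [superpose_apply (hΩ.prod isOpen_univ) hφ' fun x => ⟨hu x, mem_univ _⟩]
    exact (e _ (hu _) _).symm

/-- The derivative of u ↦ φ ∘ u is the superposition operator of (a, b) ↦ Dφ(a)b on pairs, so the
class of these operators is closed under differentiation. Precomposition with L, which is affine
with linear part L', allows fixed parameter functions and keeps the statement stable when F is
replaced by F × F. -/
theorem isCk_superpose {k : ℕ} : ∀ {W W' : Type} [NormedAddCommGroup W] [NormedSpace ℝ W]
    [NormedAddCommGroup W'] [NormedSpace ℝ W'] {φ : W → W'} {Ω : Set W} (hΩ : IsOpen Ω)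
    (hφ : ContDiffOn ℝ ∞ φ Ω) {F : Type u} [AddCommGroup F] [Module ℝ F] [TopologicalSpace F]
    {L L' : F → C^∞⟮𝓡 n, M; 𝓘(ℝ, W), W⟯}, Continuous L → Continuous L' →
    (∀ x v (t : ℝ), L (x + t • v) = L x + t • L' v) →
    (∀ x v (t : ℝ), L' (x + t • v) = L' x + t • L' v) →
    IsCk k F {p | ∀ x, L p x ∈ Ω} (fun p => superpose hΩ hφ (L p)) := by
  induction k with
  | zero =>
    intro W W' _ _ _ _ φ Ω hΩ hφ F _ _ _ L L' hL _ _ _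
    exact (continuousOn_superpose hΩ hφ).comp hL.continuousOn fun p hp => hp
  | succ k ih =>
    intro W W' _ _ _ _ φ Ω hΩ hφ F _ _ _ L L' hL hL' hLL' hLL''
    have hφ' : ContDiffOn ℝ ∞ (fun q : W × W => fderiv ℝ φ q.1 q.2) (Ω ×ˢ univ) :=
      (((hφ.fderiv_of_isOpen (m := ∞) hΩ (by simp)).comp contDiffOn_fst
        fun _ hq => hq.1)).clm_apply contDiffOn_snd
    refine ⟨(continuousOn_superpose hΩ hφ).comp hL.continuousOn fun p hp => hp,
      fun q => superpose (hΩ.prod isOpen_univ) hφ' (smoothPair (L q.1) (L' q.2)),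
      fun p hp v => ?_, ?_⟩
    · have h := hasDirDeriv_superpose hΩ hφ hφ' (fun _ _ _ => rfl) hp (L' v)
      rw [HasDirDeriv] at h ⊢
      simpa only [hLL'] using h
    · have h := ih (hΩ.prod isOpen_univ) hφ' (F := F × F)
        (L := fun q => smoothPair (L q.1) (L' q.2)) (L' := fun q => smoothPair (L' q.1) (L' q.2))
        (continuous_smoothPair.comp ((hL.comp continuous_fst).prodMk (hL'.comp continuous_snd)))
        (continuous_smoothPair.comp ((hL'.comp continuous_fst).prodMk (hL'.comp continuous_snd)))
        (fun x v t => by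
          ext1 y
          exact Prod.ext (congrArg (fun w => w y) (hLL' x.1 v.1 t))
            (congrArg (fun w => w y) (hLL'' x.2 v.2 t)))
        (fun x v t => by
          ext1 y
          exact Prod.ext (congrArg (fun w => w y) (hLL'' x.1 v.1 t))
            (congrArg (fun w => w y) (hLL'' x.2 v.2 t)))
      -- The condition that the pair takes values in Ω × W restricts only the first function, so the
      -- two domains agree.
      convert h using 1
      ext q
      exact ⟨fun hq x => ⟨hq.1 x, mem_univ _⟩, fun hq => ⟨fun x => (hq x).1, mem_univ _⟩⟩

theorem IsCk.prodMk {k : ℕ} : ∀ {F G H : Type u} [AddCommGroup F] [Module ℝ F]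
    [TopologicalSpace F] [AddCommGroup G] [Module ℝ G] [TopologicalSpace G] [AddCommGroup H]
    [Module ℝ H] [TopologicalSpace H] {U : Set F} {a : F → G} {b : F → H},
    IsCk k F U a → IsCk k F U b → IsCk k F U (fun p => (a p, b p)) := by
  induction k with
  | zero => exact fun ha hb => ContinuousOn.prodMk ha hb
  | succ k ih =>
    rintro F G H _ _ _ _ _ _ _ _ _ U a b ⟨ha, da, hda, ha'⟩ ⟨hb, db, hdb, hb'⟩
    exact ⟨ha.prodMk hb, fun q => (da q, db q),
      fun x hx v => (hda x hx v).prodMk_nhds (hdb x hx v), ih ha' hb'⟩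

end FrechetSpaces

/-! ### Uniqueness and smoothness of phases. -/

section PhaseLifting

theorem contDiffAt_arg {z : ℂ} (hz : z ∈ Complex.slitPlane) : ContDiffAt ℝ ∞ Complex.arg z := by
  have h := Complex.imCLM.contDiff.contDiffAt.comp z
    ((Complex.contDiffAt_log hz (n := ∞)).restrict_scalars ℝ)
  refine h.congr_of_eventuallyEq (Eventually.of_forall fun w => ?_)
  exact (Complex.log_im w).symm

theorem arg_exp_mul_I_of_mem {t : ℝ} (ht : t ∈ Ioc (-Real.pi) Real.pi) :
    (Complex.exp (t * Complex.I)).arg = t := by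
  rw [Complex.exp_mul_I, Complex.arg_cos_add_sin_mul_I ht]

/-- The period is 4π rather than 2π because of the half angle. -/
theorem exists_int_of_exp_eq {a b : ℝ}
    (h : Complex.exp ((a / 2 : ℝ) * Complex.I) = Complex.exp ((b / 2 : ℝ) * Complex.I)) :
    ∃ k : ℤ, a = b + 4 * Real.pi * k := by
  obtain ⟨k, hk⟩ := Complex.exp_eq_exp_iff_exists_int.1 h
  refine ⟨k, ?_⟩
  have h1 := congrArg Complex.im hk
  simp only [Complex.mul_im, Complex.ofReal_re, Complex.ofReal_im, Complex.I_re, Complex.I_im,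
    Complex.add_im, Complex.intCast_re, Complex.intCast_im, Complex.mul_re, Complex.re_ofNat,
    Complex.im_ofNat] at h1
  linarith

/-- A continuous function on a connected space with values in `c ℤ` is constant. -/
theorem eq_of_forall_exists_int {X : Type*} [TopologicalSpace X] {S : Set X}
    (hS : IsPreconnected S) {h : X → ℝ} (hc : ContinuousOn h S) {c : ℝ}
    (hk : ∀ x ∈ S, ∃ k : ℤ, h x = c * k) {x y : X} (hx : x ∈ S) (hy : y ∈ S) : h x = h y := by
  refine hS.constant_of_mapsTo (T := (AddSubgroup.zmultiples c : Set ℝ)) ?_ hc (fun z hz => ?_)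
    hx hy
  · exact ⟨inferInstanceAs (DiscreteTopology (AddSubgroup.zmultiples c))⟩
  · obtain ⟨k, hk⟩ := hk z hz
    exact ⟨k, by simp [hk, mul_comm]⟩

/-- The difference of the two phases is continuous with values in the discrete set 4πℤ, hence
constant on a connected space. -/
theorem eq_of_exp_eq {X : Type*} [TopologicalSpace X] [PreconnectedSpace X] {a b : X → ℝ}
    (ha : Continuous a) (hb : Continuous b)
    (h : ∀ x, Complex.exp ((a x / 2 : ℝ) * Complex.I) = Complex.exp ((b x / 2 : ℝ) * Complex.I))
    (x y : X) : a x - b x = a y - b y := by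
  refine eq_of_forall_exists_int isPreconnected_univ (h := fun z => a z - b z) (c := 4 * Real.pi)
    (ha.sub hb).continuousOn (fun z _ => ?_) (mem_univ x) (mem_univ y)
  obtain ⟨k, hk⟩ := exists_int_of_exp_eq (h z)
  exact ⟨k, by rw [hk]; ring⟩

/-- Near x one has θ = θ(x) + 2 arg(e^{iθ/2} e^{-iθ(x)/2}), where the argument is taken near 1 and
so is smooth. Continuity of θ selects the right branch. -/
theorem contMDiffAt_of_exp {E H X : Type*} [NormedAddCommGroup E] [NormedSpace ℝ E]
    [TopologicalSpace H] {I : ModelWithCorners ℝ E H} [TopologicalSpace X] [ChartedSpace H X]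
    {θ : X → ℝ} {x : X} (hc : ContinuousAt θ x)
    (hs : ContMDiffAt I 𝓘(ℝ, ℂ) ∞ (fun z => Complex.exp ((θ z / 2 : ℝ) * Complex.I)) x) :
    ContMDiffAt I 𝓘(ℝ, ℝ) ∞ θ x := by
  have h1 : ContDiffAt ℝ ∞ (fun w : ℂ =>
      θ x + 2 * (w * Complex.exp (-(θ x / 2 : ℝ) * Complex.I)).arg)
      (Complex.exp ((θ x / 2 : ℝ) * Complex.I)) := by
    refine contDiffAt_const.add (contDiffAt_const.mul (ContDiffAt.comp _ (contDiffAt_arg ?_)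
      (contDiffAt_id.mul contDiffAt_const)))
    rw [← Complex.exp_add]
    simp
  refine ((h1.contMDiffAt).comp x hs).congr_of_eventuallyEq ?_
  -- The bound 2π places half the difference in (−π, π), where the argument returns it unchanged.
  have h2 : ∀ᶠ z in 𝓝 x, |θ z - θ x| < 2 * Real.pi := by
    have := hc.eventually (Metric.ball_mem_nhds (θ x) Real.two_pi_pos)
    simpa [Real.dist_eq] using this
  filter_upwards [h2] with z hz
  have h3 : Complex.exp ((θ z / 2 : ℝ) * Complex.I) * Complex.exp (-(θ x / 2 : ℝ) * Complex.I) =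
      Complex.exp (((θ z - θ x) / 2 : ℝ) * Complex.I) := by
    rw [← Complex.exp_add]
    congr 1
    push_cast
    ring
  rw [abs_lt] at hz
  simp only [Function.comp_apply, h3]
  rw [arg_exp_mul_I_of_mem ⟨by linarith, by linarith⟩]
  ring

theorem ofReal_norm_mul_exp_arg (z : ℂ) : (‖z‖ : ℂ) * Complex.exp (z.arg * Complex.I) = z :=
  Complex.norm_mul_exp_arg_mul_I z

end PhaseLifting

/-! ### The polar map and its local inverse on function spaces. -/

section MadelungTransform

variable {n : ℕ} {M : Type u} [TopologicalSpace M] [ChartedSpace (EuclideanSpace ℝ (Fin n)) M]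
  [IsManifold (𝓡 n) ∞ M]

/-- `(r, t) ↦ √r e^{it/2}`. -/
def polarMap (q : ℝ × ℝ) : ℂ := (√q.1 : ℂ) * Complex.exp ((q.2 / 2 : ℝ) * Complex.I)

/-- The pairs `(r, t)` with `r > 0`. -/
def polarDomain : Set (ℝ × ℝ) := {q | 0 < q.1}

theorem isOpen_polarDomain : IsOpen polarDomain := isOpen_lt continuous_const continuous_fst

theorem contDiffOn_polarMap : ContDiffOn ℝ ∞ polarMap polarDomain := by
  intro q hq
  have h1 : ContDiffAt ℝ ∞ (fun q : ℝ × ℝ => √q.1) q := contDiffAt_fst.sqrt (ne_of_gt hq)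
  have h2 : ContDiffAt ℝ ∞ (fun q : ℝ × ℝ => (√q.1 : ℂ)) q :=
    Complex.ofRealCLM.contDiff.contDiffAt.comp _ h1
  have h3 : ContDiffAt ℝ ∞ (fun q : ℝ × ℝ => ((q.2 / 2 : ℝ) : ℂ)) q :=
    Complex.ofRealCLM.contDiff.contDiffAt.comp _ (contDiffAt_snd.div_const 2)
  exact (h2.mul (h3.mul contDiffAt_const).cexp).contDiffWithinAt

/-- The logarithmic derivative of √r e^{it/2}. Having the value of the map as a factor makes both
the symplectic form and the time derivative computable. -/
theorem fderiv_polarMap {q : ℝ × ℝ} (hq : 0 < q.1) (v : ℝ × ℝ) :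
    fderiv ℝ polarMap q v =
      polarMap q * ((v.1 / (2 * q.1) : ℝ) + (v.2 / 2 : ℝ) * Complex.I) := by
  have h1 : HasFDerivAt (fun q : ℝ × ℝ => √q.1)
      ((1 / (2 * √q.1)) • ContinuousLinearMap.fst ℝ ℝ ℝ) q :=
    (Real.hasDerivAt_sqrt hq.ne').comp_hasFDerivAt q hasFDerivAt_fst
  have h2 := Complex.ofRealCLM.hasFDerivAt.comp q h1
  have h3 := (Complex.ofRealCLM.hasFDerivAt.comp q
    ((hasFDerivAt_snd (𝕜 := ℝ) (p := q)).mul_const (2⁻¹ : ℝ))).mul_const Complex.I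
  have h4 := h2.mul h3.cexp
  have h5 : polarMap = fun q : ℝ × ℝ => (√q.1 : ℂ) * Complex.exp ((q.2 * 2⁻¹ : ℝ) * Complex.I) := by
    funext q
    rw [polarMap, div_eq_mul_inv]
  have h6 := h4.fderiv
  rw [h5]
  refine (congrArg (fun A : ℝ × ℝ →L[ℝ] ℂ => A v) h6).trans ?_
  have hs := Real.sq_sqrt hq.le
  have hs0 : √q.1 ≠ 0 := (Real.sqrt_pos.2 hq).ne'
  have hs1 : ((√q.1 : ℝ) : ℂ) ≠ 0 := by exact_mod_cast hs0
  have hs2 : (q.1 : ℂ) = (√q.1 : ℂ) ^ 2 := by exact_mod_cast hs.symm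
  simp
  rw [hs2]
  field_simp
  ring

/-- The lift `(ρ, θ) ↦ √ρ e^{iθ/2}` of the Madelung transform. -/
def madelungLift (p : CR n M × CR n M) : CC n M :=
  superpose isOpen_polarDomain contDiffOn_polarMap (smoothPair p.1 p.2)

/-- The domain of `madelungLift`. -/
def madelungDomain : Set (CR n M × CR n M) := {p | ∀ x, smoothPair p.1 p.2 x ∈ polarDomain}

theorem madelungLift_apply {p : CR n M × CR n M} (hp : ∀ x, 0 < p.1 x) (x : M) :
    madelungLift p x = madelungFun p.1 p.2 x :=
  superpose_apply isOpen_polarDomain contDiffOn_polarMap (u := smoothPair p.1 p.2) hp x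

/-- `(q, p, s) ↦ (|q|², s + 2 arg (q p))`: density and phase of `q`, relative to a reference. -/
def phaseDomain : Set (ℂ × ℂ × ℝ) := {q | q.1 * q.2.1 ∈ Complex.slitPlane}

theorem isOpen_phaseDomain : IsOpen phaseDomain :=
  Complex.isOpen_slitPlane.preimage (continuous_fst.mul (continuous_fst.comp continuous_snd))

theorem contDiffOn_normSq : ContDiffOn ℝ ∞ (fun q : ℂ × ℂ × ℝ => ‖q.1‖ ^ 2) phaseDomain :=
  (contDiff_fst.norm_sq ℝ).contDiffOn

theorem contDiffOn_phase :
    ContDiffOn ℝ ∞ (fun q : ℂ × ℂ × ℝ => q.2.2 + 2 * (q.1 * q.2.1).arg) phaseDomain := by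
  intro q hq
  refine (ContDiffAt.add (by fun_prop) (contDiffAt_const.mul
    (ContDiffAt.comp (f := fun q : ℂ × ℂ × ℝ => q.1 * q.2.1) q (contDiffAt_arg hq)
      (contDiffAt_fst.mul (contDiffAt_fst.comp q contDiffAt_snd))))).contDiffWithinAt

/-- For q near ψ the quotient q/ψ takes values in the slit plane, so |q|² and θ + 2 arg(q/ψ) are
superposition operators of q with ψ⁻¹ and θ as parameters. The resulting local inverse gives both
openness of the transform and smoothness of its inverse, with no assumption on the topology of M
beyond compactness. -/
theorem exists_local_phase [CompactSpace M] (ψ : CC n M) (ρ θ : CR n M) (hρ : ∀ x, 0 < ρ x)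
    (hψ : ∀ x, ψ x = madelungFun ρ θ x) :
    ∃ (N : Set (CC n M)) (l : CC n M → CR n M × CR n M), IsOpen N ∧ ψ ∈ N ∧
      FrechetSmoothOn N l ∧ l ψ = (ρ, θ) ∧
      ∀ q ∈ N, (∀ x, 0 < (l q).1 x) ∧ ∀ x, madelungFun (l q).1 (l q).2 x = q x := by
  have hψ0 : ∀ x, ψ x ≠ 0 := fun x => by
    rw [hψ, madelungFun]
    exact mul_ne_zero (by exact_mod_cast (Real.sqrt_pos.2 (hρ x)).ne') (Complex.exp_ne_zero _)
  have hψi : ContMDiff (𝓡 n) 𝓘(ℝ, ℂ) ∞ (fun x => (ψ x)⁻¹) := fun x =>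
    ((contDiffAt_inv ℝ (hψ0 x)).contMDiffAt).comp x (ψ.contMDiff x)
  let ψi : CC n M := ⟨fun x => (ψ x)⁻¹, hψi⟩
  let L : CC n M → C^∞⟮𝓡 n, M; 𝓘(ℝ, ℂ × ℂ × ℝ), ℂ × ℂ × ℝ⟯ :=
    fun q => smoothPair q (smoothPair ψi θ)
  -- The linear part of L: the parameters do not vary, so their increments are zero.
  let L' : CC n M → C^∞⟮𝓡 n, M; 𝓘(ℝ, ℂ × ℂ × ℝ), ℂ × ℂ × ℝ⟯ := fun q => smoothPair q 0
  have hL : Continuous L := continuous_smoothPair.comp (continuous_id.prodMk continuous_const)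
  have hL' : Continuous L' := continuous_smoothPair.comp (continuous_id.prodMk continuous_const)
  have e1 : ∀ x v (t : ℝ), L (x + t • v) = L x + t • L' v := fun x v t => by
    ext1 y
    refine Prod.ext rfl ?_
    change (ψi y, θ y) = (ψi y, θ y) + t • (0 : ℂ × ℝ)
    simp
  have e2 : ∀ x v (t : ℝ), L' (x + t • v) = L' x + t • L' v := fun x v t => by
    ext1 y
    refine Prod.ext rfl ?_
    change (0 : ℂ × ℝ) = 0 + t • (0 : ℂ × ℝ)
    simp
  have hval : ∀ q ∈ {q : CC n M | ∀ x, L q x ∈ phaseDomain},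
      ∀ x, superpose isOpen_phaseDomain contDiffOn_normSq (L q) x = ‖q x‖ ^ 2 ∧
      superpose isOpen_phaseDomain contDiffOn_phase (L q) x =
        θ x + 2 * (q x * (ψ x)⁻¹).arg := fun q hq x =>
    ⟨superpose_apply _ _ hq x, superpose_apply _ _ hq x⟩
  have hmem : ψ ∈ {q : CC n M | ∀ x, L q x ∈ phaseDomain} := fun x => by
    change ψ x * (ψ x)⁻¹ ∈ Complex.slitPlane
    rw [mul_inv_cancel₀ (hψ0 x)]
    exact Complex.one_mem_slitPlane
  refine ⟨{q | ∀ x, L q x ∈ phaseDomain},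
    fun q => (superpose isOpen_phaseDomain contDiffOn_normSq (L q),
      superpose isOpen_phaseDomain contDiffOn_phase (L q)),
    (isOpen_setOf_forall_mem isOpen_phaseDomain).preimage hL, hmem, fun k =>
      (isCk_superpose isOpen_phaseDomain contDiffOn_normSq hL hL' e1 e2).prodMk
        (isCk_superpose isOpen_phaseDomain contDiffOn_phase hL hL' e1 e2), ?_, fun q hq => ?_⟩
  · refine Prod.ext ?_ ?_
    · ext x
      refine (hval ψ hmem x).1.trans ?_
      rw [hψ, norm_sq_madelungFun _ _ _ (hρ x).le]
    · ext x
      refine (hval ψ hmem x).2.trans ?_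
      simp [mul_inv_cancel₀ (hψ0 x)]
  · have hq0 : ∀ x, q x ≠ 0 := fun x h => by
      have h1 : q x * (ψ x)⁻¹ ∈ Complex.slitPlane := hq x
      rw [h, zero_mul] at h1
      exact Complex.slitPlane_ne_zero h1 rfl
    refine ⟨fun x => ?_, fun x => ?_⟩
    · rw [(hval q hq x).1]
      exact pow_pos (norm_pos_iff.2 (hq0 x)) 2
    · simp only [madelungFun]
      rw [(hval q hq x).1, (hval q hq x).2, Real.sqrt_sq (norm_nonneg _)]
      have h1 : (((θ x + 2 * (q x * (ψ x)⁻¹).arg) / 2 : ℝ) : ℂ) * Complex.I =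
          (θ x / 2 : ℝ) * Complex.I + (q x * (ψ x)⁻¹).arg * Complex.I := by
        push_cast
        ring
      have h2 : Complex.exp ((θ x / 2 : ℝ) * Complex.I) = ψ x / ‖ψ x‖ := by
        have h3 : ‖ψ x‖ = √(ρ x) := by
          rw [← Real.sqrt_sq (norm_nonneg (ψ x)), hψ, norm_sq_madelungFun _ _ _ (hρ x).le]
        have h4 : ((√(ρ x) : ℝ) : ℂ) ≠ 0 := by exact_mod_cast (Real.sqrt_pos.2 (hρ x)).ne'
        rw [h3, hψ, madelungFun, mul_div_cancel_left₀ _ h4]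
      have h5 := ofReal_norm_mul_exp_arg (q x * (ψ x)⁻¹)
      have h6 : (‖ψ x‖ : ℂ) ≠ 0 := by exact_mod_cast (norm_pos_iff.2 (hψ0 x)).ne'
      rw [norm_mul, norm_inv] at h5
      push_cast at h5
      rw [h1, Complex.exp_add, h2]
      calc (‖q x‖ : ℂ) * (ψ x / ‖ψ x‖ * Complex.exp ((q x * (ψ x)⁻¹).arg * Complex.I)) =
          ψ x * (‖q x‖ * (‖ψ x‖ : ℂ)⁻¹ * Complex.exp ((q x * (ψ x)⁻¹).arg * Complex.I)) := by ring
        _ = q x := by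
          rw [h5]
          field_simp [hψ0 x]

end MadelungTransform

/-! ### The Madelung transform as a symplectomorphism and its image. -/

section Symplectomorphism

variable {n : ℕ} {M : Type u} [TopologicalSpace M] [ChartedSpace (EuclideanSpace ℝ (Fin n)) M]
  [IsManifold (𝓡 n) ∞ M] [T2Space M] [CompactSpace M] [MeasurableSpace M]
  [BorelSpace M] (g : Metric n M)

theorem smoothPair_add_smul (p v : CR n M × CR n M) (t : ℝ) :
    smoothPair (p + t • v).1 (p + t • v).2 = smoothPair p.1 p.2 + t • smoothPair v.1 v.2 := rfl

theorem continuous_smoothPair_uncurry :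
    Continuous (fun p : CR n M × CR n M => smoothPair p.1 p.2) := continuous_smoothPair

theorem isOpen_madelungDomain : IsOpen (madelungDomain (n := n) (M := M)) :=
  (isOpen_setOf_forall_mem isOpen_polarDomain).preimage continuous_smoothPair_uncurry

theorem frechetSmoothOn_madelungLift :
    FrechetSmoothOn (madelungDomain (n := n) (M := M)) madelungLift := fun _ =>
  isCk_superpose isOpen_polarDomain contDiffOn_polarMap continuous_smoothPair_uncurry
    continuous_smoothPair_uncurry smoothPair_add_smul smoothPair_add_smul

theorem mem_madelungDomain {p : CR n M × CR n M} (hp : p ∈ cotPairs g) : p ∈ madelungDomain :=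
  fun x => hp.1 x

theorem madelungLift_eq (p : CR n M × CR n M) (hp : p ∈ cotPairs g) :
    madelungLift p = (madelungSphere g ⟨p, hp⟩).1 := by
  ext1 x
  exact madelungLift_apply hp.1 x

theorem madelung_cotMk (p : cotPairs g) :
    madelung g (cotMk g p) = projMk g (madelungSphere g p) := rfl

/-- The space of smooth functions is Hausdorff, so any directional derivative is the one computed by
`hasDirDeriv_superpose`. -/
theorem hasDirDeriv_madelungLift_apply {p X : CR n M × CR n M} (hp : ∀ x, 0 < p.1 x) {η : CC n M}
    (h : HasDirDeriv madelungLift p X η) (x : M) :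
    η x = madelungFun p.1 p.2 x * ((X.1 x / (2 * p.1 x) : ℝ) + (X.2 x / 2 : ℝ) * Complex.I) := by
  have hφ' : ContDiffOn ℝ ∞ (fun q : (ℝ × ℝ) × (ℝ × ℝ) => fderiv ℝ polarMap q.1 q.2)
      (polarDomain ×ˢ univ) :=
    (((contDiffOn_polarMap.fderiv_of_isOpen (m := ∞) isOpen_polarDomain (by simp)).comp
      contDiffOn_fst fun _ hq => hq.1)).clm_apply contDiffOn_snd
  have h1 := hasDirDeriv_superpose isOpen_polarDomain contDiffOn_polarMap hφ' (fun _ _ _ => rfl)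
    (u := smoothPair p.1 p.2) hp (smoothPair X.1 X.2)
  rw [tendsto_nhds_unique (h : Tendsto _ _ _) (h1 : Tendsto _ _ _), superpose_apply _ _ fun y => ?_]
  · exact fderiv_polarMap (hp x) _
  · exact ⟨hp y, mem_univ _⟩

/-- If η = ψ(a + ib) and ζ = ψ(c + id), then Im(conj η · ζ) = |ψ|²(ad − bc). Here |ψ|² = ρ, while a,
c are ρ̇/(2ρ) and b, d are θ̇/2, so the density ρ cancels and the factor ¼ remains. -/
theorem four_mul_waveForm_eq_cotForm {p X Y : CR n M × CR n M} (hp : ∀ x, 0 < p.1 x)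
    {η ζ : CC n M} (hη : HasDirDeriv madelungLift p X η) (hζ : HasDirDeriv madelungLift p Y ζ) :
    4 * waveForm g η ζ = cotForm g (X.1, X.2) (Y.1, Y.2) := by
  rw [waveForm_eq_integral g η.contMDiff.continuous ζ.contMDiff.continuous, ← integral_const_mul,
    cotForm]
  refine integral_congr_ae (Eventually.of_forall fun x => ?_)
  have hx := hp x
  have hs := norm_sq_madelungFun p.1 p.2 x hx.le
  rw [Complex.sq_norm, Complex.normSq_apply] at hs
  have key : ∀ (z : ℂ) (a b c d : ℝ), (z * (a + b * Complex.I)).re * (z * (c + d * Complex.I)).im -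
      (z * (a + b * Complex.I)).im * (z * (c + d * Complex.I)).re =
      (z.re * z.re + z.im * z.im) * (a * d - b * c) := fun z a b c d => by
    simp only [Complex.mul_re, Complex.mul_im, Complex.add_re, Complex.add_im, Complex.ofReal_re,
      Complex.ofReal_im, Complex.I_re, Complex.I_im]
    ring
  simp only [hasDirDeriv_madelungLift_apply hp hη x, hasDirDeriv_madelungLift_apply hp hζ x]
  rw [key, hs]
  have := hx.ne'
  field_simp
  ring

theorem madelungFun_ne_zero {ρ θ : M → ℝ} {x : M} (h : 0 < ρ x) : madelungFun ρ θ x ≠ 0 :=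
  mul_ne_zero (by exact_mod_cast (Real.sqrt_pos.2 h).ne') (Complex.exp_ne_zero _)

theorem exp_mul_madelungFun (ρ θ : M → ℝ) (α : ℝ) (x : M) :
    Complex.exp (α * Complex.I) * madelungFun ρ θ x =
      madelungFun ρ (fun x => θ x + 2 * α) x := by
  simp only [madelungFun]
  rw [mul_left_comm, ← Complex.exp_add]
  congr 2
  push_cast
  ring

theorem eq_of_madelungFun_eq {ρ ρ' θ θ' : M → ℝ} {x : M} (h : 0 < ρ x) (h' : 0 < ρ' x)
    (e : madelungFun ρ θ x = madelungFun ρ' θ' x) : ρ x = ρ' x ∧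
      Complex.exp ((θ x / 2 : ℝ) * Complex.I) = Complex.exp ((θ' x / 2 : ℝ) * Complex.I) := by
  have h1 : ρ x = ρ' x := by
    rw [← norm_sq_madelungFun ρ θ x h.le, e, norm_sq_madelungFun ρ' θ' x h'.le]
  refine ⟨h1, ?_⟩
  have h2 : ((√(ρ' x) : ℝ) : ℂ) ≠ 0 := by exact_mod_cast (Real.sqrt_pos.2 h').ne'
  rw [madelungFun, madelungFun, h1] at e
  exact mul_left_cancel₀ h2 e

theorem cotMk_eq_cotMk {p q : cotPairs g} (h1 : ∀ x, p.1.1 x = q.1.1 x) {c : ℝ}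
    (h2 : ∀ x, p.1.2 x = q.1.2 x + c) : cotMk g p = cotMk g q := by
  refine Prod.ext (Subtype.ext (ContMDiffMap.ext h1)) ?_
  refine (Submodule.Quotient.eq _).2 (Submodule.mem_span_singleton.2 ⟨c, ?_⟩)
  ext x
  change c * 1 = p.1.2 x - q.1.2 x
  rw [h2]
  ring

theorem exists_of_cotMk_eq {p q : cotPairs g} (h : cotMk g p = cotMk g q) :
    p.1.1 = q.1.1 ∧ ∃ c : ℝ, ∀ x, p.1.2 x = q.1.2 x + c := by
  refine ⟨congrArg (fun c : CotDens g => c.1.1) h, ?_⟩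
  obtain ⟨c, hc⟩ := Submodule.mem_span_singleton.1
    ((Submodule.Quotient.eq (constants n M)).1 (congrArg (fun c : CotDens g => c.2) h))
  refine ⟨c, fun x => ?_⟩
  have h3 : c * 1 = p.1.2 x - q.1.2 x := congrArg (fun u : CR n M => u x) hc
  linarith

theorem cotMk_surjective : Function.Surjective (cotMk g) := by
  rintro ⟨⟨ρ, hρ⟩, θ⟩
  obtain ⟨θ, rfl⟩ := Submodule.Quotient.mk_surjective _ θ
  exact ⟨⟨(ρ, θ), hρ⟩, rfl⟩

theorem projMk_eq_iff {ψ φ : waveSphere g} : projMk g ψ = projMk g φ ↔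
    ∃ α : ℝ, ∀ x, φ.1 x = Complex.exp (α * Complex.I) * ψ.1 x := Quotient.eq

/-- Representatives of points of the range of the Madelung transform. -/
theorem exists_representative {ψ : waveSphere g} {c : CotDens g} (h : madelung g c = projMk g ψ) :
    ∃ p : cotPairs g, cotMk g p = c ∧ ∀ x, ψ.1 x = madelungFun p.1.1 p.1.2 x := by
  obtain ⟨p, rfl⟩ := cotMk_surjective g c
  obtain ⟨α, hα⟩ := (projMk_eq_iff g).1 h
  -- A constant phase α of the wave function is absorbed by adding 2α to θ, which does not change
  -- its class.
  refine ⟨⟨(p.1.1, p.1.2 + smoothConst (2 * α)), p.2⟩,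
    cotMk_eq_cotMk g (fun _ => rfl) (c := 2 * α) fun _ => rfl, fun x => ?_⟩
  rw [hα]
  exact exp_mul_madelungFun p.1.1 p.1.2 α x

theorem madelung_cotMk_eq {p : cotPairs g} {ψ : waveSphere g}
    (h : ∀ x, madelungFun p.1.1 p.1.2 x = ψ.1 x) : madelung g (cotMk g p) = projMk g ψ := by
  rw [madelung_cotMk]
  exact congrArg _ (Subtype.ext (ContMDiffMap.ext h))

theorem madelung_injective [PreconnectedSpace M] : Function.Injective (madelung g) := by
  intro c c' h
  obtain ⟨p', rfl⟩ := cotMk_surjective g c'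
  rw [madelung_cotMk] at h
  obtain ⟨p, rfl, hp⟩ := exists_representative g h
  have h1 := fun x => eq_of_madelungFun_eq (p'.2.1 x) (p.2.1 x) (hp x)
  -- A preconnected space may be empty; otherwise a base point measures the constant by which the
  -- phases differ.
  rcases isEmpty_or_nonempty M with hM | ⟨⟨x₀⟩⟩
  · exact cotMk_eq_cotMk g (fun x => hM.elim x) (c := 0) fun x => hM.elim x
  · refine cotMk_eq_cotMk g (fun x => (h1 x).1.symm) (c := p.1.2 x₀ - p'.1.2 x₀) fun x => ?_
    have := eq_of_exp_eq p.1.2.contMDiff.continuous p'.1.2.contMDiff.continuous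
      (fun x => (h1 x).2.symm) x x₀
    linarith

theorem mem_cotPairs_of_madelungFun_eq {p : CR n M × CR n M} (hp : ∀ x, 0 < p.1 x)
    {ψ : CC n M} (hψ : ψ ∈ waveSphere g) (h : ∀ x, madelungFun p.1 p.2 x = ψ x) :
    p ∈ cotPairs g := by
  refine ⟨hp, ?_⟩
  have h1 : ∫ x, ‖ψ x‖ ^ 2 ∂(vol g) = 1 := hψ
  rw [← h1]
  refine integral_congr_ae (Eventually.of_forall fun x => ?_)
  change p.1 x = ‖ψ x‖ ^ 2
  rw [← h, norm_sq_madelungFun _ _ _ (hp x).le]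

theorem continuous_cotMk : Continuous (cotMk g) := by
  refine Continuous.prodMk (Continuous.subtype_mk (continuous_fst.comp continuous_subtype_val) _) ?_
  exact (continuous_quot_mk (r := _)).comp (continuous_snd.comp continuous_subtype_val)

theorem isOpenMap_cotMk : IsOpenMap (cotMk g) := by
  have h1 : IsOpenMap (Submodule.Quotient.mk : CR n M → CR n M ⧸ constants n M) :=
    Submodule.isOpenMap_mkQ (constants n M)
  let e : cotPairs g ≃ₜ Dens g × CR n M :=
    { toFun := fun p => (⟨p.1.1, p.2⟩, p.1.2)
      invFun := fun q => ⟨(q.1.1, q.2), q.1.2⟩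
      left_inv := fun _ => rfl
      right_inv := fun _ => rfl
      continuous_toFun := by fun_prop
      continuous_invFun := by fun_prop }
  exact (IsOpenMap.id.prodMap h1).comp e.isOpenMap

theorem continuous_madelungSphere : Continuous (madelungSphere g) := by
  refine Continuous.subtype_mk (f := fun p : cotPairs g => (madelungSphere g p).1) ?_ _
  have h := (frechetSmoothOn_madelungLift (n := n) (M := M) 0 : ContinuousOn _ _)
  have h2 := h.comp_continuous (f := fun p : cotPairs g => p.1) continuous_subtype_val
    fun p => mem_madelungDomain g p.2
  exact h2.congr fun p => madelungLift_eq g p.1 p.2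

/-- The projection from pairs is an open continuous surjection, hence a quotient map, so continuity
can be checked on the lift. -/
theorem continuous_madelung : Continuous (madelung g) := by
  have h : IsQuotientMap (cotMk g) :=
    (isOpenMap_cotMk g).isQuotientMap (continuous_cotMk g) (cotMk_surjective g)
  rw [h.continuous_iff]
  exact (continuous_quotient_mk').comp (continuous_madelungSphere g)

/-- Let ψ represent a point of the image of U. The local phase assigns to every unit function near ψ
a pair that represents a point of U and is mapped to that function, so the preimage of the image in
the sphere is open. -/
theorem isOpenMap_madelung : IsOpenMap (madelung g) := by
  intro U hU
  refine (isQuotientMap_quotient_mk' (s := phaseSetoid g)).isOpen_preimage.1 ?_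
  refine isOpen_iff_mem_nhds.2 fun ψ hψ => ?_
  obtain ⟨c, hc, hcψ⟩ := hψ
  obtain ⟨p, rfl, hp⟩ := exists_representative g hcψ
  obtain ⟨N, l, hN, hψN, hl, hlψ, hlq⟩ := exists_local_phase ψ.1 p.1.1 p.1.2 p.2.1 hp
  have hlc : ContinuousAt l ψ.1 := (hl 0 : ContinuousOn l N).continuousAt (hN.mem_nhds hψN)
  obtain ⟨V, hV, hVU⟩ := isOpen_induced_iff.1 (hU.preimage (continuous_cotMk g))
  have hpV : l ψ.1 ∈ V := by
    rw [hlψ]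
    have : p ∈ Subtype.val ⁻¹' V := by rw [hVU]; exact hc
    exact this
  have h1 : ∀ᶠ q in 𝓝 ψ, q.1 ∈ N ∧ l q.1 ∈ V :=
    continuous_subtype_val.continuousAt.eventually
      ((eventually_mem_set.2 (hN.mem_nhds hψN)).and (hlc.eventually (hV.mem_nhds hpV)))
  refine h1.mono fun q hq => ?_
  have hm := mem_cotPairs_of_madelungFun_eq g (hlq q.1 hq.1).1 q.2 (hlq q.1 hq.1).2
  refine ⟨cotMk g ⟨l q.1, hm⟩, ?_, madelung_cotMk_eq g (hlq q.1 hq.1).2⟩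
  have : (⟨l q.1, hm⟩ : cotPairs g) ∈ Subtype.val ⁻¹' V := hq.2
  rw [hVU] at this
  exact this

theorem exists_leftInverse_madelung [PreconnectedSpace M] :
    ∃ Ψ : ProjWave g → CotDens g, Function.LeftInverse Ψ (madelung g) := by
  classical
  rcases isEmpty_or_nonempty (CotDens g) with hE | hE
  -- An inverse defined on all of the projective space needs a value off the range. If there were no
  -- densities there would be no unit functions either: a unit function forces nonzero volume, and
  -- then the normalised constant is a density.
  · have : IsEmpty (ProjWave g) := by
      refine ⟨fun c => ?_⟩
      obtain ⟨ψ, rfl⟩ := Quotient.exists_rep c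
      have h1 : ∫ x, ‖ψ.1 x‖ ^ 2 ∂(vol g) = 1 := ψ.2
      have h2 : vol g ≠ 0 := fun h => by
        rw [h, integral_zero_measure] at h1
        exact zero_ne_one h1
      have h3 : 0 < (vol g).real univ := by
        rw [measureReal_def]
        exact ENNReal.toReal_pos (by simpa using h2) (measure_ne_top _ _)
      refine hE.elim (⟨smoothConst ((vol g).real univ)⁻¹, fun x => inv_pos.2 h3, ?_⟩, 0)
      change ∫ _, ((vol g).real univ)⁻¹ ∂(vol g) = 1
      rw [integral_const, smul_eq_mul, mul_inv_cancel₀ h3.ne']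
    exact ⟨fun c => isEmptyElim c, fun c => hE.elim c⟩
  · exact ⟨Function.invFun (madelung g), Function.leftInverse_invFun (madelung_injective g)⟩

/-- One lift works at all points for the transform itself; for the inverse, the lift is the local
phase near the given ψ. -/
theorem isSymplectomorphismOnto_madelung [PreconnectedSpace M] :
    IsSymplectomorphismOnto g (madelung g) (range (madelung g)) := by
  refine ⟨.of_continuous_injective_isOpenMap (continuous_madelung g) (madelung_injective g)
    (isOpenMap_madelung g), rfl, fun p hp => ⟨madelungDomain, madelungLift, mem_madelungDomain g hp,
      ⟨isOpen_madelungDomain, frechetSmoothOn_madelungLift, fun q hq _ => ?_⟩,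
      fun X Y _ _ η ζ hη hζ => four_mul_waveForm_eq_cotForm g hp.1 hη hζ⟩, ?_⟩
  · have h := madelungLift_eq g q hq
    exact ⟨h ▸ (madelungSphere g ⟨q, hq⟩).2, congrArg (projMk g) (Subtype.ext h)⟩
  · obtain ⟨Ψ, hΨ⟩ := exists_leftInverse_madelung g
    refine ⟨Ψ, hΨ, fun ψ hψ ⟨c, hc⟩ => ?_⟩
    obtain ⟨p, rfl, hp⟩ := exists_representative g hc
    obtain ⟨N, l, hN, hψN, hl, -, hlq⟩ := exists_local_phase ψ p.1.1 p.1.2 p.2.1 hp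
    refine ⟨N, l, hψN, hN, hl, fun q hq hqN => ?_⟩
    have hm := mem_cotPairs_of_madelungFun_eq g (hlq q hqN).1 hq (hlq q hqN).2
    refine ⟨hm, ?_⟩
    rw [← madelung_cotMk_eq g (p := ⟨l q, hm⟩) (ψ := ⟨q, hq⟩) (hlq q hqN).2, hΨ]

theorem range_madelung_subset : range (madelung g) ⊆ nonvanishing g := by
  rintro _ ⟨c, rfl⟩
  obtain ⟨p, rfl⟩ := cotMk_surjective g c
  exact ⟨madelungSphere g p, fun x => madelungFun_ne_zero (p.2.1 x), rfl⟩

/-- A nowhere vanishing ψ on a simply connected manifold has a continuous logarithm L. Take θ = 2 Im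
L, which is smooth because e^{iθ/2} = ψ/|ψ| is. -/
theorem range_madelung_eq [SimplyConnectedSpace M] : range (madelung g) = nonvanishing g := by
  refine (range_madelung_subset g).antisymm ?_
  rintro _ ⟨ψ, hψ, rfl⟩
  -- Local path-connectedness is needed to lift ψ through the exponential covering.
  have := ChartedSpace.locallyPathConnectedSpace (EuclideanSpace ℝ (Fin n)) M
  have hs : IsSimplyConnected (univ : Set M) :=
    (Homeomorph.Set.univ M).toHomotopyEquiv.simplyConnectedSpace
  obtain ⟨L, hL, hLψ⟩ := Complex.exists_continuousOn_eqOn_exp_comp hs isOpen_univ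
    ψ.1.contMDiff.continuous.continuousOn (by rintro ⟨x, -, hx⟩; exact hψ x hx)
  rw [continuousOn_univ] at hL
  have hLψ' : ∀ x, Complex.exp (L x) = ψ.1 x := fun x => hLψ (mem_univ x)
  have hnorm : ∀ x, Complex.exp ((2 * (L x).im / 2 : ℝ) * Complex.I) =
      (‖ψ.1 x‖⁻¹ : ℝ) • ψ.1 x := fun x => by
    rw [← hLψ', Complex.norm_exp, mul_div_cancel_left₀ _ (two_ne_zero' ℝ), ← Real.exp_neg,
      Complex.real_smul, Complex.ofReal_exp, ← Complex.exp_add]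
    congr 1
    apply Complex.ext <;> simp
  have hθ : ContMDiff (𝓡 n) 𝓘(ℝ, ℝ) ∞ (fun x => 2 * (L x).im) := fun x => by
    refine contMDiffAt_of_exp (by fun_prop) ?_
    simp only [hnorm]
    have h2 : ContDiffAt ℝ ∞ (fun z : ℂ => (‖z‖⁻¹ : ℝ) • z) (ψ.1 x) :=
      ((contDiffAt_norm ℝ (hψ x)).inv (norm_ne_zero_iff.2 (hψ x))).smul contDiffAt_id
    exact h2.contMDiffAt.comp x (ψ.1.contMDiff x)
  have hρ : ContMDiff (𝓡 n) 𝓘(ℝ, ℝ) ∞ (fun x => ‖ψ.1 x‖ ^ 2) := fun x =>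
    (contDiff_id.norm_sq ℝ).contDiffAt.contMDiffAt.comp x (ψ.1.contMDiff x)
  let p : CR n M × CR n M := (⟨_, hρ⟩, ⟨_, hθ⟩)
  have hp0 : ∀ x, 0 < p.1 x := fun x => pow_pos (norm_pos_iff.2 (hψ x)) 2
  have hp : ∀ x, madelungFun p.1 p.2 x = ψ.1 x := fun x => by
    change (√(‖ψ.1 x‖ ^ 2) : ℂ) * Complex.exp ((2 * (L x).im / 2 : ℝ) * Complex.I) = _
    rw [hnorm, Real.sqrt_sq (norm_nonneg _), Complex.real_smul, ← mul_assoc, ← Complex.ofReal_mul,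
      mul_inv_cancel₀ (norm_ne_zero_iff.2 (hψ x)), Complex.ofReal_one, one_mul]
  exact ⟨cotMk g ⟨p, mem_cotPairs_of_madelungFun_eq g hp0 ψ.2 hp⟩, madelung_cotMk_eq g hp⟩

end Symplectomorphism

/-! ### Acceleration of a gradient field: ∇_X X = ½ ∇|X|². -/

section CovariantDerivative

/-- The coordinate computation behind `∇_X X = ½ ∇|X|²` for a gradient field `X`. -/
theorem christoffel_algebra {ι : Type*} [Fintype ι] [DecidableEq ι] {G : Matrix ι ι ℝ}
    (hG : IsUnit G.det) {dG : ι → ι → ι → ℝ} (hdG : ∀ l i j, dG l i j = dG l j i)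
    {X p : ι → ℝ} {dX H : ι → ι → ℝ} {dq : ι → ℝ} (hGs : ∀ i j, G i j = G j i)
    (hp : ∀ i, p i = ∑ j, G i j * X j) (hH : ∀ l i, H l i = H i l)
    (hd : ∀ l i, H l i = ∑ j, (dG l i j * X j + G i j * dX l j))
    (hq : ∀ l, dq l = ∑ i, (dX l i * p i + X i * H l i)) (k : ι) :
    (∑ j, X j * dX j k) + ∑ i, ∑ j, (1 / 2 * ∑ l, G⁻¹ k l * (dG i j l + dG j i l - dG l i j)) *
      X i * X j = 1 / 2 * ∑ m, G⁻¹ k m * dq m := by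
  -- Differentiate the relation p = G X between the gradient and the differential, and solve for the
  -- derivative of X.
  have h1 : ∀ j, dX j k = ∑ m, G⁻¹ k m * (H j m - ∑ i, dG j m i * X i) := fun j => by
    have e : G.mulVec (dX j) = fun m => H j m - ∑ i, dG j m i * X i := by
      funext m
      rw [hd, Finset.sum_add_distrib, add_sub_cancel_left]
      rfl
    have e2 := congrFun (congrArg (fun w => (G⁻¹).mulVec w) e) k
    simp only [Matrix.mulVec_mulVec] at e2
    rw [Matrix.nonsing_inv_mul _ hG, Matrix.one_mulVec] at e2
    exact e2
  -- Here q = Xⁱpᵢ is the squared length. Contracting `hd` with X expresses its derivative through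
  -- the Hessian H and the derivative of the metric.
  have h2 : ∀ m, dq m = 2 * ∑ i, X i * H m i - ∑ i, ∑ j, dG m i j * X i * X j := fun m => by
    have e : ∑ i, dX m i * p i = ∑ i, X i * H m i - ∑ i, ∑ j, dG m i j * X i * X j := by
      simp only [hp, hd m, Finset.mul_sum, mul_add, Finset.sum_add_distrib]
      rw [Finset.sum_comm]
      have e1 : ∑ i, ∑ j, X i * (dG m i j * X j) = ∑ i, ∑ j, dG m i j * X i * X j :=
        Finset.sum_congr rfl fun i _ => Finset.sum_congr rfl fun j _ => by ring
      rw [e1, add_sub_cancel_left]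
      refine Finset.sum_congr rfl fun i _ => Finset.sum_congr rfl fun j _ => ?_
      rw [hGs]
      ring
    rw [hq, Finset.sum_add_distrib, e]
    ring
  -- This is where the field has to be a gradient: symmetry of H replaces Xʲ ∂ⱼpₘ by Xʲ ∂ₘpⱼ.
  have h3 : ∑ j, X j * dX j k =
      ∑ m, G⁻¹ k m * (∑ i, X i * H m i - ∑ i, ∑ j, dG i j m * X i * X j) := by
    simp only [h1, Finset.mul_sum]
    rw [Finset.sum_comm]
    refine Finset.sum_congr rfl fun m _ => ?_
    rw [← Finset.sum_sub_distrib, Finset.mul_sum]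
    refine Finset.sum_congr rfl fun i _ => ?_
    have : ∑ j, dG i j m * X i * X j = X i * ∑ j, dG i m j * X j := by
      rw [Finset.mul_sum]
      refine Finset.sum_congr rfl fun j _ => ?_
      rw [hdG]
      ring
    rw [this, hH]
    ring
  -- Contracted with X twice, the first two terms of the Christoffel symbol agree. Their sum cancels
  -- the metric term of `h3`.
  have h4 : ∑ i, ∑ j, (1 / 2 * ∑ l, G⁻¹ k l * (dG i j l + dG j i l - dG l i j)) * X i * X j =
      ∑ m, G⁻¹ k m * (∑ i, ∑ j, dG i j m * X i * X j -
        1 / 2 * ∑ i, ∑ j, dG m i j * X i * X j) := by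
    have e1 : ∀ m, ∑ i, ∑ j, dG j i m * X i * X j = ∑ i, ∑ j, dG i j m * X i * X j := fun m => by
      rw [Finset.sum_comm]
      exact Finset.sum_congr rfl fun i _ => Finset.sum_congr rfl fun j _ => by ring
    have e2 : ∀ m, ∑ i, ∑ j, dG i j m * X i * X j - 1 / 2 * ∑ i, ∑ j, dG m i j * X i * X j =
        ∑ i, ∑ j, 1 / 2 * (dG i j m + dG j i m - dG m i j) * X i * X j := fun m => by
      have e3 : ∑ i, ∑ j, 1 / 2 * (dG i j m + dG j i m - dG m i j) * X i * X j =
          1 / 2 * (∑ i, ∑ j, dG i j m * X i * X j + ∑ i, ∑ j, dG j i m * X i * X j -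
            ∑ i, ∑ j, dG m i j * X i * X j) := by
        simp only [Finset.mul_sum, ← Finset.sum_add_distrib, ← Finset.sum_sub_distrib]
        exact Finset.sum_congr rfl fun i _ => Finset.sum_congr rfl fun j _ => by ring
      rw [e3, e1]
      ring
    simp only [e2]
    simp only [Finset.mul_sum, Finset.sum_mul]
    rw [Finset.sum_congr rfl fun i _ => Finset.sum_comm, Finset.sum_comm]
    refine Finset.sum_congr rfl fun m _ => Finset.sum_congr rfl fun i _ =>
      Finset.sum_congr rfl fun j _ => ?_
    ring
  rw [h3, h4, ← Finset.sum_add_distrib, Finset.mul_sum]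
  refine Finset.sum_congr rfl fun m _ => ?_
  rw [h2]
  ring

variable {n : ℕ}

theorem pd_congr {h h' : EuclideanSpace ℝ (Fin n) → ℝ} {y : EuclideanSpace ℝ (Fin n)}
    (e : h =ᶠ[𝓝 y] h') (i : Fin n) : pd i h y = pd i h' y := by
  rw [pd, pd, e.fderiv_eq]

theorem pd_sum_mul {ι : Type} [Fintype ι] {a b : ι → EuclideanSpace ℝ (Fin n) → ℝ}
    {y : EuclideanSpace ℝ (Fin n)} (ha : ∀ i, DifferentiableAt ℝ (a i) y)
    (hb : ∀ i, DifferentiableAt ℝ (b i) y) (l : Fin n) :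
    pd l (fun z => ∑ i, a i z * b i z) y = ∑ i, (pd l (a i) y * b i y + a i y * pd l (b i) y) := by
  have h := HasFDerivAt.fun_sum (u := Finset.univ) fun i _ =>
    (ha i).hasFDerivAt.fun_mul (hb i).hasFDerivAt
  rw [pd, h.fderiv, FunLike.coe_sum, Finset.sum_apply]
  refine Finset.sum_congr rfl fun i _ => ?_
  simp only [add_apply, smul_apply, smul_eq_mul, pd]
  ring

theorem pd_pd_comm {h : EuclideanSpace ℝ (Fin n) → ℝ} {y : EuclideanSpace ℝ (Fin n)}
    (hh : ContDiffAt ℝ ∞ h y) (i j : Fin n) : pd i (pd j h) y = pd j (pd i h) y := by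
  have hs := hh.isSymmSndFDerivAt (by simpa using WithTop.coe_le_coe.2 (le_top (a := (2 : ℕ∞))))
    (stdVec i) (stdVec j)
  have hd : HasFDerivAt (fderiv ℝ h) (fderiv ℝ (fderiv ℝ h) y) y :=
    ((hh.fderiv_right (m := ∞) (by simp)).differentiableAt (by simp)).hasFDerivAt
  have e : ∀ a b : Fin n, pd a (pd b h) y = fderiv ℝ (fderiv ℝ h) y (stdVec a) (stdVec b) :=
    fun a b => by
      have := (hd.clm_apply (hasFDerivAt_const (stdVec b) y)).fderiv
      change fderiv ℝ (fun z => fderiv ℝ h z (stdVec b)) y (stdVec a) = _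
      rw [this]
      simp
  rw [e, e, hs]

variable {M : Type u} [TopologicalSpace M] [ChartedSpace (EuclideanSpace ℝ (Fin n)) M]
  [IsManifold (𝓡 n) ∞ M] (g : Metric n M)

/-- At its own centre the preferred chart has the identity as derivative, by the definition of the
tangent space. -/
theorem comp_self_chart (X : ∀ x : M, TangentSpace (𝓡 n) x) (x : M) (i : Fin n) :
    comp x X (extChartAt (𝓡 n) x x) i = coord (X x) i := by
  -- The chart followed by its inverse returns x only up to a propositional equality, so the point
  -- is generalised before substituting.
  have h : ∀ z, z = x → coord (mfderiv (𝓡 n) 𝓘(ℝ, EuclideanSpace ℝ (Fin n)) (extChartAt (𝓡 n) x)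
      z (X z)) i = coord (X x) i := by
    rintro z rfl
    rw [mfderiv_extChartAt_self]
    rfl
  exact h _ (extChartAt_to_inv x)

theorem ofComponents_comp (X : ∀ x : M, TangentSpace (𝓡 n) x) (x : M) :
    ofComponents x (fun i => comp x X (extChartAt (𝓡 n) x x) i) = X x := by
  have h : ∀ v w : EuclideanSpace ℝ (Fin n), (∀ i, v i = w i) → v = w := fun _ _ => PiLp.ext
  exact h _ _ fun i => comp_self_chart X x i

/-- The algebraic identity is applied in the chart at x, with p the coordinate differential of θ and
H its coordinate Hessian. -/
theorem covDeriv_grad_self {θ : M → ℝ} (hθ : ContMDiff (𝓡 n) 𝓘(ℝ, ℝ) ∞ θ) (x : M) :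
    covDeriv g (grad g θ) (grad g θ) x =
      grad g (fun z => 1 / 2 * normSq g z (grad g θ z)) x := by
  set y := extChartAt (𝓡 n) x x with hy
  have hyT : y ∈ (extChartAt (𝓡 n) x).target := mem_extChartAt_target x
  have hT := target_mem_nhds hyT
  have hq : ContMDiff (𝓡 n) 𝓘(ℝ, ℝ) ∞ (gradInner g θ θ) := contMDiff_gradInner g hθ hθ
  have hX := smoothField_grad g hθ
  set Θ : EuclideanSpace ℝ (Fin n) → ℝ := fun z => θ ((extChartAt (𝓡 n) x).symm z) with hΘ
  have hΘs : ContDiffOn ℝ ∞ Θ (extChartAt (𝓡 n) x).target := contDiffOn_comp_symm hθ x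
  have dif : ∀ {h : EuclideanSpace ℝ (Fin n) → ℝ}, ContDiffOn ℝ ∞ h (extChartAt (𝓡 n) x).target →
      DifferentiableAt ℝ h y := fun h => (h.contDiffAt hT).differentiableAt (by simp)
  have hp : ∀ z ∈ (extChartAt (𝓡 n) x).target, ∀ i,
      pd i Θ z = ∑ j, gram g x z i j * comp x (grad g θ) z j := fun z hz i => by
    rw [pd_comp_symm hz (hθ.mdifferentiableAt (by simp)), ← grad_spec g, ← inner_coordVec g hz]
  have hqe : ∀ z ∈ (extChartAt (𝓡 n) x).target,
      gradInner g θ θ ((extChartAt (𝓡 n) x).symm z) =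
        ∑ i, comp x (grad g θ) z i * pd i Θ z := fun z hz => by
    rw [gradInner_eq]
    exact mfderiv_eq_sum hz (hθ.mdifferentiableAt (by simp)) _
  have key := christoffel_algebra (G := gram g x y) (det_gram_pos g hyT).ne'.isUnit
    (dG := fun l i j => pd l (fun z => gram g x z i j) y)
    (fun l i j => by simp only [gram_symm g x _ i j])
    (X := comp x (grad g θ) y) (p := fun i => pd i Θ y)
    (dX := fun l i => pd l (fun z => comp x (grad g θ) z i) y) (H := fun l i => pd l (pd i Θ) y)
    (dq := fun l => pd l (fun z => gradInner g θ θ ((extChartAt (𝓡 n) x).symm z)) y)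
    (gram_symm g x y) (hp y hyT)
    (fun l i => pd_pd_comm (hΘs.contDiffAt hT) l i)
    (fun l i => by
      rw [← pd_sum_mul (fun j => dif (contDiffOn_gram g x i j)) (fun j => dif (hX x j))]
      exact pd_congr (by filter_upwards [hT] with z hz using hp z hz i) l)
    (fun l => by
      rw [← pd_sum_mul (fun j => dif (hX x j))
        (fun j => dif (contDiffOn_pd (isOpen_target x) hΘs j))]
      exact pd_congr (by filter_upwards [hT] with z hz using hqe z hz) l)
  have hq2 : ContMDiff (𝓡 n) 𝓘(ℝ, ℝ) ∞ (fun z => 1 / 2 * normSq g z (grad g θ z)) :=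
    contMDiff_const.mul hq
  rw [← ofComponents_comp (grad g (fun z => 1 / 2 * normSq g z (grad g θ z))) x, covDeriv]
  congr 1
  funext k
  rw [comp_grad g hyT (hq2.mdifferentiableAt (by simp))]
  refine (key k).trans ?_
  rw [Finset.mul_sum]
  refine Finset.sum_congr rfl fun m _ => ?_
  have e : pd m (fun z => 1 / 2 * normSq g ((extChartAt (𝓡 n) x).symm z)
      (grad g θ ((extChartAt (𝓡 n) x).symm z))) y =
      1 / 2 * pd m (fun z => gradInner g θ θ ((extChartAt (𝓡 n) x).symm z)) y := by
    have h1 := (dif (contDiffOn_comp_symm hq x)).hasFDerivAt.const_mul (1 / 2)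
    exact congrArg (fun A : EuclideanSpace ℝ (Fin n) →L[ℝ] ℝ => A (stdVec m)) h1.fderiv
  rw [e]
  ring

end CovariantDerivative

/-! ### Partial derivatives of functions of time and space. -/

section Slices

variable {E : Type*} [NormedAddCommGroup E] [NormedSpace ℝ E] {W : Type*} [NormedAddCommGroup W]
  [NormedSpace ℝ W] {S : Set (ℝ × E)} {F : ℝ × E → W}

theorem hasDerivAt_slice (hS : IsOpen S) (hF : ContDiffOn ℝ ∞ F S) {t : ℝ} {y : E}
    (h : (t, y) ∈ S) : HasDerivAt (fun s => F (s, y)) (fderiv ℝ F (t, y) (1, 0)) t :=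
  (((hF.contDiffAt (hS.mem_nhds h)).differentiableAt (by simp)).hasFDerivAt).comp_hasDerivAt t
    ((hasDerivAt_id' t).prodMk (hasDerivAt_const t y))

theorem hasFDerivAt_slice (hS : IsOpen S) (hF : ContDiffOn ℝ ∞ F S) {t : ℝ} {y : E}
    (h : (t, y) ∈ S) : HasFDerivAt (fun z => F (t, z))
      ((fderiv ℝ F (t, y)).comp (ContinuousLinearMap.inr ℝ ℝ E)) y :=
  (((hF.contDiffAt (hS.mem_nhds h)).differentiableAt (by simp)).hasFDerivAt).comp y
    ((hasFDerivAt_const t y).prodMk (hasFDerivAt_id y))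

theorem contDiffOn_fderiv_apply (hS : IsOpen S) (hF : ContDiffOn ℝ ∞ F S) (v : ℝ × E) :
    ContDiffOn ℝ ∞ (fun p => fderiv ℝ F p v) S :=
  (hF.fderiv_of_isOpen (m := ∞) hS (by simp)).clm_apply contDiffOn_const

theorem fderiv_fderiv_apply_comm (hS : IsOpen S) (hF : ContDiffOn ℝ ∞ F S) {p : ℝ × E} (h : p ∈ S)
    (v w : ℝ × E) : fderiv ℝ (fun q => fderiv ℝ F q v) p w =
      fderiv ℝ (fun q => fderiv ℝ F q w) p v := by
  have hs := (hF.contDiffAt (hS.mem_nhds h)).isSymmSndFDerivAt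
    (by simpa using WithTop.coe_le_coe.2 (le_top (a := (2 : ℕ∞)))) v w
  have hd : HasFDerivAt (fderiv ℝ F) (fderiv ℝ (fderiv ℝ F) p) p :=
    (((hF.fderiv_of_isOpen (m := ∞) hS (by simp)).contDiffAt
      (hS.mem_nhds h)).differentiableAt (by simp)).hasFDerivAt
  have e : ∀ a b : ℝ × E, fderiv ℝ (fun q => fderiv ℝ F q a) p b =
      fderiv ℝ (fderiv ℝ F) p b a := fun a b => by
    rw [(hd.clm_apply (hasFDerivAt_const a p)).fderiv]
    simp
  rw [e, e, hs]

end Slices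

/-! ### Time-dependent functions on M and their gradients. -/

section TimeDependent

variable {n : ℕ}

theorem pd_slice {S : Set (ℝ × EuclideanSpace ℝ (Fin n))} {F : ℝ × EuclideanSpace ℝ (Fin n) → ℝ}
    (hS : IsOpen S) (hF : ContDiffOn ℝ ∞ F S) {t : ℝ} {y : EuclideanSpace ℝ (Fin n)}
    (h : (t, y) ∈ S) (i : Fin n) :
    pd i (fun z => F (t, z)) y = fderiv ℝ F (t, y) (0, stdVec i) := by
  rw [pd, (hasFDerivAt_slice hS hF h).fderiv]
  simp

theorem contDiffOn_pd_slice {S : Set (ℝ × EuclideanSpace ℝ (Fin n))}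
    {F : ℝ × EuclideanSpace ℝ (Fin n) → ℝ} (hS : IsOpen S) (hF : ContDiffOn ℝ ∞ F S) (i : Fin n) :
    ContDiffOn ℝ ∞ (fun p => pd i (fun z => F (p.1, z)) p.2) S :=
  (contDiffOn_fderiv_apply hS hF (0, stdVec i)).congr fun _ hp => pd_slice hS hF hp i

variable {M : Type u} [TopologicalSpace M] [ChartedSpace (EuclideanSpace ℝ (Fin n)) M]
  [IsManifold (𝓡 n) ∞ M]

theorem contDiffOn_of_contMDiffOn {W : Type*} [NormedAddCommGroup W] [NormedSpace ℝ W]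
    {J : Set ℝ} {u : ℝ → M → W}
    (hu : ContMDiffOn (𝓘(ℝ, ℝ).prod (𝓡 n)) 𝓘(ℝ, W) ∞ (fun p : ℝ × M => u p.1 p.2) (J ×ˢ univ))
    (x₀ : M) :
    ContDiffOn ℝ ∞ (fun p : ℝ × EuclideanSpace ℝ (Fin n) =>
      u p.1 ((extChartAt (𝓡 n) x₀).symm p.2)) (J ×ˢ (extChartAt (𝓡 n) x₀).target) := by
  have h1 : ContMDiffOn (𝓘(ℝ, ℝ).prod 𝓘(ℝ, EuclideanSpace ℝ (Fin n))) (𝓘(ℝ, ℝ).prod (𝓡 n)) ∞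
      (fun p : ℝ × EuclideanSpace ℝ (Fin n) => (p.1, (extChartAt (𝓡 n) x₀).symm p.2))
      (J ×ˢ (extChartAt (𝓡 n) x₀).target) :=
    contMDiffOn_fst.prodMk ((contMDiffOn_extChartAt_symm x₀).comp contMDiffOn_snd
      fun _ hp => hp.2)
  have h2 := hu.comp h1 fun p hp => ⟨hp.1, mem_univ _⟩
  -- The product of the two models is identified with the model of the product vector space, where
  -- smoothness is ordinary differentiability.
  rw [← modelWithCornersSelf_prod, chartedSpaceSelf_prod] at h2
  exact contMDiffOn_iff_contDiffOn.1 h2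

theorem isOpen_prod_target {J : Set ℝ} (hJ : IsOpen J) (x₀ : M) :
    IsOpen (J ×ˢ (extChartAt (𝓡 n) x₀).target) := hJ.prod (isOpen_target x₀)

variable {W : Type*} [NormedAddCommGroup W] [NormedSpace ℝ W] {J : Set ℝ}
  {u : ℝ → C^∞⟮𝓡 n, M; 𝓘(ℝ, W), W⟯} [T2Space M] [CompactSpace M] [MeasurableSpace M]
  [BorelSpace M]

theorem JointlySmooth.contDiffOn (hu : JointlySmooth J u) (x₀ : M) :
    ContDiffOn ℝ ∞ (fun p : ℝ × EuclideanSpace ℝ (Fin n) =>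
      u p.1 ((extChartAt (𝓡 n) x₀).symm p.2)) (J ×ˢ (extChartAt (𝓡 n) x₀).target) :=
  contDiffOn_of_contMDiffOn (u := fun t x => u t x) hu x₀

theorem JointlySmooth.hasDerivAt (hJ : IsOpen J) (hu : JointlySmooth J u) {t : ℝ} (ht : t ∈ J)
    (x : M) : HasDerivAt (fun s => u s x) (deriv (fun s => u s x) t) t := by
  obtain ⟨x₀, y, hy, rfl⟩ := exists_symm_eq (n := n) x
  exact (hasDerivAt_slice (isOpen_prod_target hJ x₀) (hu.contDiffOn x₀)
    ⟨ht, hy⟩).differentiableAt.hasDerivAt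

theorem JointlySmooth.contMDiff_deriv (hJ : IsOpen J) (hu : JointlySmooth J u) {t : ℝ}
    (ht : t ∈ J) : ContMDiff (𝓡 n) 𝓘(ℝ, W) ∞ (fun x => deriv (fun s => u s x) t) := by
  refine contMDiff_of_contDiffOn_comp_symm fun x₀ => ?_
  have h := contDiffOn_fderiv_apply (isOpen_prod_target hJ x₀) (hu.contDiffOn x₀) (1, 0)
  refine (h.comp (f := fun y => (t, y)) (contDiffOn_const.prodMk contDiffOn_id)
    fun y hy => ⟨ht, hy⟩).congr fun y hy => ?_
  exact (hasDerivAt_slice (isOpen_prod_target hJ x₀) (hu.contDiffOn x₀) ⟨ht, hy⟩).deriv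

variable (g : Metric n M)

theorem grad_eq_ofComponents {w : M → ℝ} (hw : ContMDiff (𝓡 n) 𝓘(ℝ, ℝ) ∞ w) (x : M) :
    grad g w x = ofComponents x (fun i => ∑ j, (gram g x (extChartAt (𝓡 n) x x))⁻¹ i j *
      pd j (fun z => w ((extChartAt (𝓡 n) x).symm z)) (extChartAt (𝓡 n) x x)) := by
  rw [← ofComponents_comp (grad g w) x]
  congr 1
  funext i
  exact comp_grad g (mem_extChartAt_target x) (hw.mdifferentiableAt (by simp)) i

/-- The metric does not depend on time, so in the chart at x only ∂ⱼθ does, and mixed partial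
derivatives commute. -/
theorem timeDeriv_grad (hJ : IsOpen J) {θ : ℝ → CR n M} (hθ : JointlySmooth J θ) {t : ℝ}
    (ht : t ∈ J) (x : M) :
    timeDeriv (fun s => grad g (θ s)) t x = grad g (fun x => deriv (fun s => θ s x) t) x := by
  set y := extChartAt (𝓡 n) x x
  have hy : y ∈ (extChartAt (𝓡 n) x).target := mem_extChartAt_target x
  have hS := isOpen_prod_target (n := n) hJ x
  have hΘ := hθ.contDiffOn x
  rw [grad_eq_ofComponents g (hθ.contMDiff_deriv hJ ht)]
  have h1 : ∀ j, HasDerivAt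
      (fun s => pd j (fun z => θ s ((extChartAt (𝓡 n) x).symm z)) y)
      (pd j (fun z => deriv (fun s => θ s ((extChartAt (𝓡 n) x).symm z)) t) y) t := fun j => by
    have e1 := hasDerivAt_slice hS (contDiffOn_fderiv_apply hS hΘ (0, stdVec j))
      (show (t, y) ∈ _ from ⟨ht, hy⟩)
    have e2 : pd j (fun z => deriv (fun s => θ s ((extChartAt (𝓡 n) x).symm z)) t) y =
        pd j (fun z => fderiv ℝ (fun p : ℝ × EuclideanSpace ℝ (Fin n) =>
          θ p.1 ((extChartAt (𝓡 n) x).symm p.2)) (t, z) (1, 0)) y := by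
      refine pd_congr ?_ j
      filter_upwards [target_mem_nhds hy] with z hz
      exact (hasDerivAt_slice hS hΘ ⟨ht, hz⟩).deriv
    rw [e2, pd_slice hS (contDiffOn_fderiv_apply hS hΘ (1, 0)) ⟨ht, hy⟩,
      fderiv_fderiv_apply_comm hS hΘ ⟨ht, hy⟩]
    refine e1.congr_of_eventuallyEq ?_
    filter_upwards [hJ.mem_nhds ht] with s hs
    exact pd_slice hS hΘ (show (s, y) ∈ _ from ⟨hs, hy⟩) j
  have h2 : HasDerivAt (F := Fin n → ℝ) (fun s i => ∑ j, (gram g x y)⁻¹ i j *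
      pd j (fun z => θ s ((extChartAt (𝓡 n) x).symm z)) y)
      (fun i => ∑ j, (gram g x y)⁻¹ i j *
        pd j (fun z => deriv (fun s => θ s ((extChartAt (𝓡 n) x).symm z)) t) y) t :=
    hasDerivAt_pi.2 fun i => HasDerivAt.fun_sum fun j _ => (h1 j).const_mul _
  have h3 := ((EuclideanSpace.equiv (Fin n) ℝ).symm.toContinuousLinearMap.hasFDerivAt
    (x := _)).comp_hasDerivAt t h2
  have h4 : (fun s => (grad g (θ s) x : EuclideanSpace ℝ (Fin n))) =
      fun s => (EuclideanSpace.equiv (Fin n) ℝ).symm (fun i => ∑ j, (gram g x y)⁻¹ i j *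
      pd j (fun z => θ s ((extChartAt (𝓡 n) x).symm z)) y) := by
    funext s
    exact grad_eq_ofComponents g (θ s).contMDiff x
  rw [timeDeriv]
  exact (congrArg (fun h : ℝ → EuclideanSpace ℝ (Fin n) => deriv h t) h4).trans h3.deriv

end TimeDependent

/-! ### Correspondence between solutions of (A) and (B). -/

section Trajectories

theorem exp_half_eq_div_norm {M : Type u} {ρ θ : M → ℝ} {x : M} {z : ℂ} (hρ : 0 < ρ x)
    (h : z = madelungFun ρ θ x) : Complex.exp ((θ x / 2 : ℝ) * Complex.I) = z / ‖z‖ := by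
  have h3 : ‖z‖ = √(ρ x) := by
    rw [← Real.sqrt_sq (norm_nonneg z), h, norm_sq_madelungFun _ _ _ hρ.le]
  have h4 : ((√(ρ x) : ℝ) : ℂ) ≠ 0 := by exact_mod_cast (Real.sqrt_pos.2 hρ).ne'
  rw [h3, h, madelungFun, mul_div_cancel_left₀ _ h4]

theorem exp_half_add_arg {θ : ℝ} {z w : ℂ} (hz : z ≠ 0) (hw : w ≠ 0)
    (h : Complex.exp ((θ / 2 : ℝ) * Complex.I) = w / ‖w‖) :
    Complex.exp (((θ + 2 * (z * w⁻¹).arg) / 2 : ℝ) * Complex.I) = z / ‖z‖ := by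
  have h1 : (((θ + 2 * (z * w⁻¹).arg) / 2 : ℝ) : ℂ) * Complex.I =
      (θ / 2 : ℝ) * Complex.I + (z * w⁻¹).arg * Complex.I := by
    push_cast
    ring
  have h5 := ofReal_norm_mul_exp_arg (z * w⁻¹)
  have hz' : (‖z‖ : ℂ) ≠ 0 := by exact_mod_cast (norm_pos_iff.2 hz).ne'
  have hw' : (‖w‖ : ℂ) ≠ 0 := by exact_mod_cast (norm_pos_iff.2 hw).ne'
  rw [norm_mul, norm_inv] at h5
  push_cast at h5
  rw [h1, Complex.exp_add, h, eq_div_iff hz']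
  calc w / ‖w‖ * Complex.exp ((z * w⁻¹).arg * Complex.I) * ‖z‖ =
      w * (‖z‖ * (‖w‖ : ℂ)⁻¹ * Complex.exp ((z * w⁻¹).arg * Complex.I)) := by ring
    _ = z := by
      rw [h5]
      field_simp

variable {n : ℕ} {M : Type u} [TopologicalSpace M] [ChartedSpace (EuclideanSpace ℝ (Fin n)) M]
  [IsManifold (𝓡 n) ∞ M] [T2Space M] [CompactSpace M] [MeasurableSpace M]
  [BorelSpace M] (g : Metric n M) {J : Set ℝ}

/-- Factoring out e^{iθ/2}, the left side of (B) is −√ρ θ̇/2 + iρ̇/(2√ρ). Equality of real parts is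
then the Hamilton-Jacobi equation times −√ρ/2, and equality of imaginary parts is the continuity
equation times 1/(2√ρ). -/
theorem solvesHam_iff_solvesSchrodinger (hJ : IsOpen J) (V : M → ℝ) (f : ℝ → ℝ)
    {ρ θ : ℝ → CR n M} (hρ : JointlySmooth J ρ) (hθ : JointlySmooth J θ)
    (h0 : ∀ t ∈ J, ∀ x, 0 < ρ t x) :
    SolvesHam g V f J (fun t => ρ t) (fun t => θ t) ↔
      SolvesSchrodinger g V f J (fun t => madelungFun (ρ t) (θ t)) := by
  refine forall₂_congr fun t ht => forall_congr' fun x => ?_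
  have hp := h0 t ht x
  have hr := Real.sqrt_pos.2 hp
  have hsq := Real.sq_sqrt hp.le
  have hd : deriv (fun s => madelungFun (ρ s) (θ s) x) t =
      madelungFun (ρ t) (θ t) x * ((deriv (fun s => ρ s x) t / (2 * ρ t x) : ℝ) +
        (deriv (fun s => θ s x) t / 2 : ℝ) * Complex.I) := by
    have h1 := ((contDiffOn_polarMap.contDiffAt (isOpen_polarDomain.mem_nhds
      (show (ρ t x, θ t x) ∈ polarDomain from hp))).differentiableAt (by simp)).hasFDerivAt
    have h2 := h1.comp_hasDerivAt t
      ((JointlySmooth.hasDerivAt hJ hρ ht x).prodMk (JointlySmooth.hasDerivAt hJ hθ ht x))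
    exact h2.deriv.trans (fderiv_polarMap (q := (ρ t x, θ t x)) hp _)
  simp only [hd]
  rw [schrodingerOp_madelungFun g V f (ρ t).contMDiff (θ t).contMDiff (h0 t ht)]
  set a := deriv (fun s => θ s x) t
  set d := deriv (fun s => ρ s x) t
  set K := 1 / 2 * normSq g x (grad g (θ t) x)
  set Q := quantumPotential g V f (ρ t) x
  set D := divg g (fun y => ρ t y • grad g (θ t) y) x
  set r := √(ρ t x) with hrd
  have e1 : Complex.I * (madelungFun (ρ t) (θ t) x * ((d / (2 * ρ t x) : ℝ) +
      (a / 2 : ℝ) * Complex.I)) = Complex.exp ((θ t x / 2 : ℝ) * Complex.I) *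
      ((-(r * a / 2) : ℝ) + ((2 * r)⁻¹ * d : ℝ) * Complex.I) := by
    have e2 : (2 * r)⁻¹ * d = r * (d / (2 * ρ t x)) := by
      rw [← hsq]
      field_simp
    rw [e2, madelungFun, ← hrd]
    push_cast
    linear_combination (r * Complex.exp ((θ t x / 2 : ℂ) * Complex.I) * (a / 2 : ℂ)) *
      Complex.I_mul_I
  rw [e1, mul_right_inj' (Complex.exp_ne_zero _), Complex.ext_iff]
  simp only [Complex.add_re, Complex.sub_re, Complex.add_im, Complex.sub_im, Complex.ofReal_re,
    Complex.ofReal_im, Complex.re_ofReal_mul, Complex.im_ofReal_mul, Complex.I_re, Complex.I_im]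
  have hr2 : (2 * r)⁻¹ ≠ 0 := by positivity
  refine and_congr ⟨fun h => ?_, fun h => ?_⟩ ⟨fun h => ?_, fun h => ?_⟩
  · linear_combination (-(r / 2)) * h
  · have : r / 2 * (a + K + Q) = 0 := by linear_combination -h
    exact (mul_eq_zero.1 this).resolve_left (by positivity)
  · linear_combination (2 * r)⁻¹ * h
  · have : (2 * r)⁻¹ * (d + D) = 0 := by linear_combination h
    exact (mul_eq_zero.1 this).resolve_left hr2

theorem solvesSchrodinger_congr (hJ : IsOpen J) {V : M → ℝ} {f : ℝ → ℝ} {ψ φ : ℝ → M → ℂ}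
    (h : ∀ t ∈ J, ψ t = φ t) (hs : SolvesSchrodinger g V f J ψ) :
    SolvesSchrodinger g V f J φ := fun t ht x => by
  have e : (fun s => φ s x) =ᶠ[𝓝 t] fun s => ψ s x := by
    filter_upwards [hJ.mem_nhds ht] with s hs
    rw [h s hs]
  rw [e.deriv_eq, ← h t ht]
  exact hs t ht x

theorem jointlySmooth_superpose {W W' : Type} [NormedAddCommGroup W] [NormedSpace ℝ W]
    [NormedAddCommGroup W'] [NormedSpace ℝ W'] {φ : W → W'} {Ω : Set W} (hΩ : IsOpen Ω)
    (hφ : ContDiffOn ℝ ∞ φ Ω) {u : ℝ → C^∞⟮𝓡 n, M; 𝓘(ℝ, W), W⟯} (hu : JointlySmooth J u)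
    (hm : ∀ t ∈ J, ∀ x, u t x ∈ Ω) {w : ℝ → C^∞⟮𝓡 n, M; 𝓘(ℝ, W'), W'⟯}
    (hw : ∀ t ∈ J, ∀ x, w t x = φ (u t x)) : JointlySmooth J w := by
  have h : ContMDiffOn (𝓘(ℝ, ℝ).prod (𝓡 n)) 𝓘(ℝ, W') ∞ (fun p : ℝ × M => φ (u p.1 p.2))
      (J ×ˢ univ) := fun p hp =>
    ((hφ.contDiffAt (hΩ.mem_nhds (hm p.1 hp.1 p.2))).contMDiffAt).comp_contMDiffWithinAt p
      (hu p hp)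
  exact h.congr fun p hp => hw p.1 hp.1 p.2

theorem isSchrodingerTrajectory_of_isHamTrajectory (hJ : IsOpen J) {V : M → ℝ} {f : ℝ → ℝ}
    {c : ℝ → CotDens g} (hc : IsHamTrajectory g V f J c) :
    IsSchrodingerTrajectory g V f J (fun t => madelung g (c t)) := by
  obtain ⟨ρ, θ, ⟨hρ, hθ, hr⟩, hs⟩ := hc
  have hm : ∀ t ∈ J, (ρ t, θ t) ∈ cotPairs g := fun t ht => (hr t ht).1
  have h0 : ∀ t ∈ J, ∀ x, 0 < ρ t x := fun t ht => (hm t ht).1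
  refine ⟨fun t => madelungLift (ρ t, θ t), ⟨?_, fun t ht => ?_⟩, ?_⟩
  · exact jointlySmooth_superpose isOpen_polarDomain contDiffOn_polarMap
      (u := fun t => smoothPair (ρ t) (θ t)) (hρ.prodMk_space hθ) h0
      fun t ht x => madelungLift_apply (h0 t ht) x
  · have h := madelungLift_eq g _ (hm t ht)
    refine ⟨mem_of_eq_of_mem h (madelungSphere g ⟨_, hm t ht⟩).2, ?_⟩
    obtain ⟨h', e⟩ := hr t ht
    exact (congrArg (projMk g) (Subtype.ext h)).trans (congrArg (madelung g) e)
  · refine solvesSchrodinger_congr g hJ (fun t ht => ?_)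
      ((solvesHam_iff_solvesSchrodinger g hJ V f hρ hθ h0).1 hs)
    funext x
    exact (madelungLift_apply (p := (ρ t, θ t)) (h0 t ht) x).symm

/-- Near t₀ the smooth function θ(t₀) + 2 arg(ψ(t)/ψ(t₀)) is also a phase of ψ(t). Its difference
from θ(t) lies in 4πℤ and is constant on M; continuity in time at the single point x₀ forces it to
be zero. -/
theorem jointlySmooth_phase [PreconnectedSpace M] (hJ : IsOpen J) {ψ : ℝ → CC n M}
    (hψ : JointlySmooth J ψ) {ρ θ : ℝ → CR n M} (h0 : ∀ t ∈ J, ∀ x, 0 < ρ t x)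
    (h : ∀ t ∈ J, ∀ x, ψ t x = madelungFun (ρ t) (θ t) x) (x₀ : M)
    (hβ : ContinuousOn (fun t => θ t x₀) J) : JointlySmooth J θ := by
  have hψ0 : ∀ t ∈ J, ∀ x, ψ t x ≠ 0 := fun t ht x => by
    rw [h t ht]
    exact madelungFun_ne_zero (h0 t ht x)
  have hexp : ∀ t ∈ J, ∀ x, Complex.exp ((θ t x / 2 : ℝ) * Complex.I) = ψ t x / ‖ψ t x‖ :=
    fun t ht x => exp_half_eq_div_norm (h0 t ht x) (h t ht x)
  rintro ⟨t₀, x₁⟩ ⟨ht₀ : t₀ ∈ J, -⟩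
  have hopen : IsOpen (J ×ˢ (univ : Set M)) := hJ.prod isOpen_univ
  have hinv : ContMDiff (𝓡 n) 𝓘(ℝ, ℂ) ∞ (fun x => (ψ t₀ x)⁻¹) := fun x =>
    ((contDiffAt_inv ℝ (hψ0 t₀ ht₀ x)).contMDiffAt).comp x ((ψ t₀).contMDiff x)
  have hq : ∀ x, ContMDiffAt (𝓘(ℝ, ℝ).prod (𝓡 n)) 𝓘(ℝ, ℂ) ∞
      (fun p : ℝ × M => ψ p.1 p.2 * (ψ t₀ p.2)⁻¹) (t₀, x) := fun x => by
    have h1 : ContMDiffAt (𝓘(ℝ, ℝ).prod (𝓡 n)) 𝓘(ℝ, ℂ) ∞ (fun p : ℝ × M => ψ p.1 p.2) (t₀, x) :=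
      ContMDiffOn.contMDiffAt hψ (hopen.mem_nhds ⟨ht₀, mem_univ _⟩)
    have h2 : ContMDiffAt (𝓘(ℝ, ℝ).prod (𝓡 n)) 𝓘(ℝ, ℂ) ∞ (fun p : ℝ × M => (ψ t₀ p.2)⁻¹)
        (t₀, x) := ContMDiffAt.comp (g := fun x => (ψ t₀ x)⁻¹) (t₀, x) (hinv x) contMDiffAt_snd
    have h3 : ContDiff ℝ ∞ (fun q : ℂ × ℂ => q.1 * q.2) := contDiff_fst.mul contDiff_snd
    exact ContMDiffAt.comp (t₀, x) h3.contMDiff.contMDiffAt (h1.prodMk_space h2)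
  have hone : ∀ x, ψ t₀ x * (ψ t₀ x)⁻¹ = 1 := fun x => mul_inv_cancel₀ (hψ0 t₀ ht₀ x)
  have hslit : ∀ x, ψ t₀ x * (ψ t₀ x)⁻¹ ∈ Complex.slitPlane := fun x => by
    rw [hone]
    exact Complex.one_mem_slitPlane
  -- Compactness of M gives a time interval on which the principal argument is usable at all points
  -- simultaneously.
  have hnear : ∀ᶠ t in 𝓝 t₀, ∀ x, ψ t x * (ψ t₀ x)⁻¹ ∈ Complex.slitPlane := by
    have := (isCompact_univ (X := M)).eventually_forall_of_forall_eventually (x₀ := t₀)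
      (P := fun t x => ψ t x * (ψ t₀ x)⁻¹ ∈ Complex.slitPlane) fun x _ =>
        (hq x).continuousAt.eventually (Complex.isOpen_slitPlane.mem_nhds (hslit x))
    exact this.mono fun t ht x => ht x (mem_univ x)
  have hsm : ∀ x, ContMDiffAt (𝓘(ℝ, ℝ).prod (𝓡 n)) 𝓘(ℝ, ℝ) ∞
      (fun p : ℝ × M => θ t₀ p.2 + 2 * (ψ p.1 p.2 * (ψ t₀ p.2)⁻¹).arg) (t₀, x) := fun x => by
    have h1 : ContMDiffAt (𝓘(ℝ, ℝ).prod (𝓡 n)) 𝓘(ℝ, ℝ) ∞ (fun p : ℝ × M => θ t₀ p.2) (t₀, x) :=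
      ContMDiffAt.comp (t₀, x) ((θ t₀).contMDiff x) contMDiffAt_snd
    exact h1.add (contMDiffAt_const.mul
      (ContMDiffAt.comp (t₀, x) (contDiffAt_arg (hslit x)).contMDiffAt (hq x)))
  have hkey : ∀ᶠ t in 𝓝 t₀, ∀ x, θ t x = θ t₀ x + 2 * (ψ t x * (ψ t₀ x)⁻¹).arg := by
    have hcont : ContinuousAt
        (fun t => θ t x₀ - (θ t₀ x₀ + 2 * (ψ t x₀ * (ψ t₀ x₀)⁻¹).arg)) t₀ :=
      (hβ.continuousAt (hJ.mem_nhds ht₀)).sub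
        ((hsm x₀).continuousAt.comp (f := fun t : ℝ => (t, x₀)) (by fun_prop))
    have hsmall : ∀ᶠ t in 𝓝 t₀,
        |θ t x₀ - (θ t₀ x₀ + 2 * (ψ t x₀ * (ψ t₀ x₀)⁻¹).arg)| < 4 * Real.pi := by
      have := hcont.eventually (Metric.ball_mem_nhds _ (show 0 < 4 * Real.pi by positivity))
      simpa [hone, Real.dist_eq] using this
    filter_upwards [hnear, hsmall, hJ.mem_nhds ht₀] with t ht hts htJ x
    have he : ∀ x, Complex.exp ((θ t x / 2 : ℝ) * Complex.I) = Complex.exp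
        (((θ t₀ x + 2 * (ψ t x * (ψ t₀ x)⁻¹).arg) / 2 : ℝ) * Complex.I) := fun x => by
      rw [hexp t htJ, exp_half_add_arg (hψ0 t htJ x) (hψ0 t₀ ht₀ x) (hexp t₀ ht₀ x)]
    have hc : Continuous (fun x => θ t₀ x + 2 * (ψ t x * (ψ t₀ x)⁻¹).arg) := by
      refine (θ t₀).contMDiff.continuous.add (continuous_const.mul ?_)
      refine continuous_iff_continuousAt.2 fun x => ?_
      exact (contDiffAt_arg (ht x)).continuousAt.comp (f := fun x => ψ t x * (ψ t₀ x)⁻¹)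
        (((ψ t).contMDiff.continuous.mul hinv.continuous).continuousAt)
    have h1 := eq_of_exp_eq (θ t).contMDiff.continuous hc he x x₀
    obtain ⟨k, hk⟩ := exists_int_of_exp_eq (he x₀)
    -- The phases differ by 4πk at x₀ and by less than 4π in absolute value.
    have hk0 : k = 0 := by
      rw [hk, add_sub_cancel_left, abs_mul, abs_of_pos (by positivity : 0 < 4 * Real.pi)] at hts
      have h2 : |(k : ℝ)| < 1 := by
        by_contra h3
        have := mul_le_mul_of_nonneg_left (not_lt.1 h3) (by positivity : 0 ≤ 4 * Real.pi)
        linarith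
      have h4 : |k| < 1 := by exact_mod_cast h2
      exact Int.abs_lt_one_iff.1 h4
    rw [hk0] at hk
    simp only [Int.cast_zero, mul_zero, add_zero] at hk
    linarith
  refine ((hsm x₁).congr_of_eventuallyEq ?_).contMDiffWithinAt
  exact (continuousAt_fst.eventually hkey).mono fun p hp => hp p.2

/-- A nonempty interval is convex, hence contractible and simply connected, so a continuous
logarithm exists. -/
theorem exists_continuousOn_phase (hJ : IsOpen J) (hJc : J.OrdConnected) {z : ℝ → ℂ}
    (hz : ContinuousOn z J) (h0 : ∀ t ∈ J, z t ≠ 0) :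
    ∃ β : ℝ → ℝ, ContinuousOn β J ∧
      ∀ t ∈ J, Complex.exp ((β t / 2 : ℝ) * Complex.I) = z t / ‖z t‖ := by
  rcases J.eq_empty_or_nonempty with rfl | hne
  · exact ⟨0, by simp, by simp⟩
  have := hJc.convex.contractibleSpace hne
  have hs : IsSimplyConnected J := inferInstanceAs (SimplyConnectedSpace J)
  obtain ⟨L, hL, hLz⟩ := Complex.exists_continuousOn_eqOn_exp_comp hs hJ hz
    (by rintro ⟨t, ht, hx⟩; exact h0 t ht hx)
  refine ⟨fun t => 2 * (L t).im, continuousOn_const.mul (Complex.continuous_im.comp_continuousOn hL),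
    fun t ht => ?_⟩
  have e : Complex.exp (L t) = z t := hLz ht
  rw [← e, Complex.norm_exp, mul_div_cancel_left₀ _ (two_ne_zero' ℝ), Complex.ofReal_exp,
    ← Complex.exp_sub]
  congr 1
  apply Complex.ext <;> simp

/-- Representatives (ρ, θ) of ψ(t) are chosen independently for each t. The density |ψ|² is jointly
smooth in any case; the phase becomes so after it is normalised at a base point to a continuous
function of time. -/
theorem isHamTrajectory_of_isSchrodingerTrajectory [ConnectedSpace M] (hJ : IsOpen J)
    (hJc : J.OrdConnected) {V : M → ℝ} {f : ℝ → ℝ} {c : ℝ → CotDens g}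
    (hc : IsSchrodingerTrajectory g V f J (fun t => madelung g (c t))) :
    IsHamTrajectory g V f J c := by
  classical
  obtain ⟨ψ, ⟨hψ, hr⟩, hs⟩ := hc
  obtain ⟨x₀⟩ := (inferInstance : Nonempty M)
  have hp : ∀ t ∈ J, ∃ p : CR n M × CR n M, ∃ h : p ∈ cotPairs g, cotMk g ⟨p, h⟩ = c t ∧
      ∀ x, ψ t x = madelungFun p.1 p.2 x := fun t ht => by
    obtain ⟨hm, e⟩ := hr t ht
    obtain ⟨p, hp, hp'⟩ := exists_representative g e.symm
    exact ⟨p.1, p.2, hp, hp'⟩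
  choose! p hpm hpc hpψ using hp
  have hψ0 : ∀ t ∈ J, ∀ x, ψ t x ≠ 0 := fun t ht x => by
    rw [hpψ t ht]
    exact madelungFun_ne_zero ((hpm t ht).1 x)
  have hcont : ContinuousOn (fun t => ψ t x₀) J := fun t ht =>
    (JointlySmooth.hasDerivAt hJ hψ ht x₀).continuousAt.continuousWithinAt
  obtain ⟨β, hβ, hβe⟩ := exists_continuousOn_phase hJ hJc hcont fun t ht => hψ0 t ht x₀
  -- The added constant makes the phase at x₀ equal to β(t). It is a multiple of 4π, so ψ(t) is
  -- still represented exactly, not just up to a phase.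
  let θ : ℝ → CR n M := fun t => (p t).2 + smoothConst (β t - (p t).2 x₀)
  have hθ : ∀ t x, θ t x = (p t).2 x + (β t - (p t).2 x₀) := fun _ _ => rfl
  have hψθ : ∀ t ∈ J, ∀ x, ψ t x = madelungFun (p t).1 (θ t) x := fun t ht x => by
    have h1 := exp_half_eq_div_norm ((hpm t ht).1 x₀) (hpψ t ht x₀)
    obtain ⟨k, hk⟩ := exists_int_of_exp_eq ((hβe t ht).trans h1.symm)
    rw [hpψ t ht, madelungFun, madelungFun, hθ, hk]
    congr 1
    refine Complex.exp_eq_exp_iff_exists_int.2 ⟨-k, ?_⟩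
    push_cast
    ring
  have h0 : ∀ t ∈ J, ∀ x, 0 < (p t).1 x := fun t ht => (hpm t ht).1
  have hθs : JointlySmooth J θ := jointlySmooth_phase hJ hψ (ρ := fun t => (p t).1) h0 hψθ x₀
    (hβ.congr fun t _ => by rw [hθ]; ring)
  have hρs : JointlySmooth J (fun t => (p t).1) :=
    jointlySmooth_superpose isOpen_univ (φ := fun z : ℂ => ‖z‖ ^ 2)
      (contDiff_id.norm_sq ℝ).contDiffOn hψ (fun _ _ _ => mem_univ _) fun t ht x => by
        rw [hpψ t ht, norm_sq_madelungFun _ _ _ (h0 t ht x).le]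
  refine ⟨fun t => (p t).1, θ, ⟨hρs, hθs, fun t ht => ⟨hpm t ht, ?_⟩⟩,
    (solvesHam_iff_solvesSchrodinger g hJ V f hρs hθs h0).2
      (solvesSchrodinger_congr g hJ (fun t ht => funext (hψθ t ht)) hs)⟩
  rw [← hpc t ht]
  exact cotMk_eq_cotMk g (fun _ => rfl) (hθ t)

end Trajectories

/-! ### Smooth primitives on an interval. -/

section Primitives

theorem exists_hasDerivAt_of_continuousOn {J : Set ℝ} (hJ : IsOpen J) (hJc : J.OrdConnected)
    {b : ℝ → ℝ} (hb : ContinuousOn b J) : ∃ a : ℝ → ℝ, ∀ t ∈ J, HasDerivAt a (b t) t := by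
  rcases J.eq_empty_or_nonempty with rfl | ⟨t₀, ht₀⟩
  · exact ⟨0, by simp⟩
  refine ⟨fun t => ∫ s in t₀..t, b s, fun t ht => ?_⟩
  refine intervalIntegral.integral_hasDerivAt_right
    ((hb.mono (hJc.uIcc_subset ht₀ ht)).intervalIntegrable) ?_ (hb.continuousAt (hJ.mem_nhds ht))
  exact hb.stronglyMeasurableAtFilter hJ t ht

theorem contDiffOn_of_hasDerivAt {J : Set ℝ} (hJ : IsOpen J) {a b : ℝ → ℝ}
    (hb : ContDiffOn ℝ ∞ b J) (h : ∀ t ∈ J, HasDerivAt a (b t) t) : ContDiffOn ℝ ∞ a J := by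
  rw [contDiffOn_infty_iff_deriv_of_isOpen hJ]
  exact ⟨fun t ht => (h t ht).differentiableAt.differentiableWithinAt,
    hb.congr fun t ht => (h t ht).deriv⟩

end Primitives

/-! ### The quantum-corrected barotropic system. -/

section Barotropic

variable {n : ℕ} {M : Type u} [TopologicalSpace M] [ChartedSpace (EuclideanSpace ℝ (Fin n)) M]
  [IsManifold (𝓡 n) ∞ M] [T2Space M] [CompactSpace M] [MeasurableSpace M]
  [BorelSpace M] (g : Metric n M) {J : Set ℝ}

theorem grad_add {u w : M → ℝ} (hu : ContMDiff (𝓡 n) 𝓘(ℝ, ℝ) ∞ u)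
    (hw : ContMDiff (𝓡 n) 𝓘(ℝ, ℝ) ∞ w) (x : M) :
    grad g (fun z => u z + w z) x = grad g u x + grad g w x :=
  grad_eq_of_inner g fun v => by
    rw [differential_add (hu.mdifferentiableAt (by simp)) (hw.mdifferentiableAt (by simp)),
      map_add, add_apply, add_apply, inner_grad, inner_grad]

theorem grad_const (c : ℝ) (x : M) : grad g (fun _ => c) x = 0 :=
  grad_eq_of_inner g fun v => by
    rw [differential_const, map_zero]

theorem grad_add_const {u w : M → ℝ} (hu : ContMDiff (𝓡 n) 𝓘(ℝ, ℝ) ∞ u) {c : ℝ}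
    (h : ∀ x, w x = u x + c) : grad g w = grad g u := by
  funext x
  rw [show w = fun z => u z + c from funext h, grad_add g hu contMDiff_const, grad_const, add_zero]

/-- A function with vanishing gradient on a connected manifold is constant. -/
theorem eq_of_grad_eq_zero [PreconnectedSpace M] {u : M → ℝ}
    (hu : ContMDiff (𝓡 n) 𝓘(ℝ, ℝ) ∞ u) (h : ∀ x, grad g u x = 0) (x z : M) : u x = u z := by
  have hl : IsLocallyConstant u := by
    refine (IsLocallyConstant.iff_eventually_eq u).2 fun x => ?_
    set y := extChartAt (𝓡 n) x x
    have hy : y ∈ (extChartAt (𝓡 n) x).target := mem_extChartAt_target x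
    have hs := contDiffOn_comp_symm hu x
    have hd : ∀ w ∈ (extChartAt (𝓡 n) x).target,
        HasFDerivAt (fun y => u ((extChartAt (𝓡 n) x).symm y)) (0 : _ →L[ℝ] ℝ) w := fun w hw => by
      have h1 := ((hs.contDiffAt (target_mem_nhds hw)).differentiableAt (by simp)).hasFDerivAt
      have e : fderiv ℝ (fun y => u ((extChartAt (𝓡 n) x).symm y)) w = 0 := by
        ext v
        rw [fderiv_eq_sum_pd]
        refine Finset.sum_eq_zero fun i _ => ?_
        rw [pd_comp_symm hw (hu.mdifferentiableAt (by simp)), ← grad_spec g, h, map_zero]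
        exact mul_zero _
      rw [e] at h1
      exact h1
    -- On a coordinate ball, which is convex, vanishing derivative means constant; connectedness of
    -- M then globalises.
    obtain ⟨r, hr, hball⟩ := Metric.isOpen_iff.1 (isOpen_target (n := n) x) y hy
    have hconst : ∀ w ∈ Metric.ball y r, u ((extChartAt (𝓡 n) x).symm w) = u x := fun w hw => by
      have := (convex_ball y r).is_const_of_fderivWithin_eq_zero (𝕜 := ℝ)
        (f := fun y => u ((extChartAt (𝓡 n) x).symm y))
        (fun w hw => (hd w (hball hw)).differentiableAt.differentiableWithinAt)
        (fun w hw => ((hd w (hball hw)).hasFDerivWithinAt.fderivWithin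
          (Metric.isOpen_ball.uniqueDiffWithinAt hw)))
        hw (Metric.mem_ball_self hr)
      rw [this, extChartAt_to_inv]
    filter_upwards [(continuousAt_extChartAt (I := 𝓡 n) x).eventually
      (Metric.ball_mem_nhds y hr), extChartAt_source_mem_nhds (I := 𝓡 n) x] with z hz hz'
    rw [← hconst _ hz, (extChartAt (𝓡 n) x).left_inv hz']
  exact hl.apply_eq_of_preconnectedSpace x z

/-- The left-hand side of the Hamilton-Jacobi equation. -/
def hamiltonJacobi (V : M → ℝ) (f : ℝ → ℝ) (ρ θ : ℝ → CR n M) (t : ℝ) (x : M) : ℝ :=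
  deriv (fun s => θ s x) t + (1 / 2) * normSq g x (grad g (θ t) x)
    + quantumPotential g V f (ρ t) x

theorem contMDiff_hamiltonJacobi (hJ : IsOpen J) {V : M → ℝ} (hV : ContMDiff (𝓡 n) 𝓘(ℝ, ℝ) ∞ V)
    {f : ℝ → ℝ} (hf : ContDiffOn ℝ ∞ f (Ioi 0)) {ρ θ : ℝ → CR n M}
    (hθ : JointlySmooth J θ) {t : ℝ} (ht : t ∈ J) (h0 : ∀ x, 0 < ρ t x) :
    ContMDiff (𝓡 n) 𝓘(ℝ, ℝ) ∞ (hamiltonJacobi g V f ρ θ t) :=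
  ((JointlySmooth.contMDiff_deriv hJ hθ ht).add
    (contMDiff_const.mul (contMDiff_gradInner g (θ t).contMDiff (θ t).contMDiff))).add
    (contMDiff_quantumPotential g hV hf (ρ t).contMDiff h0)

/-- Time derivative, convective term and force are each a gradient: of θ̇, of ½|∇θ|² and of the
quantum potential. -/
theorem timeDeriv_add_covDeriv_add_grad (hJ : IsOpen J) {V : M → ℝ}
    (hV : ContMDiff (𝓡 n) 𝓘(ℝ, ℝ) ∞ V) {f : ℝ → ℝ} (hf : ContDiffOn ℝ ∞ f (Ioi 0))
    {ρ θ : ℝ → CR n M} (hθ : JointlySmooth J θ) {t : ℝ} (ht : t ∈ J) (h0 : ∀ x, 0 < ρ t x) (x : M) :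
    timeDeriv (fun s => grad g (θ s)) t x + covDeriv g (grad g (θ t)) (grad g (θ t)) x
      + grad g (quantumPotential g V f (ρ t)) x = grad g (hamiltonJacobi g V f ρ θ t) x := by
  have h1 := JointlySmooth.contMDiff_deriv hJ hθ ht
  have h2 : ContMDiff (𝓡 n) 𝓘(ℝ, ℝ) ∞ (fun x => (1 / 2) * normSq g x (grad g (θ t) x)) :=
    contMDiff_const.mul (contMDiff_gradInner g (θ t).contMDiff (θ t).contMDiff)
  rw [timeDeriv_grad g hJ hθ ht, covDeriv_grad_self g (θ t).contMDiff]
  exact ((grad_add g (h1.add h2) (contMDiff_quantumPotential g hV hf (ρ t).contMDiff h0) x).trans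
    (congrArg (· + _) (grad_add g h1 h2 x))).symm

theorem solvesBarotropic_congr (hJ : IsOpen J) {V : M → ℝ} {f : ℝ → ℝ} {ρ ρ' : ℝ → M → ℝ}
    {v v' : ℝ → ∀ x : M, TangentSpace (𝓡 n) x} (hρ : ∀ t ∈ J, ρ t = ρ' t)
    (hv : ∀ t ∈ J, v t = v' t) (h : SolvesBarotropic g V f J ρ v) :
    SolvesBarotropic g V f J ρ' v' := fun t ht x => by
  have e1 : timeDeriv v' t x = timeDeriv v t x := by
    refine Filter.EventuallyEq.deriv_eq (F := EuclideanSpace ℝ (Fin n)) ?_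
    filter_upwards [hJ.mem_nhds ht] with s hs
    rw [hv s hs]
  have e2 : deriv (fun s => ρ' s x) t = deriv (fun s => ρ s x) t := by
    refine Filter.EventuallyEq.deriv_eq ?_
    filter_upwards [hJ.mem_nhds ht] with s hs
    rw [hρ s hs]
  rw [e1, e2, ← hρ t ht, ← hv t ht]
  exact h t ht x

theorem solvesBarotropic_of_solvesHam (hJ : IsOpen J) {V : M → ℝ}
    (hV : ContMDiff (𝓡 n) 𝓘(ℝ, ℝ) ∞ V) {f : ℝ → ℝ} (hf : ContDiffOn ℝ ∞ f (Ioi 0))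
    {ρ θ : ℝ → CR n M} (hθ : JointlySmooth J θ) (h0 : ∀ t ∈ J, ∀ x, 0 < ρ t x)
    (h : SolvesHam g V f J (fun t => ρ t) (fun t => θ t)) :
    SolvesBarotropic g V f J (fun t => ρ t) (fun t => grad g (θ t)) := fun t ht x => by
  refine ⟨?_, (h t ht x).2⟩
  rw [timeDeriv_add_covDeriv_add_grad g hJ hV hf hθ ht (h0 t ht),
    show hamiltonJacobi g V f ρ θ t = fun _ => 0 from funext fun x => (h t ht x).1, grad_const]

theorem gradInner_symm_eq_sum {u w : M → ℝ} (hu : ContMDiff (𝓡 n) 𝓘(ℝ, ℝ) ∞ u)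
    (hw : ContMDiff (𝓡 n) 𝓘(ℝ, ℝ) ∞ w) {x₀ : M} {y : EuclideanSpace ℝ (Fin n)}
    (hy : y ∈ (extChartAt (𝓡 n) x₀).target) :
    gradInner g u w ((extChartAt (𝓡 n) x₀).symm y) =
      ∑ i, (∑ j, (gram g x₀ y)⁻¹ i j * pd j (fun z => w ((extChartAt (𝓡 n) x₀).symm z)) y) *
        pd i (fun z => u ((extChartAt (𝓡 n) x₀).symm z)) y := by
  rw [gradInner_eq]
  refine (mfderiv_eq_sum hy (hu.mdifferentiableAt (by simp)) _).trans ?_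
  exact Finset.sum_congr rfl fun i _ => by rw [comp_grad g hy (hw.mdifferentiableAt (by simp))]

theorem contDiffOn_gradInner_slice (hJ : IsOpen J) {u w : ℝ → CR n M} (hu : JointlySmooth J u)
    (hw : JointlySmooth J w) (x : M) : ContDiffOn ℝ ∞ (fun t => gradInner g (u t) (w t) x) J := by
  obtain ⟨x₀, y, hy, rfl⟩ := exists_symm_eq (n := n) x
  have hpd : ∀ {u : ℝ → CR n M}, JointlySmooth J u → ∀ i, ContDiffOn ℝ ∞
      (fun t => pd i (fun z => u t ((extChartAt (𝓡 n) x₀).symm z)) y) J := fun hu i =>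
    (contDiffOn_pd_slice (isOpen_prod_target hJ x₀) (hu.contDiffOn x₀) i).comp
      (f := fun t => (t, y)) (contDiffOn_id.prodMk contDiffOn_const) fun t ht => ⟨ht, hy⟩
  simp only [gradInner_symm_eq_sum g (u _).contMDiff (w _).contMDiff hy]
  exact ContDiffOn.sum fun i _ => (ContDiffOn.sum fun j _ =>
    contDiffOn_const.mul (hpd hw j)).mul (hpd hu i)

theorem contDiffOn_lap_slice (hJ : IsOpen J) {u : ℝ → CR n M} (hu : JointlySmooth J u) (x : M) :
    ContDiffOn ℝ ∞ (fun t => lap g (u t) x) J := by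
  obtain ⟨x₀, y, hy, rfl⟩ := exists_symm_eq (n := n) x
  have hS := isOpen_prod_target (n := n) hJ x₀
  have hG : ∀ {h : EuclideanSpace ℝ (Fin n) → ℝ},
      ContDiffOn ℝ ∞ h (extChartAt (𝓡 n) x₀).target → ContDiffOn ℝ ∞
        (fun p : ℝ × EuclideanSpace ℝ (Fin n) => h p.2) (J ×ˢ (extChartAt (𝓡 n) x₀).target) :=
    fun h => h.comp contDiffOn_snd fun p hp => hp.2
  have hR : ∀ i, ContDiffOn ℝ ∞ (fun p : ℝ × EuclideanSpace ℝ (Fin n) =>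
      √(gram g x₀ p.2).det * ∑ j, (gram g x₀ p.2)⁻¹ i j *
        pd j (fun z => u p.1 ((extChartAt (𝓡 n) x₀).symm z)) p.2)
      (J ×ˢ (extChartAt (𝓡 n) x₀).target) := fun i =>
    (hG (contDiffOn_sqrt_det g x₀)).mul (ContDiffOn.sum fun j _ =>
      (hG (contDiffOn_inv_gram g x₀ i j)).mul (contDiffOn_pd_slice hS (hu.contDiffOn x₀) j))
  have h : ContDiffOn ℝ ∞ (fun t => (√(gram g x₀ y).det)⁻¹ *
      ∑ i, pd i (fun z => √(gram g x₀ z).det * ∑ j, (gram g x₀ z)⁻¹ i j *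
        pd j (fun z => u t ((extChartAt (𝓡 n) x₀).symm z)) z) y) J :=
    contDiffOn_const.mul (ContDiffOn.sum fun i _ => (contDiffOn_pd_slice hS (hR i) i).comp
      (f := fun t => (t, y)) (contDiffOn_id.prodMk contDiffOn_const) fun t ht => ⟨ht, hy⟩)
  refine h.congr fun t _ => ?_
  rw [lap, divg_symm g (smoothField_grad g (u t).contMDiff) hy, divAt]
  refine congrArg _ (Finset.sum_congr rfl fun i _ => pd_congr ?_ i)
  filter_upwards [target_mem_nhds hy] with z hz
  rw [comp_grad g hz ((u t).contMDiff.mdifferentiableAt (by simp))]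

/-- At a fixed point this is a smooth function of time. Its primitive can thus be added to θ without
losing joint smoothness. -/
theorem contDiffOn_hamiltonJacobi_slice (hJ : IsOpen J) {V : M → ℝ} {f : ℝ → ℝ}
    (hf : ContDiffOn ℝ ∞ f (Ioi 0)) {ρ θ : ℝ → CR n M} (hρ : JointlySmooth J ρ)
    (hθ : JointlySmooth J θ) (h0 : ∀ t ∈ J, ∀ x, 0 < ρ t x) (x : M) :
    ContDiffOn ℝ ∞ (fun t => hamiltonJacobi g V f ρ θ t x) J := by
  have hev : ∀ {u : ℝ → CR n M}, JointlySmooth J u → ContDiffOn ℝ ∞ (fun t => u t x) J := by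
    intro u hu
    obtain ⟨x₀, y, hy, rfl⟩ := exists_symm_eq (n := n) x
    exact (hu.contDiffOn x₀).comp (f := fun t => (t, y)) (contDiffOn_id.prodMk contDiffOn_const)
      fun t ht => ⟨ht, hy⟩
  have hd : ContDiffOn ℝ ∞ (fun t => deriv (fun s => θ s x) t) J :=
    (hev hθ).deriv_of_isOpen hJ (by simp)
  have hne : ∀ t ∈ J, ρ t x ≠ 0 := fun t ht => (h0 t ht x).ne'
  have h : ContDiffOn ℝ ∞ (fun t => deriv (fun s => θ s x) t +
      (1 / 2) * gradInner g (θ t) (θ t) x + (2 * V x + 2 * f (ρ t x) +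
      (-(lap g (ρ t) x / ρ t x) + 1 / 2 * (gradInner g (ρ t) (ρ t) x / ρ t x ^ 2)))) J := by
    have hfc : ContDiffOn ℝ ∞ (fun t => f (ρ t x)) J := hf.comp (hev hρ) fun t ht => h0 t ht x
    exact (hd.add (contDiffOn_const.mul (contDiffOn_gradInner_slice g hJ hθ hθ x))).add
      ((contDiffOn_const.add (contDiffOn_const.mul hfc)).add
        (((contDiffOn_lap_slice g hJ hρ x).div (hev hρ) hne).neg.add
          (contDiffOn_const.mul ((contDiffOn_gradInner_slice g hJ hρ hρ x).div
            ((hev hρ).pow 2) fun t ht => pow_ne_zero 2 (hne t ht)))))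
  refine h.congr fun t ht => ?_
  rw [hamiltonJacobi, quantumPotential_eq g V f (ρ t).contMDiff (h0 t ht), normSq_grad]

/-- The Hamilton-Jacobi expression has zero gradient, so it is a function of time alone. Adding to θ
a primitive of minus that function makes the expression vanish, and changes neither ∇θ nor the class
of θ. -/
theorem isHamTrajectory_of_solvesBarotropic [ConnectedSpace M] (hJ : IsOpen J)
    (hJc : J.OrdConnected) {V : M → ℝ} (hV : ContMDiff (𝓡 n) 𝓘(ℝ, ℝ) ∞ V) {f : ℝ → ℝ}
    (hf : ContDiffOn ℝ ∞ f (Ioi 0)) {c : ℝ → CotDens g} {ρ θ : ℝ → CR n M}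
    (hc : RepresentsCot g J c ρ θ)
    (h : SolvesBarotropic g V f J (fun t => ρ t) (fun t => grad g (θ t))) :
    IsHamTrajectory g V f J c := by
  obtain ⟨hρ, hθ, hr⟩ := hc
  have h0 : ∀ t ∈ J, ∀ x, 0 < ρ t x := fun t ht => (hr t ht).1.1
  obtain ⟨x₀⟩ := (inferInstance : Nonempty M)
  have hconst : ∀ t ∈ J, ∀ x, hamiltonJacobi g V f ρ θ t x = hamiltonJacobi g V f ρ θ t x₀ :=
    fun t ht x => eq_of_grad_eq_zero g (contMDiff_hamiltonJacobi g hJ hV hf hθ ht (h0 t ht))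
      (fun x => by
        rw [← timeDeriv_add_covDeriv_add_grad g hJ hV hf hθ ht (h0 t ht)]
        exact (h t ht x).1) x x₀
  have hb := (contDiffOn_hamiltonJacobi_slice (V := V) g hJ hf hρ hθ h0 x₀).neg
  obtain ⟨a, ha⟩ := exists_hasDerivAt_of_continuousOn hJ hJc hb.continuousOn
  have has := contDiffOn_of_hasDerivAt hJ hb ha
  let θ' : ℝ → CR n M := fun t => θ t + smoothConst (a t)
  have hθ' : ∀ t x, θ' t x = θ t x + a t := fun _ _ => rfl
  have hgrad : ∀ t, grad g (θ' t) = grad g (θ t) := fun t =>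
    grad_add_const g (θ t).contMDiff (hθ' t)
  refine ⟨ρ, θ', ⟨hρ, ?_, fun t ht => ?_⟩, fun t ht x => ?_⟩
  · have h1 : ContMDiffOn (𝓘(ℝ, ℝ).prod (𝓡 n)) 𝓘(ℝ, ℝ) ∞ (fun p : ℝ × M => a p.1)
        (J ×ˢ univ) := has.contMDiffOn.comp contMDiffOn_fst fun p hp => hp.1
    exact ContMDiffOn.add hθ h1
  · obtain ⟨hm, e⟩ := hr t ht
    refine ⟨hm, ?_⟩
    rw [← e]
    exact cotMk_eq_cotMk g (fun _ => rfl) (hθ' t)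
  · have hd : deriv (fun s => θ' s x) t =
        deriv (fun s => θ s x) t - hamiltonJacobi g V f ρ θ t x₀ :=
      ((JointlySmooth.hasDerivAt hJ hθ ht x).add (ha t ht)).deriv
    refine ⟨?_, ?_⟩
    · simp only [hd, hgrad]
      have := hconst t ht x
      rw [hamiltonJacobi] at this
      linarith
    · simp only [hgrad]
      exact (h t ht x).2

/-- The solution of (A) behind a trajectory may use another representative, but it has the same ρ,
and its θ differs by a constant at each time. The velocity ∇θ is therefore the same. -/
theorem isHamTrajectory_iff_solvesBarotropic [ConnectedSpace M] (hJ : IsOpen J)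
    (hJc : J.OrdConnected) {V : M → ℝ} (hV : ContMDiff (𝓡 n) 𝓘(ℝ, ℝ) ∞ V) {f : ℝ → ℝ}
    (hf : ContDiffOn ℝ ∞ f (Ioi 0)) {c : ℝ → CotDens g} {ρ θ : ℝ → CR n M}
    (hc : RepresentsCot g J c ρ θ) :
    IsHamTrajectory g V f J c ↔
      SolvesBarotropic g V f J (fun t => ρ t) (fun t => grad g (θ t)) := by
  refine ⟨?_, isHamTrajectory_of_solvesBarotropic g hJ hJc hV hf hc⟩
  rintro ⟨ρ', θ', ⟨-, hθ', hr'⟩, hs⟩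
  have e : ∀ t ∈ J, ρ' t = ρ t ∧ grad g (θ' t) = grad g (θ t) := fun t ht => by
    obtain ⟨hm, e⟩ := hc.2.2 t ht
    obtain ⟨hm', e'⟩ := hr' t ht
    obtain ⟨h1, c, h2⟩ := exists_of_cotMk_eq g (e'.trans e.symm)
    exact ⟨h1, grad_add_const g (θ t).contMDiff h2⟩
  exact solvesBarotropic_congr g hJ (fun t ht => by rw [(e t ht).1]) (fun t ht => (e t ht).2)
    (solvesBarotropic_of_solvesHam g hJ hV hf hθ' (fun t ht => (hr' t ht).1.1) hs)

end Barotropic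

end Madelung

end

/-! ### Assembly of the main theorem. -/

theorem mainTheorem10 {n : ℕ} {M : Type*} [TopologicalSpace M]
    [ChartedSpace (EuclideanSpace ℝ (Fin n)) M] [IsManifold (𝓡 n) ∞ M] [T2Space M] [CompactSpace M]
    [ConnectedSpace M] [MeasurableSpace M] [BorelSpace M]
    (g : Madelung.Metric n M) (V : Madelung.CR n M) (f F : ℝ → ℝ)
    (hf : ContDiffOn ℝ ∞ f (Ioi 0)) (hF : ∀ a > 0, HasDerivAt F (f a) a) :
    -- the Madelung transform is a symplectomorphism onto an open subset
    (Madelung.IsSymplectomorphismOnto g (Madelung.madelung g) (range (Madelung.madelung g)) ∧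
      range (Madelung.madelung g) ⊆ Madelung.nonvanishing g ∧
      (SimplyConnectedSpace M → range (Madelung.madelung g) = Madelung.nonvanishing g)) ∧
    -- the system on the cotangent bundle is the Hamiltonian system of the stated potential
    (∀ p ∈ Madelung.cotPairs g,
      Madelung.IsVariationalDeriv g (Madelung.potential g V F) p.1
        (Madelung.quantumPotential g V f p.1) ∧
      ∀ Y : Madelung.CR n M × Madelung.CR n M, ∫ x, Y.1 x ∂(Madelung.vol g) = 0 →
        HasDerivAt (fun ε : ℝ => Madelung.cotHamiltonian g V F
            (fun x => p.1 x + ε * Y.1 x, fun x => p.2 x + ε * Y.2 x))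
          (Madelung.cotForm g (Madelung.cotField g V f (p.1, p.2)) (Y.1, Y.2)) 0) ∧
    -- the Schrodinger equation is Hamiltonian
    (∀ ψ : Madelung.CC n M, (∀ x, ψ x ≠ 0) → ∀ η : Madelung.CC n M,
      HasDerivAt (fun ε : ℝ => Madelung.waveHamiltonian g V F (fun x => ψ x + ε * η x))
        (Madelung.waveForm g (fun x => -Complex.I * Madelung.schrodingerOp g V f ψ x) η) 0) ∧
    -- the Hamiltonians correspond to each other
    (∀ p ∈ Madelung.cotPairs g,
      4 * Madelung.waveHamiltonian g V F (Madelung.madelungFun p.1 p.2) =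
        Madelung.cotHamiltonian g V F (p.1, p.2)) ∧
    -- the solutions correspond to each other
    (∀ J : Set ℝ, IsOpen J → J.OrdConnected →
      (∀ ρ θ : ℝ → Madelung.CR n M, Madelung.JointlySmooth J ρ → Madelung.JointlySmooth J θ →
        (∀ t ∈ J, ∀ x, 0 < ρ t x) →
        (Madelung.SolvesHam g V f J (fun t => ρ t) (fun t => θ t) ↔
          Madelung.SolvesSchrodinger g V f J (fun t => Madelung.madelungFun (ρ t) (θ t)))) ∧
      (∀ c : ℝ → Madelung.CotDens g,
        (Madelung.IsHamTrajectory g V f J c ↔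
          Madelung.IsSchrodingerTrajectory g V f J (fun t => Madelung.madelung g (c t))) ∧
        ∀ ρ θ : ℝ → Madelung.CR n M, Madelung.RepresentsCot g J c ρ θ →
          (Madelung.IsHamTrajectory g V f J c ↔
            Madelung.SolvesBarotropic g V f J (fun t => ρ t)
              (fun t => Madelung.grad g (θ t))))) :=
  ⟨⟨Madelung.isSymplectomorphismOnto_madelung g, Madelung.range_madelung_subset g,
      fun _ => Madelung.range_madelung_eq g⟩,
    fun p hp => ⟨fun α => Madelung.hasDerivAt_potential g V.contMDiff hf hF p.1.contMDiff hp.1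
        α.contMDiff,
      fun Y _ => Madelung.hasDerivAt_cotHamiltonian g V.contMDiff hf hF p.1.contMDiff hp.1
        p.2.contMDiff Y.1.contMDiff Y.2.contMDiff⟩,
    fun ψ h0 η => Madelung.hasDerivAt_waveHamiltonian g V.contMDiff hf hF ψ.contMDiff h0
      η.contMDiff,
    fun p hp => Madelung.four_mul_waveHamiltonian_madelungFun g V.contMDiff
      (fun a ha => (hF a ha).continuousAt.continuousWithinAt) p.1.contMDiff hp.1 p.2.contMDiff,
    fun _ hJ hJc => ⟨fun _ _ hρ hθ h0 => Madelung.solvesHam_iff_solvesSchrodinger g hJ V f hρ hθ h0,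
      fun _ => ⟨⟨Madelung.isSchrodingerTrajectory_of_isHamTrajectory g hJ,
        Madelung.isHamTrajectory_of_isSchrodingerTrajectory g hJ hJc⟩,
      fun _ _ hc => Madelung.isHamTrajectory_iff_solvesBarotropic g hJ hJc V.contMDiff hf hc⟩⟩⟩
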